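/- Let $\mathbb O$ be the octonions with imaginary units $i,j,k,k\ell,j\ell,i\ell,\ell$, and let $\mathbb O'$ be the split octonions with imaginary units $I,J,K,KL,JL,IL,L$ ($L^2=+1$); both are Cayley–Dickson doubles of the quaternions. Let $\mathfrak e_8=\mathfrak e_{8(-24)}\cong\mathfrak{su}(3,\mathbb O'\otimes\mathbb O)$ be the Lie algebra of generalized $3\times3$ matrices over $\mathbb O'\otimes\mathbb O$. It is spanned by the anti-Hermitian matrices $X_p$ ($p$ at position $(1,2)$, $-\bar p$ at $(2,1)$), $Y_p$ ($p$ at $(2,3)$, $-\bar p$ at $(3,2)$), $Z_p$ ($p$ at $(3,1)$, $-\bar p$ at $(1,3)$), $p\in\mathbb O'\otimes\mathbb O$, and by the commutators $[X_p,X_q]$, $[Y_p,Y_q]$, $[Z_p,Z_q]$, computed with products of entries read as compositions of left multiplications (written $p\circ q$); these commutators span the diagonal part $\mathfrak{so}(4,4)\oplus\mathfrak{so}(8)$. Each diagonal element is identified with its action on the off-diagonal matrices (triality), and $[X_p,Y_q]=Z_{-\overline{pq}}$, $[Y_p,Z_q]=X_{-\overline{pq}}$, $[Z_p,X_q]=Y_{-\overline{pq}}$.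 Put $$D_q=\tfrac12[X_1,X_q],\quad E_q=\tfrac12[Y_1,Y_q],\quad F_q=\tfrac12[Z_1,Z_q],\quad S_q=E_q-F_q,$$ $$D_{p,q}=\tfrac12[X_p,X_q],\quad E_{p,q}=\tfrac12[Y_p,Y_q],\quad F_{p,q}=\tfrac12[Z_p,Z_q],\quad (p\circ q)\,\mathcal I=\tfrac12(D_{p,q}+E_{p,q}+F_{p,q}),$$ the last for orthogonal imaginary $p,q$. An ordinary anti-Hermitian trace-free matrix $M$ over $\mathbb O'\otimes\mathbb O$ is the element $X_{M_{12}}+Y_{M_{23}}+Z_{M_{31}}+D_{M_{11}}-E_{M_{33}}$. For each imaginary unit $p$ of $\mathbb O$ let $(a(p),b(p),c(p))$ be the three pairs of units generating the quaternionic subalgebras containing $p$: $i:(j,k),(k\ell,j\ell),(\ell,i\ell)$; $j:(k,i),(i\ell,k\ell),(\ell,j\ell)$; $k:(i,j),(j\ell,i\ell),(\ell,k\ell)$; $k\ell:(j\ell,i),(j,i\ell),(k,\ell)$; $j\ell:(i\ell,k),(i,k\ell),(j,\ell)$; $i\ell:(k\ell,j),(k,j\ell),(i,\ell)$; $\ell:(i\ell,i),(j\ell,j),(k\ell,k)$.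 Put $-A_p=D_{a(p)}-D_{b(p)}$ and $-G_p=D_{a(p)}+D_{b(p)}-2D_{c(p)}$, where $D_{(u,v)}$ means $D_{u,v}$. For $Q\in\mathrm{span}\{I,J,K,KL,JL,IL\}$ put $G_Q=-2\,(QL\circ L)\,\mathcal I$ and $$\mathrm H_Q=\langle X_{pQ},\,Y_{pQ},\,Z_{pQ}\ (p\in\{1,i,j,k,k\ell,j\ell,i\ell,\ell\}),\ D_Q,\,S_Q,\,G_Q\rangle .$$ Let $\mathfrak e_6=\mathfrak e_{6(-26)}\subset\mathfrak e_8$ be the Lie subalgebra generated by the 78 elements $A_p,G_p,S_p,D_p$ ($p$ an imaginary unit of $\mathbb O$), $X_q,Y_q,Z_q,X_{qL},Y_{qL},Z_{qL}$ ($q$ such a unit or $1$), $D_L$, $S_L$. Let $\mathrm H_3(\mathbb O)$ be the Albert algebra of $3\times3$ octonionic Hermitian matrices. For an octonionic matrix $\mathcal M$ let $\rho(\mathcal M)$ be the operator $\mathcal P\mapsto\mathcal M\mathcal P+\mathcal P\mathcal M^\dagger$ on $\mathrm H_3(\mathbb O)$, and let $\mathfrak{sl}(3,\mathbb O)\subset\mathfrak{gl}(\mathrm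 H_3(\mathbb O))$ be the Lie algebra generated by all $\rho(\mathcal M)$ with $\mathcal M$ trace-free and anti-Hermitian or Hermitian. For $Q$ as above and $\mathcal P=\mathcal P_0+\frac{\operatorname{tr}\mathcal P}{3}\mathcal I\in\mathrm H_3(\mathbb O)$ with $\mathcal P_0$ trace-free, let $Q\mathcal P\in\mathfrak e_8$ be the anti-Hermitian matrix $Q\mathcal P_0$ plus $\frac{\operatorname{tr}\mathcal P}{3}\cdot(-\frac12G_Q)$; that is, "$Q\mathcal I$" is read as $-\frac12G_Q$. Then: 1. The 78 generators of $\mathfrak e_6$ are linearly independent and their span is closed under the commutator. 2. There is an isomorphism of Lie algebras $\Phi:\mathfrak e_6\to\mathfrak{sl}(3,\mathbb O)$ such that, for every trace-free anti-Hermitian octonionic matrix $\mathcal A$ and every trace-free Hermitian octonionic matrix $\mathcal B$, the matrices $\mathcal A$ and $\mathcal BL$ lie in $\mathfrak e_6$, and $\Phi(\mathcal A)=\rho(\mathcal A)$, $\Phi(\mathcal BL)=\rho(\mathcal B)$. 3. For each of the six null labels $Q$ with $2Q\in\{I\pm IL,\,J\pm JL,\,K\pm KL\}$, the space $\mathrm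 H_Q$ has dimension 27 and is a representation of $\mathfrak e_6$ under the commutator of $\mathfrak e_8$. The map $\mathcal P\mapsto Q\mathcal P$ is a linear bijection $\mathrm H_3(\mathbb O)\to\mathrm H_Q$, and for all $\mathcal A$, $\mathcal B$ as in 2 and all $\mathcal P\in\mathrm H_3(\mathbb O)$ $$[\mathcal A,Q\mathcal P]=Q\,(\mathcal A\mathcal P+\mathcal P\mathcal A^\dagger),\qquad[\mathcal BL,Q\mathcal P]=(LQ)\,(\mathcal B\mathcal P+\mathcal P\mathcal B^\dagger).$$ 4. Each label satisfies $LQ=Q$ or $LQ=-Q$, and three labels satisfy each. If $LQ=Q$, then $[x,Q\mathcal P]=Q\,\Phi(x)\mathcal P$ for all $x\in\mathfrak e_6$ and $\mathcal P\in\mathrm H_3(\mathbb O)$, so $\mathrm H_Q$ is equivalent to the action of $\mathfrak e_6$ on the Albert algebra (the $27$). If $LQ=-Q$, then $\mathrm H_Q$ is equivalent to the dual of that representation (the $\overline{27}$). For two labels $Q,R$ the representations $\mathrm H_Q$ and $\mathrm H_R$ are equivalent if and only if the signs in $LQ=\pm Q$ and $LR=\pm R$ agree. -/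

import Mathlib

open scoped TensorProduct Quaternion Matrix
attribute [local instance 100] LieRing.ofAssociativeRing

noncomputable section

/-! ## Octonions and split octonions -/

/-- The Cayley-Dickson double `ℍ ⊕ ℍℓ` of the quaternions with `ℓ² = γ`; the pair `(a, b)` stands
for `a + bℓ`.  The octonions are the case `γ = -1`, the split octonions the case `γ = 1`. -/
def Oct (_γ : ℝ) : Type := ℍ[ℝ] × ℍ[ℝ]

namespace Oct
variable {γ : ℝ}

instance : AddCommGroup (Oct γ) := inferInstanceAs (AddCommGroup (ℍ[ℝ] × ℍ[ℝ]))
instance : Module ℝ (Oct γ) := inferInstanceAs (Module ℝ (ℍ[ℝ] × ℍ[ℝ]))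
instance : Mul (Oct γ) :=
  ⟨fun x y => (x.1 * y.1 + γ • (star y.2 * x.2), y.2 * x.1 + x.2 * star y.1)⟩
instance : One (Oct γ) := ⟨(1, 0)⟩
/-- Octonionic conjugation. -/
instance : Star (Oct γ) := ⟨fun x => (star x.1, -x.2)⟩

theorem ext {x y : Oct γ} (h1 : x.1 = y.1) (h2 : x.2 = y.2) : x = y := Prod.ext h1 h2
@[simp] theorem mul_fst (x y : Oct γ) : (x * y).1 = x.1 * y.1 + γ • (star y.2 * x.2) := rfl
@[simp] theorem mul_snd (x y : Oct γ) : (x * y).2 = y.2 * x.1 + x.2 * star y.1 := rfl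
@[simp] theorem star_fst (x : Oct γ) : (star x).1 = star x.1 := rfl
@[simp] theorem star_snd (x : Oct γ) : (star x).2 = -x.2 := rfl
@[simp] theorem one_fst : (1 : Oct γ).1 = 1 := rfl
@[simp] theorem one_snd : (1 : Oct γ).2 = 0 := rfl
@[simp] theorem zero_fst : (0 : Oct γ).1 = 0 := rfl
@[simp] theorem zero_snd : (0 : Oct γ).2 = 0 := rfl
@[simp] theorem add_fst (x y : Oct γ) : (x + y).1 = x.1 + y.1 := rfl
@[simp] theorem add_snd (x y : Oct γ) : (x + y).2 = x.2 + y.2 := rfl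
@[simp] theorem neg_fst (x : Oct γ) : (-x).1 = -x.1 := rfl
@[simp] theorem neg_snd (x : Oct γ) : (-x).2 = -x.2 := rfl
@[simp] theorem smul_fst (r : ℝ) (x : Oct γ) : (r • x).1 = r • x.1 := rfl
@[simp] theorem smul_snd (r : ℝ) (x : Oct γ) : (r • x).2 = r • x.2 := rfl

instance : NonAssocRing (Oct γ) :=
  { (inferInstance : AddCommGroup (Oct γ)), (inferInstance : Mul (Oct γ)),
    (inferInstance : One (Oct γ)) with
    left_distrib := fun x y z => by apply ext <;> simp [mul_add, add_mul] <;> abel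
    right_distrib := fun x y z => by apply ext <;> simp [mul_add, add_mul] <;> abel
    zero_mul := fun x => by apply ext <;> simp
    mul_zero := fun x => by apply ext <;> simp
    one_mul := fun x => by apply ext <;> simp
    mul_one := fun x => by apply ext <;> simp }

instance : SMulCommClass ℝ (Oct γ) (Oct γ) :=
  ⟨fun r x y => by apply ext <;> simp [smul_smul, mul_comm]⟩
instance : IsScalarTower ℝ (Oct γ) (Oct γ) :=
  ⟨fun r x y => by apply ext <;> simp [smul_smul, mul_comm]⟩

instance : StarRing (Oct γ) where
  star_involutive x := by apply ext <;> simp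
  star_mul x y := by apply ext <;> simp [add_comm]
  star_add x y := by apply ext <;> simp [add_comm]

instance : StarModule ℝ (Oct γ) := ⟨fun r x => by apply ext <;> simp⟩


/-- The polarised norm `⟨x, y⟩ = Re (x ȳ)`. -/
def ip (x y : Oct γ) : ℝ := (x * star y).1.re

end Oct

/-! ## Composition operators -/

section Composition
/-- Conjugation as a real linear map. -/
def conjL (A : Type*) [NonAssocRing A] [StarRing A] [Module ℝ A] [StarModule ℝ A] :
    A →ₗ[ℝ] A where
  toFun := star
  map_add' := star_add
  map_smul' r a := by simp

@[simp] theorem conjL_apply {A : Type*} [NonAssocRing A] [StarRing A] [Module ℝ A]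
    [StarModule ℝ A] (a : A) : conjL A a = star a := rfl

variable {A : Type*} [NonAssocRing A] [StarRing A] [Module ℝ A] [SMulCommClass ℝ A A]
  [IsScalarTower ℝ A A] [StarModule ℝ A]

/-!
For `a ∈ A` let `X_a` be the `2 × 2` anti-Hermitian matrix with rows `(0, a)` and `(-ā, 0)`.  When
products of entries are read as compositions of left multiplications, the commutator
`X_a X_b - X_b X_a` is the diagonal generalized matrix with entries `topEntry a b`, `botEntry a b`.
-/

/-- The `(1,1)` entry `b ∘ ā - a ∘ b̄` of `X_a X_b - X_b X_a`. -/
def topEntry (a b : A) : Module.End ℝ A :=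
  LinearMap.mulLeft ℝ b ∘ₗ LinearMap.mulLeft ℝ (star a) -
    LinearMap.mulLeft ℝ a ∘ₗ LinearMap.mulLeft ℝ (star b)

/-- The `(2,2)` entry `b̄ ∘ a - ā ∘ b` of `X_a X_b - X_b X_a`. -/
def botEntry (a b : A) : Module.End ℝ A :=
  LinearMap.mulLeft ℝ (star b) ∘ₗ LinearMap.mulLeft ℝ a -
    LinearMap.mulLeft ℝ (star a) ∘ₗ LinearMap.mulLeft ℝ b

/-!
The action of that commutator, placed in the first two rows of a `3 × 3` matrix, on the three kinds
of off-diagonal matrices `X_c` (entry `c` at `(1,2)`), `Y_c` (entry `c` at `(2,3)`) and `Z_c` (entry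
`c` at `(3,1)`, hence `-c̄` at `(1,3)`) is by `X_c ↦ X_{own a b c}`, `Y_c ↦ Y_{next a b c}` and
`Z_c ↦ Z_{prev a b c}`.
-/

/-- The `(1,2)` entry of the commutator of `diag (topEntry a b, botEntry a b)` with `X_c` is the
operator `topEntry a b ∘ c - c ∘ botEntry a b`; evaluated at `1`, it is the element `own a b c`. -/
def own (a b : A) : Module.End ℝ A :=
  topEntry a b - LinearMap.mulRight ℝ (botEntry a b 1)

/-- The action of `botEntry a b` on the `(2,3)` entry. -/
def next (a b : A) : Module.End ℝ A := botEntry a b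

/-- The action of `topEntry a b` on the `(1,3)` entry `-c̄`, read off at the `(3,1)` entry. -/
def prev (a b : A) : Module.End ℝ A := conjL A ∘ₗ topEntry a b ∘ₗ conjL A

theorem own_apply (a b c : A) : own a b c =
    b * (star a * c) - a * (star b * c) + c * (star a * b) - c * (star b * a) := by
  simp [own, topEntry, botEntry, mul_sub]; abel

theorem next_apply (a b c : A) : next a b c = star b * (a * c) - star a * (b * c) := by
  simp [next, botEntry]

theorem prev_apply (a b c : A) : prev a b c = (c * a) * star b - (c * b) * star a := by
  simp [prev, topEntry]

end Composition

namespace Oct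
variable {γ : ℝ}

/-- A quaternion from its coordinates. -/
def mkq (a b c d : ℝ) : ℍ[ℝ] := ⟨a, b, c, d⟩
@[simp] theorem mkq_re (a b c d : ℝ) : (mkq a b c d).re = a := rfl
@[simp] theorem mkq_imI (a b c d : ℝ) : (mkq a b c d).imI = b := rfl
@[simp] theorem mkq_imJ (a b c d : ℝ) : (mkq a b c d).imJ = c := rfl
@[simp] theorem mkq_imK (a b c d : ℝ) : (mkq a b c d).imK = d := rfl

/-- The element with coordinates `a0, …, a7` in the basis `1, i, j, k, ℓ, iℓ, jℓ, kℓ`. -/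
def co (a0 a1 a2 a3 a4 a5 a6 a7 : ℝ) : Oct γ := (mkq a0 a1 a2 a3, mkq a4 a5 a6 a7)
@[simp] theorem co_fst (a0 a1 a2 a3 a4 a5 a6 a7 : ℝ) :
    (co a0 a1 a2 a3 a4 a5 a6 a7 : Oct γ).1 = mkq a0 a1 a2 a3 := rfl
@[simp] theorem co_snd (a0 a1 a2 a3 a4 a5 a6 a7 : ℝ) :
    (co a0 a1 a2 a3 a4 a5 a6 a7 : Oct γ).2 = mkq a4 a5 a6 a7 := rfl

theorem eq_co (a : Oct γ) : ∃ a0 a1 a2 a3 a4 a5 a6 a7, a = co a0 a1 a2 a3 a4 a5 a6 a7 :=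
  ⟨_, _, _, _, _, _, _, _, rfl⟩

theorem co_ext {a b : Oct γ} (h0 : a.1.re = b.1.re) (h1 : a.1.imI = b.1.imI)
    (h2 : a.1.imJ = b.1.imJ) (h3 : a.1.imK = b.1.imK) (h4 : a.2.re = b.2.re)
    (h5 : a.2.imI = b.2.imI) (h6 : a.2.imJ = b.2.imJ) (h7 : a.2.imK = b.2.imK) : a = b :=
  ext (Quaternion.ext _ _ h0 h1 h2 h3) (Quaternion.ext _ _ h4 h5 h6 h7)

theorem co_mul (a0 a1 a2 a3 a4 a5 a6 a7 b0 b1 b2 b3 b4 b5 b6 b7 : ℝ) :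
    (co a0 a1 a2 a3 a4 a5 a6 a7 * co b0 b1 b2 b3 b4 b5 b6 b7 : Oct γ) =
    co (a0*b0-a1*b1-a2*b2-a3*b3 + γ * (b4*a4+b5*a5+b6*a6+b7*a7))
     (a0*b1+a1*b0+a2*b3-a3*b2 + γ * (b4*a5-b5*a4-b6*a7+b7*a6))
     (a0*b2-a1*b3+a2*b0+a3*b1 + γ * (b4*a6+b5*a7-b6*a4-b7*a5))
     (a0*b3+a1*b2-a2*b1+a3*b0 + γ * (b4*a7-b5*a6+b6*a5-b7*a4))
     (b4*a0-b5*a1-b6*a2-b7*a3 + (a4*b0+a5*b1+a6*b2+a7*b3))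
     (b4*a1+b5*a0+b6*a3-b7*a2 + (-a4*b1+a5*b0-a6*b3+a7*b2))
     (b4*a2-b5*a3+b6*a0+b7*a1 + (-a4*b2+a5*b3+a6*b0-a7*b1))
     (b4*a3+b5*a2-b6*a1+b7*a0 + (-a4*b3-a5*b2+a6*b1+a7*b0)) := by
  apply co_ext <;> simp [-mul_eq_mul_left_iff] <;> ring

theorem co_star (a0 a1 a2 a3 a4 a5 a6 a7 : ℝ) : star (co a0 a1 a2 a3 a4 a5 a6 a7 : Oct γ) =
    co a0 (-a1) (-a2) (-a3) (-a4) (-a5) (-a6) (-a7) := by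
  apply co_ext <;> simp

theorem co_add (a0 a1 a2 a3 a4 a5 a6 a7 b0 b1 b2 b3 b4 b5 b6 b7 : ℝ) :
    (co a0 a1 a2 a3 a4 a5 a6 a7 + co b0 b1 b2 b3 b4 b5 b6 b7 : Oct γ) =
    co (a0+b0) (a1+b1) (a2+b2) (a3+b3) (a4+b4) (a5+b5) (a6+b6) (a7+b7) := by
  apply co_ext <;> simp

theorem co_sub (a0 a1 a2 a3 a4 a5 a6 a7 b0 b1 b2 b3 b4 b5 b6 b7 : ℝ) :
    (co a0 a1 a2 a3 a4 a5 a6 a7 - co b0 b1 b2 b3 b4 b5 b6 b7 : Oct γ) =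
    co (a0-b0) (a1-b1) (a2-b2) (a3-b3) (a4-b4) (a5-b5) (a6-b6) (a7-b7) := by
  rw [sub_eq_iff_eq_add, co_add]; simp

theorem co_smul (r a0 a1 a2 a3 a4 a5 a6 a7 : ℝ) : r • (co a0 a1 a2 a3 a4 a5 a6 a7 : Oct γ) =
    co (r*a0) (r*a1) (r*a2) (r*a3) (r*a4) (r*a5) (r*a6) (r*a7) := by
  apply co_ext <;> simp

theorem co_ip (a0 a1 a2 a3 a4 a5 a6 a7 b0 b1 b2 b3 b4 b5 b6 b7 : ℝ) :
    ip (co a0 a1 a2 a3 a4 a5 a6 a7) (co b0 b1 b2 b3 b4 b5 b6 b7 : Oct γ) =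
    a0*b0+a1*b1+a2*b2+a3*b3 - γ * (a4*b4+a5*b5+a6*b6+a7*b7) := by
  rw [ip, co_star, co_mul]; simp; ring

theorem co_congr {a0 a1 a2 a3 a4 a5 a6 a7 b0 b1 b2 b3 b4 b5 b6 b7 : ℝ} (h0 : a0 = b0)
    (h1 : a1 = b1) (h2 : a2 = b2) (h3 : a3 = b3) (h4 : a4 = b4) (h5 : a5 = b5) (h6 : a6 = b6)
    (h7 : a7 = b7) : (co a0 a1 a2 a3 a4 a5 a6 a7 : Oct γ) = co b0 b1 b2 b3 b4 b5 b6 b7 := by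
  subst_vars; rfl

theorem comp_left (a b c : Oct γ) : star a * (b * c) + star b * (a * c) = (2 * ip a b) • c := by
  obtain ⟨a0, a1, a2, a3, a4, a5, a6, a7, rfl⟩ := eq_co a
  obtain ⟨b0, b1, b2, b3, b4, b5, b6, b7, rfl⟩ := eq_co b
  obtain ⟨c0, c1, c2, c3, c4, c5, c6, c7, rfl⟩ := eq_co c
  simp only [co_mul, co_star, co_add, co_smul, co_ip]
  apply co_congr <;> ring

theorem ip_star (a b : Oct γ) : ip (star a) (star b) = ip a b := by
  obtain ⟨a0, a1, a2, a3, a4, a5, a6, a7, rfl⟩ := eq_co a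
  obtain ⟨b0, b1, b2, b3, b4, b5, b6, b7, rfl⟩ := eq_co b
  simp only [co_star, co_ip]; ring

theorem ip_comm (a b : Oct γ) : ip a b = ip b a := by
  obtain ⟨a0, a1, a2, a3, a4, a5, a6, a7, rfl⟩ := eq_co a
  obtain ⟨b0, b1, b2, b3, b4, b5, b6, b7, rfl⟩ := eq_co b
  simp only [co_ip]; ring

theorem ip_cyc (a b c : Oct γ) : ip a (star (b * c)) = ip b (star (c * a)) := by
  obtain ⟨a0, a1, a2, a3, a4, a5, a6, a7, rfl⟩ := eq_co a
  obtain ⟨b0, b1, b2, b3, b4, b5, b6, b7, rfl⟩ := eq_co b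
  obtain ⟨c0, c1, c2, c3, c4, c5, c6, c7, rfl⟩ := eq_co c
  simp only [co_mul, co_star, co_ip]; ring

theorem comp_left' (a b c : Oct γ) : a * (star b * c) + b * (star a * c) = (2 * ip a b) • c := by
  simpa [ip_star] using comp_left (star a) (star b) c

theorem comp_right (a b c : Oct γ) : (c * a) * star b + (c * b) * star a = (2 * ip a b) • c := by
  simpa [ip_comm b a] using congrArg star (comp_left' b a (star c))

theorem comp_right' (a b c : Oct γ) : (c * star a) * b + (c * star b) * a = (2 * ip a b) • c := by
  simpa [ip_star] using comp_right (star a) (star b) c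

theorem own_eq (a b c : Oct γ) : own a b c = (4 * ip a c) • b - (4 * ip b c) • a := by
  rw [own_apply]
  obtain ⟨a0, a1, a2, a3, a4, a5, a6, a7, rfl⟩ := eq_co a
  obtain ⟨b0, b1, b2, b3, b4, b5, b6, b7, rfl⟩ := eq_co b
  obtain ⟨c0, c1, c2, c3, c4, c5, c6, c7, rfl⟩ := eq_co c
  simp only [co_mul, co_star, co_add, co_sub, co_smul, co_ip]
  apply co_congr <;> ring

theorem own_cyc (a b c y : Oct γ) :
    own a (star (b * c)) y + prev b (star (c * a)) y + next c (star (a * b)) y = 0 := by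
  rw [own_eq, prev_apply, next_apply]
  have h1 := comp_right b (star (c * a)) y
  have h2 := comp_left c (star (a * b)) y
  have h3 := congrArg (star c * ·) (comp_right (star a) (star y) (star b))
  have h4 := comp_left c (star (y * b)) a
  rw [ip_cyc b c a] at h1
  rw [ip_star] at h3
  rw [ip_cyc c y b, ip_comm] at h4
  simp only [star_mul, star_star, mul_add, mul_smul_comm] at h1 h2 h3 h4 ⊢
  linear_combination (norm := module) (-1 : ℝ) • h1 + h2 - (2 : ℝ) • h3 + (2 : ℝ) • h4

theorem tri_own (a b x y : Oct γ) :
    own a b (star (x * y)) = star (next a b x * y) + star (x * prev a b y) := by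
  rw [own_eq, prev_apply, next_apply]
  apply star_injective
  have h1 := congrArg (· * y) (comp_left a b x)
  have h2 := congrArg (x * ·) (comp_right a b y)
  have h3 := comp_left (star x) (y * a) (star b)
  have h4 := comp_right (b * x) (star y) (star a)
  rw [ip_comm, ← ip_star, star_star, ip_comm, ← ip_cyc] at h3
  rw [ip_comm, ← ip_star, star_star, ip_cyc] at h4
  rw [star_add, star_star, star_star]
  simp only [star_sub, star_smul, star_mul, mul_add, add_mul, mul_sub, sub_mul,
    mul_smul_comm, smul_mul_assoc, star_trivial] at h1 h2 h3 h4 ⊢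
  linear_combination (norm := module) (-1 : ℝ) • h1 + h2 - (2 : ℝ) • h3 + (2 : ℝ) • h4

theorem tri_next (a b x y : Oct γ) :
    next a b (star (x * y)) = star (prev a b x * y) + star (x * own a b y) := by
  rw [own_eq, prev_apply, next_apply]
  apply star_injective
  have h1 := comp_right' a b (x * y)
  have h2 := congrArg (· * y) (comp_right a b x)
  have h3 := congrArg (· * b) (comp_right a y x)
  have h4 := comp_right' y b (x * a)
  rw [ip_comm y b] at h4
  simp only [star_add, star_sub, star_smul, star_mul, star_star, add_mul, mul_sub,
    sub_mul, mul_smul_comm, smul_mul_assoc, star_trivial] at h1 h2 h3 h4 ⊢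
  linear_combination (norm := module) (-1 : ℝ) • h1 + h2 + (2 : ℝ) • h3 - (2 : ℝ) • h4

theorem star_prev (a b x : Oct γ) : star (prev a b x) = next (star a) (star b) (star x) := by
  simp [prev_apply, next_apply]

theorem star_next (a b x : Oct γ) : star (next a b x) = prev (star a) (star b) (star x) := by
  simp [prev_apply, next_apply]

theorem star_own (a b x : Oct γ) : star (own a b x) = own (star a) (star b) (star x) := by
  simp [own_eq, ip_star]

theorem tri_prev (a b x y : Oct γ) :
    prev a b (star (x * y)) = star (own a b x * y) + star (x * next a b y) := by
  have h := tri_next (star a) (star b) (star y) (star x)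
  apply star_injective
  rw [star_prev]
  simp only [star_add, star_mul, star_star, star_next, star_own] at h ⊢
  rw [h]; abel

end Oct

/-! ## The algebra `𝕆' ⊗ 𝕆` -/

section Additive
variable {A : Type*} [NonAssocRing A] [StarRing A] [Module ℝ A] [SMulCommClass ℝ A A]
  [IsScalarTower ℝ A A] [StarModule ℝ A]

theorem own_add_left (a a' b : A) : own (a + a') b = own a b + own a' b := by
  ext c; simp only [own_apply, LinearMap.add_apply, star_add, add_mul, mul_add]; abel
theorem own_add_right (a b b' : A) : own a (b + b') = own a b + own a b' := by
  ext c; simp only [own_apply, LinearMap.add_apply, star_add, add_mul, mul_add]; abel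
theorem next_add_left (a a' b : A) : next (a + a') b = next a b + next a' b := by
  ext c; simp only [next_apply, LinearMap.add_apply, star_add, add_mul, mul_add]; abel
theorem next_add_right (a b b' : A) : next a (b + b') = next a b + next a b' := by
  ext c; simp only [next_apply, LinearMap.add_apply, star_add, add_mul, mul_add]; abel
theorem prev_add_left (a a' b : A) : prev (a + a') b = prev a b + prev a' b := by
  ext c; simp only [prev_apply, LinearMap.add_apply, star_add, add_mul, mul_add]; abel
theorem prev_add_right (a b b' : A) : prev a (b + b') = prev a b + prev a b' := by
  ext c; simp only [prev_apply, LinearMap.add_apply, star_add, add_mul, mul_add]; abel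
theorem own_smul_left (r : ℝ) (a b : A) : own (r • a) b = r • own a b := by
  ext c; simp only [own_apply, LinearMap.smul_apply, star_smul, star_trivial, smul_mul_assoc,
    mul_smul_comm]; module
theorem own_smul_right (r : ℝ) (a b : A) : own a (r • b) = r • own a b := by
  ext c; simp only [own_apply, LinearMap.smul_apply, star_smul, star_trivial, smul_mul_assoc,
    mul_smul_comm]; module
theorem next_smul_left (r : ℝ) (a b : A) : next (r • a) b = r • next a b := by
  ext c; simp only [next_apply, LinearMap.smul_apply, star_smul, star_trivial, smul_mul_assoc,
    mul_smul_comm]; module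
theorem next_smul_right (r : ℝ) (a b : A) : next a (r • b) = r • next a b := by
  ext c; simp only [next_apply, LinearMap.smul_apply, star_smul, star_trivial, smul_mul_assoc,
    mul_smul_comm]; module
theorem prev_smul_left (r : ℝ) (a b : A) : prev (r • a) b = r • prev a b := by
  ext c; simp only [prev_apply, LinearMap.smul_apply, star_smul, star_trivial, smul_mul_assoc,
    mul_smul_comm]; module
theorem prev_smul_right (r : ℝ) (a b : A) : prev a (r • b) = r • prev a b := by
  ext c; simp only [prev_apply, LinearMap.smul_apply, star_smul, star_trivial, smul_mul_assoc,
    mul_smul_comm]; module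
theorem own_sub_left (a a' b : A) : own (a - a') b = own a b - own a' b := by
  rw [eq_sub_iff_add_eq, ← own_add_left, sub_add_cancel]
theorem own_sub_right (a b b' : A) : own a (b - b') = own a b - own a b' := by
  rw [eq_sub_iff_add_eq, ← own_add_right, sub_add_cancel]
theorem next_sub_left (a a' b : A) : next (a - a') b = next a b - next a' b := by
  rw [eq_sub_iff_add_eq, ← next_add_left, sub_add_cancel]
theorem next_sub_right (a b b' : A) : next a (b - b') = next a b - next a b' := by
  rw [eq_sub_iff_add_eq, ← next_add_right, sub_add_cancel]
theorem prev_sub_left (a a' b : A) : prev (a - a') b = prev a b - prev a' b := by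
  rw [eq_sub_iff_add_eq, ← prev_add_left, sub_add_cancel]
theorem prev_sub_right (a b b' : A) : prev a (b - b') = prev a b - prev a b' := by
  rw [eq_sub_iff_add_eq, ← prev_add_right, sub_add_cancel]
theorem own_self (a : A) : own a a = 0 := by ext c; simp [own_apply]
theorem next_self (a : A) : next a a = 0 := by ext c; simp [next_apply]
theorem prev_self (a : A) : prev a a = 0 := by ext c; simp [prev_apply]
theorem own_swap (a b : A) : own b a = -own a b := by
  ext c; simp only [own_apply, LinearMap.neg_apply]; abel
theorem next_swap (a b : A) : next b a = -next a b := by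
  ext c; simp only [next_apply, LinearMap.neg_apply]; abel
theorem prev_swap (a b : A) : prev b a = -prev a b := by
  ext c; simp only [prev_apply, LinearMap.neg_apply]; abel
end Additive

/-- `𝕆' ⊗ 𝕆`, with the split octonions as left factor. -/
abbrev BiOct : Type := Oct 1 ⊗[ℝ] Oct (-1)

namespace BiOct
open Oct

theorem next_tmul (P R S : Oct 1) (p r s : Oct (-1)) :
    next (P ⊗ₜ[ℝ] p) (R ⊗ₜ[ℝ] r) (S ⊗ₜ[ℝ] s) =
      ip P R • (S ⊗ₜ[ℝ] next p r s) + ip p r • (next P R S ⊗ₜ[ℝ] s) := by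
  simp only [next_apply, Algebra.TensorProduct.tmul_mul_tmul, TensorProduct.star_tmul]
  rw [eq_sub_of_add_eq' (comp_left P R S), eq_sub_of_add_eq' (comp_left p r s)]
  simp only [TensorProduct.sub_tmul, TensorProduct.tmul_sub, ← TensorProduct.smul_tmul',
    TensorProduct.tmul_smul]
  module

theorem prev_tmul (P R S : Oct 1) (p r s : Oct (-1)) :
    prev (P ⊗ₜ[ℝ] p) (R ⊗ₜ[ℝ] r) (S ⊗ₜ[ℝ] s) =
      ip P R • (S ⊗ₜ[ℝ] prev p r s) + ip p r • (prev P R S ⊗ₜ[ℝ] s) := by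
  simp only [prev_apply, Algebra.TensorProduct.tmul_mul_tmul, TensorProduct.star_tmul]
  rw [eq_sub_of_add_eq (comp_right P R S), eq_sub_of_add_eq (comp_right p r s)]
  simp only [TensorProduct.sub_tmul, TensorProduct.tmul_sub, ← TensorProduct.smul_tmul',
    TensorProduct.tmul_smul]
  module

theorem mul_ip {γ : ℝ} (a b c : Oct γ) : c * (star a * b) + c * (star b * a) = (2 * ip a b) • c := by
  have := congrArg (c * ·) (comp_left a b 1)
  simpa [mul_add] using this

theorem own_tmul (P R S : Oct 1) (p r s : Oct (-1)) :
    own (P ⊗ₜ[ℝ] p) (R ⊗ₜ[ℝ] r) (S ⊗ₜ[ℝ] s) =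
      ip P R • (S ⊗ₜ[ℝ] own p r s) + ip p r • (own P R S ⊗ₜ[ℝ] s) := by
  simp only [own_apply, Algebra.TensorProduct.tmul_mul_tmul, TensorProduct.star_tmul]
  rw [eq_sub_of_add_eq' (comp_left' P R S), eq_sub_of_add_eq' (comp_left' p r s),
    eq_sub_of_add_eq' (mul_ip P R S), eq_sub_of_add_eq' (mul_ip p r s)]
  simp only [TensorProduct.sub_tmul, TensorProduct.tmul_sub, TensorProduct.add_tmul,
    TensorProduct.tmul_add, ← TensorProduct.smul_tmul', TensorProduct.tmul_smul]
  module

theorem mul_tmul (P R : Oct 1) (p r : Oct (-1)) :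
    (P ⊗ₜ[ℝ] p) * (R ⊗ₜ[ℝ] r) = (P * R) ⊗ₜ[ℝ] (p * r) :=
  Algebra.TensorProduct.tmul_mul_tmul P R p r

theorem tri_own (a b x y : BiOct) :
    own a b (star (x * y)) = star (next a b x * y) + star (x * prev a b y) := by
  induction a using TensorProduct.induction_on with
  | zero => simp [own_apply, next_apply, prev_apply]
  | add a a' h h' =>
    simp only [own_add_left, next_add_left, prev_add_left, LinearMap.add_apply, add_mul, mul_add,
      star_add, h, h']; abel
  | tmul P p =>
  induction b using TensorProduct.induction_on with
  | zero => simp [own_apply, next_apply, prev_apply]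
  | add a a' h h' =>
    simp only [own_add_right, next_add_right, prev_add_right, LinearMap.add_apply, add_mul,
      mul_add, star_add, h, h']; abel
  | tmul R r =>
  induction x using TensorProduct.induction_on with
  | zero => simp
  | add a a' h h' => simp only [map_add, add_mul, star_add, h, h']; abel
  | tmul S s =>
  induction y using TensorProduct.induction_on with
  | zero => simp
  | add a a' h h' => simp only [map_add, mul_add, star_add, h, h']; abel
  | tmul W w =>
  simp only [mul_tmul, TensorProduct.star_tmul, own_tmul, next_tmul, prev_tmul, Oct.tri_own,
    TensorProduct.tmul_add, TensorProduct.add_tmul, add_mul, mul_add, smul_mul_assoc,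
    mul_smul_comm, star_add, star_smul, star_trivial]
  module

theorem tri_next (a b x y : BiOct) :
    next a b (star (x * y)) = star (prev a b x * y) + star (x * own a b y) := by
  induction a using TensorProduct.induction_on with
  | zero => simp [own_apply, next_apply, prev_apply]
  | add a a' h h' =>
    simp only [own_add_left, next_add_left, prev_add_left, LinearMap.add_apply, add_mul, mul_add,
      star_add, h, h']; abel
  | tmul P p =>
  induction b using TensorProduct.induction_on with
  | zero => simp [own_apply, next_apply, prev_apply]
  | add a a' h h' =>
    simp only [own_add_right, next_add_right, prev_add_right, LinearMap.add_apply, add_mul,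
      mul_add, star_add, h, h']; abel
  | tmul R r =>
  induction x using TensorProduct.induction_on with
  | zero => simp
  | add a a' h h' => simp only [map_add, add_mul, star_add, h, h']; abel
  | tmul S s =>
  induction y using TensorProduct.induction_on with
  | zero => simp
  | add a a' h h' => simp only [map_add, mul_add, star_add, h, h']; abel
  | tmul W w =>
  simp only [mul_tmul, TensorProduct.star_tmul, own_tmul, next_tmul, prev_tmul, Oct.tri_next,
    TensorProduct.tmul_add, TensorProduct.add_tmul, add_mul, mul_add, smul_mul_assoc,
    mul_smul_comm, star_add, star_smul, star_trivial]
  module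

theorem tri_prev (a b x y : BiOct) :
    prev a b (star (x * y)) = star (own a b x * y) + star (x * next a b y) := by
  induction a using TensorProduct.induction_on with
  | zero => simp [own_apply, next_apply, prev_apply]
  | add a a' h h' =>
    simp only [own_add_left, next_add_left, prev_add_left, LinearMap.add_apply, add_mul, mul_add,
      star_add, h, h']; abel
  | tmul P p =>
  induction b using TensorProduct.induction_on with
  | zero => simp [own_apply, next_apply, prev_apply]
  | add a a' h h' =>
    simp only [own_add_right, next_add_right, prev_add_right, LinearMap.add_apply, add_mul,
      mul_add, star_add, h, h']; abel
  | tmul R r =>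
  induction x using TensorProduct.induction_on with
  | zero => simp
  | add a a' h h' => simp only [map_add, add_mul, star_add, h, h']; abel
  | tmul S s =>
  induction y using TensorProduct.induction_on with
  | zero => simp
  | add a a' h h' => simp only [map_add, mul_add, star_add, h, h']; abel
  | tmul W w =>
  simp only [mul_tmul, TensorProduct.star_tmul, own_tmul, next_tmul, prev_tmul, Oct.tri_prev,
    TensorProduct.tmul_add, TensorProduct.add_tmul, add_mul, mul_add, smul_mul_assoc,
    mul_smul_comm, star_add, star_smul, star_trivial]
  module

theorem own_cyc (a b c y : BiOct) :
    own a (star (b * c)) y + prev b (star (c * a)) y + next c (star (a * b)) y = 0 := by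
  induction a using TensorProduct.induction_on with
  | zero => simp [own_apply, next_apply, prev_apply]
  | add a a' h h' =>
    simp only [own_add_left, next_add_right, prev_add_right, LinearMap.add_apply, add_mul,
      mul_add, star_add]
    linear_combination (norm := abel) h + h'
  | tmul P p =>
  induction b using TensorProduct.induction_on with
  | zero => simp [own_apply, next_apply, prev_apply]
  | add a a' h h' =>
    simp only [own_add_right, next_add_right, prev_add_left, LinearMap.add_apply, add_mul,
      mul_add, star_add]
    linear_combination (norm := abel) h + h'
  | tmul R r =>
  induction c using TensorProduct.induction_on with
  | zero => simp [own_apply, next_apply, prev_apply]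
  | add a a' h h' =>
    simp only [own_add_right, next_add_left, prev_add_right, LinearMap.add_apply, add_mul,
      mul_add, star_add]
    linear_combination (norm := abel) h + h'
  | tmul S s =>
  induction y using TensorProduct.induction_on with
  | zero => simp
  | add a a' h h' =>
    simp only [map_add]
    linear_combination (norm := abel) h + h'
  | tmul W w =>
  have h := congrArg (W ⊗ₜ[ℝ] ·) (Oct.own_cyc p r s w)
  have h' := congrArg (· ⊗ₜ[ℝ] w) (Oct.own_cyc P R S W)
  simp only [TensorProduct.tmul_add, TensorProduct.add_tmul, TensorProduct.tmul_zero,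
    TensorProduct.zero_tmul] at h h'
  simp only [mul_tmul, TensorProduct.star_tmul, own_tmul, next_tmul, prev_tmul]
  rw [ip_cyc P R S, ip_cyc p r s, ip_cyc R S P, ip_cyc r s p]
  linear_combination (norm := module) ip S (star (P * R)) • h + ip s (star (p * r)) • h'

theorem own_jacobi (a b c : BiOct) : own a b c + own b c a + own c a b = 0 := by
  simp only [own_apply]
  induction a using TensorProduct.induction_on with
  | zero => simp
  | add a a' h h' =>
    simp only [add_mul, mul_add, star_add] at h h' ⊢
    linear_combination (norm := abel) h + h'
  | tmul P p =>
  induction b using TensorProduct.induction_on with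
  | zero => simp
  | add a a' h h' =>
    simp only [add_mul, mul_add, star_add] at h h' ⊢
    linear_combination (norm := abel) h + h'
  | tmul R r =>
  induction c using TensorProduct.induction_on with
  | zero => simp
  | add a a' h h' =>
    simp only [add_mul, mul_add, star_add] at h h' ⊢
    linear_combination (norm := abel) h + h'
  | tmul S s =>
  simp only [← own_apply, own_tmul, own_eq, ip_comm R P, ip_comm r p, ip_comm S P, ip_comm s p,
    ip_comm S R, ip_comm s r, TensorProduct.tmul_sub, TensorProduct.sub_tmul,
    TensorProduct.tmul_smul, ← TensorProduct.smul_tmul']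
  module

/-- The composition commutator of a diagonal generalized matrix with `X_c` is the operator of left
multiplication by `own a b c`, so that it is again an ordinary matrix. -/
theorem topEntry_comp (a b c : BiOct) :
    topEntry a b ∘ₗ LinearMap.mulLeft ℝ c - LinearMap.mulLeft ℝ c ∘ₗ botEntry a b =
      LinearMap.mulLeft ℝ (own a b c) := by
  refine LinearMap.ext fun x => ?_
  have h := congrArg star (tri_prev a b c x)
  have h' : star (prev a b (star (c * x))) = topEntry a b (c * x) := by
    simp only [prev, LinearMap.comp_apply, conjL_apply, star_star]
  rw [h', star_add, star_star, star_star] at h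
  simp only [LinearMap.sub_apply, LinearMap.comp_apply, LinearMap.mulLeft_apply, h, next,
    add_sub_cancel_right]

end BiOct

/-! ## Generalized matrices and `𝔢₈` -/

/-- Generalized `3 × 3` matrices.  The second component lists the parameters of the off-diagonal
part `X_p + Y_q + Z_r`.  The first component is the (generalized) diagonal part: its values at
`0, 1, 2` are the operators through which it acts, by commutators, on the parameters of `X`, `Y`,
`Z`; this is independent of the type (I, II or III) in which the diagonal part is written. -/
abbrev GMat : Type := (Fin 3 → Module.End ℝ BiOct) × (Fin 3 → BiOct)

namespace GMat

/-- The diagonal part of the composition commutator `[X_a, X_b]` (`t = 0`), `[Y_a, Y_b]` (`t = 1`) or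
`[Z_a, Z_b]` (`t = 2`). -/
def nested (t : Fin 3) (a b : BiOct) : Fin 3 → Module.End ℝ BiOct := fun i =>
  if i = t then own a b else if i = t + 1 then next a b else prev a b

/-- The commutator: diagonal parts act as described, `[X_p, Y_q] = Z_{-conj (pq)}` and cyclically,
and commutators of off-diagonal matrices of the same type are computed by composition. -/
def comm (x y : GMat) : GMat :=
  (fun i => x.1 i ∘ₗ y.1 i - y.1 i ∘ₗ x.1 i + ∑ t, nested t (x.2 t) (y.2 t) i,
   fun i => x.1 i (y.2 i) - y.1 i (x.2 i)
      - star (x.2 (i + 1) * y.2 (i + 2)) + star (y.2 (i + 1) * x.2 (i + 2)))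

/-- The diagonal generalized matrices, spanned by commutators of off-diagonal ones of equal type;
this is `𝔰𝔬(4,4) ⊕ 𝔰𝔬(8)`. -/
def diagonal : Submodule ℝ (Fin 3 → Module.End ℝ BiOct) :=
  Submodule.span ℝ {T | ∃ t a b, T = nested t a b}

theorem nested_self (t : Fin 3) (a b : BiOct) : nested t a b t = own a b := by simp [nested]
theorem nested_add_one (t : Fin 3) (a b : BiOct) : nested t a b (t + 1) = next a b := by
  fin_cases t <;> simp [nested]
theorem nested_add_two (t : Fin 3) (a b : BiOct) : nested t a b (t + 2) = prev a b := by
  fin_cases t <;> simp [nested]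

theorem add1 (i : Fin 3) : i + 1 + 1 = i + 2 := by fin_cases i <;> rfl
theorem add2 (i : Fin 3) : i + 1 + 2 = i := by fin_cases i <;> rfl
theorem add3 (i : Fin 3) : i + 2 + 1 = i := by fin_cases i <;> rfl
theorem add4 (i : Fin 3) : i + 2 + 2 = i + 1 := by fin_cases i <;> rfl

theorem sum_nested (u v : Fin 3 → BiOct) (i : Fin 3) : ∑ t, nested t (u t) (v t) i =
    own (u i) (v i) + prev (u (i + 1)) (v (i + 1)) + next (u (i + 2)) (v (i + 2)) := by
  rw [Fin.sum_univ_three]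
  fin_cases i <;> simp [nested] <;> abel

/-- Compatibility of the three operators of a diagonal generalized matrix (triality). -/
def IsTri (S : Fin 3 → Module.End ℝ BiOct) : Prop :=
  ∀ i x y, S i (star (x * y)) = star (S (i + 1) x * y) + star (x * S (i + 2) y)

theorem isTri_nested (t : Fin 3) (a b : BiOct) : IsTri (nested t a b) := by
  intro i x y
  have : i = t ∨ i = t + 1 ∨ i = t + 2 := by revert i t; decide
  rcases this with rfl | rfl | rfl
  · simp only [nested_self, nested_add_one, nested_add_two, BiOct.tri_own]
  · simp only [nested_self, nested_add_one, nested_add_two, BiOct.tri_next, add1, add2]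
  · simp only [nested_self, nested_add_one, nested_add_two, BiOct.tri_prev, add3, add4]

theorem isTri_diagonal {S : Fin 3 → Module.End ℝ BiOct} (hS : S ∈ diagonal) : IsTri S := by
  induction hS using Submodule.span_induction with
  | mem S h => obtain ⟨t, a, b, rfl⟩ := h; exact isTri_nested t a b
  | zero => intro i x y; simp
  | add S T _ _ h h' =>
    intro i x y
    simp only [Pi.add_apply, LinearMap.add_apply, h i, h' i, add_mul, mul_add, star_add]; abel
  | smul r S _ h =>
    intro i x y
    simp only [Pi.smul_apply, LinearMap.smul_apply, h i, smul_mul_assoc, mul_smul_comm, star_smul,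
      star_trivial, smul_add]

theorem eqv_next {S : Fin 3 → Module.End ℝ BiOct} (hS : IsTri S) (t : Fin 3) (a b c : BiOct) :
    S (t + 1) (next a b c) =
      next a b (S (t + 1) c) + next (S t a) b c + next a (S t b) c := by
  have key : ∀ a b c : BiOct, star b * (a * c) = star (star (a * c) * b) := by simp
  simp only [next_apply, key, map_sub]
  simp only [hS (t + 1), add1, add2, hS (t + 2), add3, add4, add_mul, star_add]
  abel

theorem eqv_prev {S : Fin 3 → Module.End ℝ BiOct} (hS : IsTri S) (t : Fin 3) (a b c : BiOct) :
    S (t + 2) (prev a b c) =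
      prev a b (S (t + 2) c) + prev (S t a) b c + prev a (S t b) c := by
  have key : ∀ a b c : BiOct, (c * a) * star b = star (b * star (c * a)) := by simp
  simp only [prev_apply, key, map_sub]
  simp only [hS (t + 1), add1, add2, hS (t + 2), add3, add4, mul_add, star_add]
  abel

theorem eqv_own {S : Fin 3 → Module.End ℝ BiOct} (hS : IsTri S) (t : Fin 3) (a b c : BiOct) :
    S t (own a b c) = own a b (S t c) + own (S t a) b c + own a (S t b) c := by
  obtain ⟨z, rfl⟩ : ∃ z, c = star (z * 1) := ⟨star c, by simp⟩
  have h1 := eqv_next hS t a b z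
  have h2 := eqv_prev hS t a b 1
  simp only [hS t, BiOct.tri_own, map_add, h1, h2, add_mul, mul_add, star_add]
  abel

theorem comm_nested {S : Fin 3 → Module.End ℝ BiOct} (hS : IsTri S) (t : Fin 3) (a b : BiOct) :
    (fun i => S i ∘ₗ nested t a b i - nested t a b i ∘ₗ S i) =
      nested t (S t a) b + nested t a (S t b) := by
  funext i
  refine LinearMap.ext fun c => ?_
  have : i = t ∨ i = t + 1 ∨ i = t + 2 := by revert i t; decide
  rcases this with rfl | rfl | rfl
  · simp [nested_self, eqv_own hS]; abel
  · simp [nested_add_one, eqv_next hS]; abel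
  · simp [nested_add_two, eqv_prev hS]; abel

theorem comm_mem {S T : Fin 3 → Module.End ℝ BiOct} (hS : S ∈ diagonal) (hT : T ∈ diagonal) :
    (fun i => S i ∘ₗ T i - T i ∘ₗ S i) ∈ diagonal := by
  induction hT using Submodule.span_induction with
  | mem T h =>
    obtain ⟨t, a, b, rfl⟩ := h
    rw [comm_nested (isTri_diagonal hS)]
    exact add_mem (Submodule.subset_span ⟨_, _, _, rfl⟩) (Submodule.subset_span ⟨_, _, _, rfl⟩)
  | zero => convert diagonal.zero_mem using 1; funext i; simp
  | add U V _ _ h h' =>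
    convert add_mem h h' using 1
    funext i; simp [LinearMap.comp_add, LinearMap.add_comp]; abel
  | smul r U _ h =>
    convert diagonal.smul_mem r h using 1
    funext i; simp [LinearMap.comp_smul, LinearMap.smul_comp, smul_sub]

end GMat

/-- `𝔢₈₍₋₂₄₎ = 𝔰𝔲(3, 𝕆' ⊗ 𝕆)`, as a space of generalized matrices. -/
def e8 : Submodule ℝ GMat := GMat.diagonal.prod ⊤

namespace e8
open GMat

theorem comm_mem {x y : GMat} (hx : x ∈ e8) (hy : y ∈ e8) : comm x y ∈ e8 := by
  refine ⟨?_, trivial⟩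
  have h1 := GMat.comm_mem hx.1 hy.1
  have h2 : (∑ t, nested t (x.2 t) (y.2 t)) ∈ diagonal :=
    sum_mem fun t _ => Submodule.subset_span ⟨_, _, _, rfl⟩
  have h3 : (comm x y).1 = (fun i => x.1 i ∘ₗ y.1 i - y.1 i ∘ₗ x.1 i) +
      ∑ t, nested t (x.2 t) (y.2 t) := by
    funext i; simp [GMat.comm]
  change (comm x y).1 ∈ diagonal
  rw [h3]
  exact add_mem h1 h2

instance : Bracket e8 e8 := ⟨fun x y => ⟨comm x y, comm_mem x.2 y.2⟩⟩

theorem lie_fst (x y : e8) (i : Fin 3) (c : BiOct) : (⁅x, y⁆ : e8).1.1 i c =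
    x.1.1 i (y.1.1 i c) - y.1.1 i (x.1.1 i c) + (own (x.1.2 i) (y.1.2 i) c +
      prev (x.1.2 (i + 1)) (y.1.2 (i + 1)) c + next (x.1.2 (i + 2)) (y.1.2 (i + 2)) c) := by
  change (x.1.1 i ∘ₗ y.1.1 i - y.1.1 i ∘ₗ x.1.1 i +
    ∑ t, nested t (x.1.2 t) (y.1.2 t) i) c = _
  rw [sum_nested]; simp

theorem lie_snd (x y : e8) (i : Fin 3) : (⁅x, y⁆ : e8).1.2 i =
    x.1.1 i (y.1.2 i) - y.1.1 i (x.1.2 i)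
      - star (x.1.2 (i + 1) * y.1.2 (i + 2)) + star (y.1.2 (i + 1) * x.1.2 (i + 2)) := rfl

theorem ext {x y : e8} (h1 : ∀ i c, x.1.1 i c = y.1.1 i c) (h2 : ∀ i, x.1.2 i = y.1.2 i) :
    x = y :=
  Subtype.ext (Prod.ext (funext fun i => LinearMap.ext (h1 i)) (funext h2))

@[simp] theorem add_fst (x y : e8) (i : Fin 3) : (x + y).1.1 i = x.1.1 i + y.1.1 i := rfl
@[simp] theorem add_snd (x y : e8) (i : Fin 3) : (x + y).1.2 i = x.1.2 i + y.1.2 i := rfl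
@[simp] theorem smul_fst (r : ℝ) (x : e8) (i : Fin 3) : (r • x).1.1 i = r • x.1.1 i := rfl
@[simp] theorem smul_snd (r : ℝ) (x : e8) (i : Fin 3) : (r • x).1.2 i = r • x.1.2 i := rfl

theorem jacobi_snd (x y z : e8) (i : Fin 3) :
    (⁅x, ⁅y, z⁆⁆ : e8).1.2 i = (⁅⁅x, y⁆, z⁆ + ⁅y, ⁅x, z⁆⁆ : e8).1.2 i := by
  have hx := isTri_diagonal x.2.1
  have hy := isTri_diagonal y.2.1
  have hz := isTri_diagonal z.2.1
  have key1 : ∀ a b c : BiOct, star b * (a * c) = star (star (a * c) * b) := by simp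
  have key2 : ∀ a b c : BiOct, (c * a) * star b = star (b * star (c * a)) := by simp
  have hj := BiOct.own_jacobi (x.1.2 i) (y.1.2 i) (z.1.2 i)
  have hs := own_swap (x.1.2 i) (z.1.2 i)
  have hj' : own (z.1.2 i) (x.1.2 i) (y.1.2 i) = - own (x.1.2 i) (z.1.2 i) (y.1.2 i) := by
    rw [hs]; simp
  rw [hj'] at hj
  simp only [add_snd, lie_snd, lie_fst, add1, add2, add3, add4, map_add, map_sub, hx i, hy i,
    hz i, mul_add, mul_sub, add_mul, sub_mul, star_add, star_sub, next_apply, prev_apply, key1,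
    key2]
  linear_combination (norm := abel) -hj

theorem jacobi_fst (x y z : e8) (i : Fin 3) (c : BiOct) :
    (⁅x, ⁅y, z⁆⁆ : e8).1.1 i c = (⁅⁅x, y⁆, z⁆ + ⁅y, ⁅x, z⁆⁆ : e8).1.1 i c := by
  have hx := isTri_diagonal x.2.1
  have hy := isTri_diagonal y.2.1
  have hz := isTri_diagonal z.2.1
  have hp : ∀ {S : Fin 3 → Module.End ℝ BiOct}, IsTri S → ∀ a b c : BiOct,
      S i (prev a b c) = prev a b (S i c) + prev (S (i + 1) a) b c + prev a (S (i + 1) b) c := by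
    intro S hS a b c
    have := eqv_prev hS (i + 1) a b c
    rwa [add2] at this
  have hn : ∀ {S : Fin 3 → Module.End ℝ BiOct}, IsTri S → ∀ a b c : BiOct,
      S i (next a b c) = next a b (S i c) + next (S (i + 2) a) b c + next a (S (i + 2) b) c := by
    intro S hS a b c
    have := eqv_next hS (i + 2) a b c
    rwa [add3] at this
  have swap : ∀ (x y z : e8), own (z.1.2 i) (star (x.1.2 (i + 1) * y.1.2 (i + 2))) c =
      - own (star (x.1.2 (i + 1) * y.1.2 (i + 2))) (z.1.2 i) c := by
    intro x y z; rw [own_swap]; simp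
  have swap1 : ∀ (x y z : e8), prev (z.1.2 (i + 1)) (star (x.1.2 (i + 2) * y.1.2 i)) c =
      - prev (star (x.1.2 (i + 2) * y.1.2 i)) (z.1.2 (i + 1)) c := by
    intro x y z; rw [prev_swap]; simp
  have swap2 : ∀ (x y z : e8), next (z.1.2 (i + 2)) (star (x.1.2 i * y.1.2 (i + 1))) c =
      - next (star (x.1.2 i * y.1.2 (i + 1))) (z.1.2 (i + 2)) c := by
    intro x y z; rw [next_swap]; simp
  have hc : ∀ x y z : e8, _ := fun x y z =>
    BiOct.own_cyc (x.1.2 i) (y.1.2 (i + 1)) (z.1.2 (i + 2)) c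
  have h1 := hc x y z
  have h2 := hc x z y
  have h3 := hc y x z
  have h4 := hc y z x
  have h5 := hc z x y
  have h6 := hc z y x
  have s1 := LinearMap.congr_fun (own_swap (z.1.1 i (x.1.2 i)) (y.1.2 i)) c
  have s2 := LinearMap.congr_fun (prev_swap (z.1.1 (i + 1) (x.1.2 (i + 1))) (y.1.2 (i + 1))) c
  have s3 := LinearMap.congr_fun (next_swap (z.1.1 (i + 2) (x.1.2 (i + 2))) (y.1.2 (i + 2))) c
  simp only [LinearMap.neg_apply] at s1 s2 s3
  simp only [swap, swap1, swap2] at h1 h2 h3 h4 h5 h6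
  simp only [add_fst, LinearMap.add_apply, lie_snd, lie_fst, add1, add2, add3, add4, map_add,
    map_sub, eqv_own hx, eqv_own hy, eqv_own hz, hp hx, hp hy, hp hz, hn hx, hn hy, hn hz,
    own_add_left, own_add_right, own_sub_left, own_sub_right, next_add_left, next_add_right,
    next_sub_left, next_sub_right, prev_add_left, prev_add_right, prev_sub_left, prev_sub_right,
    LinearMap.sub_apply, swap, swap1, swap2]
  linear_combination (norm := abel) -h1 + h2 + h3 - h4 - h5 + h6 + s1 + s2 + s3

instance : LieRing e8 where
  add_lie x y z := by
    refine ext (fun i c => ?_) (fun i => ?_)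
    · simp only [add_fst, lie_fst, LinearMap.add_apply, add_snd, own_add_left, prev_add_left,
        next_add_left, map_add]; abel
    · simp only [add_snd, lie_snd, add_fst, LinearMap.add_apply, map_add, add_mul, mul_add,
        star_add]; abel
  lie_add x y z := by
    refine ext (fun i c => ?_) (fun i => ?_)
    · simp only [add_fst, lie_fst, LinearMap.add_apply, add_snd, own_add_right, prev_add_right,
        next_add_right, map_add]; abel
    · simp only [add_snd, lie_snd, add_fst, LinearMap.add_apply, map_add, add_mul, mul_add,
        star_add]; abel
  lie_self x := by
    refine ext (fun i c => ?_) (fun i => ?_)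
    · simp [lie_fst, own_self, next_self, prev_self]
    · simp [lie_snd]
  leibniz_lie x y z := ext (jacobi_fst x y z) (jacobi_snd x y z)

instance : LieAlgebra ℝ e8 where
  lie_smul r x y := by
    refine ext (fun i c => ?_) (fun i => ?_)
    · simp only [smul_fst, lie_fst, LinearMap.smul_apply, smul_snd, own_smul_right,
        prev_smul_right, next_smul_right, map_smul]; module
    · simp only [smul_snd, lie_snd, smul_fst, LinearMap.smul_apply, map_smul, smul_mul_assoc,
        mul_smul_comm, star_smul, star_trivial]; module

/-- The off-diagonal matrix of type `t` with parameter `p`. -/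
def off (t : Fin 3) (p : BiOct) : e8 := ⟨(0, Pi.single t p), diagonal.zero_mem, trivial⟩

/-- `p` at `(1,2)`, `-p̄` at `(2,1)`. -/
def X (p : BiOct) : e8 := off 0 p
/-- `p` at `(2,3)`, `-p̄` at `(3,2)`. -/
def Y (p : BiOct) : e8 := off 1 p
/-- `p` at `(3,1)`, `-p̄` at `(1,3)`. -/
def Z (p : BiOct) : e8 := off 2 p

/-- `D_q = diag (q, -q, 0)`. -/
def D (q : BiOct) : e8 := (1 / 2 : ℝ) • ⁅X 1, X q⁆
/-- `E_q = diag (0, q, -q)`. -/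
def E (q : BiOct) : e8 := (1 / 2 : ℝ) • ⁅Y 1, Y q⁆
/-- `F_q = diag (-q, 0, q)`. -/
def F (q : BiOct) : e8 := (1 / 2 : ℝ) • ⁅Z 1, Z q⁆

/-- `D_{p,q} = diag (p ∘ q, p ∘ q, 0)` for orthogonal imaginary `p`, `q`. -/
def DD (p q : BiOct) : e8 := (1 / 2 : ℝ) • ⁅X p, X q⁆
/-- `E_{p,q} = diag (0, p ∘ q, p ∘ q)` for orthogonal imaginary `p`, `q`. -/
def EE (p q : BiOct) : e8 := (1 / 2 : ℝ) • ⁅Y p, Y q⁆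
/-- `F_{p,q} = diag (p ∘ q, 0, p ∘ q)` for orthogonal imaginary `p`, `q`. -/
def FF (p q : BiOct) : e8 := (1 / 2 : ℝ) • ⁅Z p, Z q⁆

/-- `S_q = E_q - F_q = diag (q, q, -2q)`. -/
def S (q : BiOct) : e8 := E q - F q

/-- `(p ∘ q) 𝓘`, for orthogonal imaginary `p`, `q`. -/
def nestedScalar (p q : BiOct) : e8 := (1 / 2 : ℝ) • (DD p q + EE p q + FF p q)

theorem off_add (t : Fin 3) (p q : BiOct) : off t (p + q) = off t p + off t q :=
  Subtype.ext (Prod.ext (by simp [off]) (by simp [off, Pi.single_add]))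

theorem off_smul (t : Fin 3) (r : ℝ) (p : BiOct) : off t (r • p) = r • off t p :=
  Subtype.ext (Prod.ext (by simp [off]) (by simp [off, Pi.single_smul]))

end e8

/-! ## The basis units -/

namespace Oct
variable {γ : ℝ}

def i : Oct γ := co 0 1 0 0 0 0 0 0
def j : Oct γ := co 0 0 1 0 0 0 0 0
def k : Oct γ := co 0 0 0 1 0 0 0 0
def l : Oct γ := co 0 0 0 0 1 0 0 0
def il : Oct γ := co 0 0 0 0 0 1 0 0
def jl : Oct γ := co 0 0 0 0 0 0 1 0
def kl : Oct γ := co 0 0 0 0 0 0 0 1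

/-- The seven imaginary basis units. -/
def unit : Fin 7 → Oct γ := ![i, j, k, kl, jl, il, l]

/-- The eight basis units. -/
def basisUnit : Fin 8 → Oct γ := ![1, i, j, k, kl, jl, il, l]

/-- For each imaginary unit `p`, the three pairs of units `a(p)`, `b(p)`, `c(p)` generating the
quaternionic subalgebras that contain `p`. -/
def pairA : Fin 7 → Oct (-1) × Oct (-1) :=
  ![(j, k), (k, i), (i, j), (jl, i), (il, k), (kl, j), (il, i)]
def pairB : Fin 7 → Oct (-1) × Oct (-1) :=
  ![(kl, jl), (il, kl), (jl, il), (j, il), (i, kl), (k, jl), (jl, j)]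
def pairC : Fin 7 → Oct (-1) × Oct (-1) :=
  ![(l, il), (l, jl), (l, kl), (k, l), (j, l), (i, l), (kl, k)]

end Oct

namespace e8
open Oct

/-- `D_{p,q}` for octonions `p`, `q`. -/
def DO (p : Oct (-1) × Oct (-1)) : e8 := DD (1 ⊗ₜ p.1) (1 ⊗ₜ p.2)

/-- `-A_p = D_{a(p)} - D_{b(p)}`, for the octonionic units `p`. -/
def A (n : Fin 7) : e8 := -(DO (pairA n) - DO (pairB n))

/-- `-G_p = D_{a(p)} + D_{b(p)} - 2 D_{c(p)}`, for the octonionic units `p`. -/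
def G (n : Fin 7) : e8 := -(DO (pairA n) + DO (pairB n) - (2 : ℝ) • DO (pairC n))

/-- `G_Q = -2 (QL ∘ L) 𝓘`, for split octonions `Q` orthogonal to `1` and `L`. -/
def GS (Q : Oct 1) : e8 := (-2 : ℝ) • nestedScalar ((Q * l) ⊗ₜ 1) (l ⊗ₜ 1)

/-! ## `𝔢₆` and the spaces `H_Q` -/

/-- The 78 generators of `𝔢₆`. -/
def e6Generators : Set e8 :=
  Set.range A ∪ Set.range G ∪ Set.range (fun n => S (1 ⊗ₜ unit n)) ∪
  Set.range (fun n => D (1 ⊗ₜ unit n)) ∪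
  Set.range (fun n => X (1 ⊗ₜ basisUnit n)) ∪ Set.range (fun n => Y (1 ⊗ₜ basisUnit n)) ∪
  Set.range (fun n => Z (1 ⊗ₜ basisUnit n)) ∪
  Set.range (fun n => X (l ⊗ₜ basisUnit n)) ∪ Set.range (fun n => Y (l ⊗ₜ basisUnit n)) ∪
  Set.range (fun n => Z (l ⊗ₜ basisUnit n)) ∪ {D (l ⊗ₜ 1), S (l ⊗ₜ 1)}

/-- `𝔢₆₍₋₂₆₎ = 𝔰𝔲(3, ℂ' ⊗ 𝕆)` inside `𝔢₈₍₋₂₄₎`. -/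
def e6 : LieSubalgebra ℝ e8 := LieSubalgebra.lieSpan ℝ e8 e6Generators

/-- `H_Q = ⟨X_{pQ}, Y_{pQ}, Z_{pQ}, D_Q, S_Q, G_Q⟩`. -/
def H (Q : Oct 1) : Submodule ℝ e8 :=
  Submodule.span ℝ (Set.range (fun n => X (Q ⊗ₜ basisUnit n)) ∪
    Set.range (fun n => Y (Q ⊗ₜ basisUnit n)) ∪ Set.range (fun n => Z (Q ⊗ₜ basisUnit n)) ∪
    {D (Q ⊗ₜ 1), S (Q ⊗ₜ 1), GS Q})

/-- The six null labels: `2Q ∈ {I ± IL, J ± JL, K ± KL}`. -/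
def labels : Set (Oct 1) :=
  {Q | (2 : ℝ) • Q ∈ ({i + il, i - il, j + jl, j - jl, k + kl, k - kl} : Set (Oct 1))}

/-- The element of `𝔢₈` given by an ordinary anti-Hermitian trace-free matrix `M` over `𝕆' ⊗ 𝕆`; its
diagonal part is `diag (M₁₁, -M₁₁ - M₃₃, M₃₃) = D_{M₁₁} - E_{M₃₃}`. -/
def ofMatrix (M : Matrix (Fin 3) (Fin 3) BiOct) : e8 :=
  X (M 0 1) + Y (M 1 2) + Z (M 2 0) + D (M 0 0) - E (M 2 2)

/-- The matrix `Q𝓜` over `𝕆' ⊗ 𝕆`, for a split octonion `Q` and an octonionic matrix `𝓜`. -/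
def mulLabel (Q : Oct 1) (M : Matrix (Fin 3) (Fin 3) (Oct (-1))) :
    Matrix (Fin 3) (Fin 3) BiOct := M.map (fun m => Q ⊗ₜ m)

end e8

/-! ## The Albert algebra and the action of `𝔢₆` on it -/

open Matrix in
/-- The Albert algebra `H₃(𝕆)`. -/
def Albert : Submodule ℝ (Matrix (Fin 3) (Fin 3) (Oct (-1))) where
  carrier := {P | Pᴴ = P}
  add_mem' {P R} hP hR := by
    rw [Set.mem_ofPred_eq, Matrix.conjTranspose_add, hP, hR]
  zero_mem' := Matrix.conjTranspose_zero
  smul_mem' r P hP := by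
    rw [Set.mem_ofPred_eq, Matrix.conjTranspose_smul, hP, star_trivial]

namespace Albert

/-- The (real) trace of an element of the Albert algebra. -/
def tr (P : Albert) : ℝ := (Matrix.trace P.1).1.re

/-- The action `P ↦ M P + P M†`. -/
def act (M : Matrix (Fin 3) (Fin 3) (Oct (-1))) : Module.End ℝ Albert where
  toFun P := ⟨M * P.1 + P.1 * Mᴴ, by
    change (M * P.1 + P.1 * Mᴴ)ᴴ = _
    have hP : P.1ᴴ = P.1 := P.2
    rw [Matrix.conjTranspose_add, Matrix.conjTranspose_mul, Matrix.conjTranspose_mul, hP,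
      Matrix.conjTranspose_conjTranspose, add_comm]⟩
  map_add' P R := Subtype.ext (by
    change M * (P.1 + R.1) + (P.1 + R.1) * Mᴴ = (M * P.1 + P.1 * Mᴴ) + (M * R.1 + R.1 * Mᴴ)
    rw [Matrix.mul_add, Matrix.add_mul]; abel)
  map_smul' r P := Subtype.ext (by
    change M * (r • P.1) + (r • P.1) * Mᴴ = r • (M * P.1 + P.1 * Mᴴ)
    rw [Matrix.mul_smul, Matrix.smul_mul, smul_add])

/-- `𝔢₆₍₋₂₆₎ = 𝔰𝔩(3, 𝕆)`, acting on the Albert algebra: the Lie algebra generated by the actions of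
the trace-free anti-Hermitian (rotations) and the trace-free Hermitian (boosts) octonionic
matrices. -/
def sl3O : LieSubalgebra ℝ (Module.End ℝ Albert) :=
  LieSubalgebra.lieSpan ℝ (Module.End ℝ Albert)
    {f | ∃ M : Matrix (Fin 3) (Fin 3) (Oct (-1)), M.trace = 0 ∧ (Mᴴ = -M ∨ Mᴴ = M) ∧ f = act M}

end Albert

namespace e8
open Albert

/-- The element `Q𝓟` of `𝔢₈`: if `𝓟 = 𝓟₀ + (tr 𝓟 / 3) 𝓘` with `𝓟₀` trace-free, then `Q𝓟₀` is an
ordinary anti-Hermitian matrix, and `Q𝓘` stands for `-½ G_Q`. -/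
def labelled (Q : Oct 1) (P : Albert) : e8 :=
  ofMatrix (mulLabel Q (P.1 - (tr P / 3) • 1)) + (tr P / 3) • ((-1 / 2 : ℝ) • GS Q)

/-- The rotation of `𝔢₈` given by an anti-Hermitian trace-free octonionic matrix. -/
def rotation (M : Matrix (Fin 3) (Fin 3) (Oct (-1))) : e8 := ofMatrix (mulLabel 1 M)

/-- The boost `ℬL` of `𝔢₈` given by a Hermitian trace-free octonionic matrix `ℬ`. -/
def boost (M : Matrix (Fin 3) (Fin 3) (Oct (-1))) : e8 := ofMatrix (mulLabel Oct.l M)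

end e8

end

/-!
The diagonal part of the element `QP` of `H_Q` acts on off-diagonal matrices through the split
octonionic factor of their entries alone. This reduces the commutators of `QP` with rotations and
boosts to identities in the two factors of `𝕆' ⊗ 𝕆`, valid for every `Q` in the span of `I`, `J`,
`K`, `KL`, `JL`, `IL`.

Rotations and boosts generate `𝔢₆`, which is `𝔰𝔲(3, ℂ' ⊗ 𝕆)` with `ℂ' = ⟨1, L⟩`: its dimension is
`48 + 28 + 2 = 78`, from the off-diagonal part, `𝔰𝔬(8)`, and the diagonal multiples of `L`.

The isomorphism `Φ` is constructed through its graph, the Lie algebra generated by all pairs of a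
rotation or boost and the operator `P ↦ MP + PM†`. A pair `(0, T)` in it has `T = 0`, because
`H_Q` with `LQ = Q` is a faithful copy of the Albert algebra. In a pair `(x, 0)` the element `x`
kills `H_Q` for every `Q` with `LQ = Q`, and also for every `Q` with `LQ = -Q`, where boosts act
with the opposite sign and the trace form turns `H_Q` into the dual of the Albert algebra. Hence
`x` commutes with all off-diagonal matrices with labels `Q`; these generate `𝔢₈`, so `x = 0`.

The Albert algebra and its dual are told apart by the boost of `diag(1, 1, -2)`, which has the
eigenvalue `-4`, but not `4`, on the Albert algebra.
-/

noncomputable section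

theorem eq_or_eq_add_one_or_eq_add_two (t i : Fin 3) : i = t ∨ i = t + 1 ∨ i = t + 2 := by
  revert i t; decide

theorem sum_univ_three_cyclic {M : Type*} [AddCommMonoid M] (f : Fin 3 → M) (i : Fin 3) :
    ∑ j, f j = f i + f (i + 1) + f (i + 2) := by
  rw [Fin.sum_univ_three]
  fin_cases i
  exacts [rfl, (add_rotate ..).trans rfl, (add_rotate ..).symm.trans rfl]

section Composition
variable {A : Type*} [NonAssocRing A] [StarRing A] [Module ℝ A] [SMulCommClass ℝ A A]
  [IsScalarTower ℝ A A] [StarModule ℝ A]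

/-- The triality triple of `a, b`: the operators through which the commutator of the off-diagonal
matrices of type `t` with parameters `a` and `b` acts on those of type `0, 1, 2`. Over `𝕆' ⊗ 𝕆` it
is `GMat.nested`; here it is available for the octonionic and the split octonionic factor too. -/
def triality (t : Fin 3) (a b : A) : Fin 3 → Module.End ℝ A := fun i =>
  if i = t then own a b else if i = t + 1 then next a b else prev a b

theorem triality_self (t : Fin 3) (a : A) : triality t a a = 0 := by
  funext i; simp [triality, own_self, next_self, prev_self]

theorem sum_smul_triality (w : Fin 3 → ℝ) (a b : A) (i : Fin 3) :
    ∑ t, w t • triality t a b i = w i • own a b + w (i + 1) • prev a b + w (i + 2) • next a b := by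
  rw [Fin.sum_univ_three]
  fin_cases i <;> simp [triality] <;> abel

theorem own_one_of_skew {p : A} (hp : star p = -p) (c : A) :
    own 1 p c = (2 : ℝ) • (p * c) + (2 : ℝ) • (c * p) := by
  rw [own_apply, hp, star_one]; simp only [one_mul, mul_one, neg_mul, mul_neg]; module

theorem next_one_of_skew {p : A} (hp : star p = -p) (c : A) :
    next 1 p c = (-2 : ℝ) • (p * c) := by
  rw [next_apply, hp, star_one]; simp only [one_mul, neg_mul]; module

theorem prev_one_of_skew {p : A} (hp : star p = -p) (c : A) :
    prev 1 p c = (-2 : ℝ) • (c * p) := by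
  rw [prev_apply, hp, star_one]; simp only [mul_one, mul_neg]; module

end Composition

namespace Oct
variable {γ : ℝ}

theorem one_eq_co : (1 : Oct γ) = co 1 0 0 0 0 0 0 0 := by apply co_ext <;> simp

theorem zero_eq_co : (0 : Oct γ) = co 0 0 0 0 0 0 0 0 := by apply co_ext <;> simp

theorem co_neg (a0 a1 a2 a3 a4 a5 a6 a7 : ℝ) : -(co a0 a1 a2 a3 a4 a5 a6 a7 : Oct γ) =
    co (-a0) (-a1) (-a2) (-a3) (-a4) (-a5) (-a6) (-a7) := by
  apply co_ext <;> simp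

/-- The polarised norm `Oct.ip` as a bilinear form. -/
def ipL : Oct γ →ₗ[ℝ] Oct γ →ₗ[ℝ] ℝ :=
  LinearMap.mk₂ ℝ ip (fun a b c => by simp [ip, add_mul])
    (fun r a b => by simp [ip]; ring) (fun a b c => by simp [ip, mul_add])
    (fun r a b => by simp [ip]; ring)

@[simp] theorem ipL_apply (a b : Oct γ) : ipL a b = ip a b := rfl

theorem ip_sub_right (a b c : Oct γ) : ip a (b - c) = ip a b - ip a c := map_sub (ipL a) b c

theorem ip_smul_left (r : ℝ) (a b : Oct γ) : ip (r • a) b = r * ip a b :=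
  LinearMap.map_smul₂ ipL r a b

theorem ip_smul_right (r : ℝ) (a b : Oct γ) : ip a (r • b) = r * ip a b :=
  map_smul (ipL a) r b

theorem ip_neg_left (a b : Oct γ) : ip (-a) b = -ip a b := LinearMap.map_neg₂ ipL a b

theorem ip_neg_right (a b : Oct γ) : ip a (-b) = -ip a b := map_neg (ipL a) b

theorem ip_zero_left (a : Oct γ) : ip 0 a = 0 := LinearMap.map_zero₂ ipL a

theorem ip_zero_right (a : Oct γ) : ip a 0 = 0 := map_zero (ipL a)

theorem ip_one_one : ip (1 : Oct γ) 1 = 1 := by simp [ip]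

theorem ip_one_l : ip (1 : Oct γ) l = 0 := by simp [one_eq_co, l, co_ip]

theorem ip_l_one : ip (l : Oct γ) 1 = 0 := by rw [ip_comm, ip_one_l]

theorem ip_l_l : ip (l : Oct γ) l = -γ := by simp [l, co_ip]

theorem l_mul_l : (l * l : Oct 1) = 1 := by rw [one_eq_co, l, co_mul]; apply co_congr <;> ring

theorem star_l : star (l : Oct γ) = -l := by rw [l, co_star, co_neg, neg_zero]

theorem eq_re_smul_one_of_star_eq {x : Oct γ} (h : star x = x) : x = x.1.re • 1 := by
  obtain ⟨a0, a1, a2, a3, a4, a5, a6, a7, rfl⟩ := eq_co x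
  rw [co_star] at h
  have h1 (f : ℍ[ℝ] → ℝ) := congrArg (fun x : Oct γ => f x.1) h
  have h2 (f : ℍ[ℝ] → ℝ) := congrArg (fun x : Oct γ => f x.2) h
  obtain rfl : a1 = 0 := CharZero.neg_eq_self_iff.1 (h1 (·.imI))
  obtain rfl : a2 = 0 := CharZero.neg_eq_self_iff.1 (h1 (·.imJ))
  obtain rfl : a3 = 0 := CharZero.neg_eq_self_iff.1 (h1 (·.imK))
  obtain rfl : a4 = 0 := CharZero.neg_eq_self_iff.1 (h2 (·.re))
  obtain rfl : a5 = 0 := CharZero.neg_eq_self_iff.1 (h2 (·.imI))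
  obtain rfl : a6 = 0 := CharZero.neg_eq_self_iff.1 (h2 (·.imJ))
  obtain rfl : a7 = 0 := CharZero.neg_eq_self_iff.1 (h2 (·.imK))
  simp [one_eq_co, co_smul]

theorem sum_ip_basisUnit_smul (p : Oct (-1)) :
    ∑ n, ip (basisUnit n) p • (basisUnit n : Oct (-1)) = p := by
  obtain ⟨a0, a1, a2, a3, a4, a5, a6, a7, rfl⟩ := eq_co p
  simp [Fin.sum_univ_eight, basisUnit, one_eq_co, i, j, k, kl, jl, il, l, co_ip, co_smul, co_add]

theorem ip_basisUnit (m n : Fin 8) : ip (basisUnit m : Oct (-1)) (basisUnit n) =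
    if m = n then 1 else 0 := by
  fin_cases m <;> fin_cases n <;>
    simp [basisUnit, one_eq_co, i, j, k, kl, jl, il, l, co_ip]

theorem ip_self_eq_zero {p : Oct (-1)} : ip p p = 0 ↔ p = 0 := by
  refine ⟨fun h => ?_, fun h => by rw [h, ip_zero_left]⟩
  obtain ⟨a0, a1, a2, a3, a4, a5, a6, a7, rfl⟩ := eq_co p
  rw [co_ip] at h
  rw [zero_eq_co]
  apply co_congr <;> nlinarith [sq_nonneg a0, sq_nonneg a1, sq_nonneg a2, sq_nonneg a3,
    sq_nonneg a4, sq_nonneg a5, sq_nonneg a6, sq_nonneg a7]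

end Oct

namespace BiOct
open Oct

theorem nested_tmul (t i : Fin 3) (P R S : Oct 1) (p r s : Oct (-1)) :
    GMat.nested t (P ⊗ₜ p) (R ⊗ₜ r) i (S ⊗ₜ s) =
      ip P R • (S ⊗ₜ triality t p r i s) + ip p r • (triality t P R i S ⊗ₜ s) := by
  unfold GMat.nested triality
  split_ifs
  exacts [own_tmul .., next_tmul .., prev_tmul ..]

/-- Contraction of the split octonionic factor with `R`. -/
def contract (R : Oct 1) : BiOct →ₗ[ℝ] Oct (-1) :=
  (TensorProduct.lid ℝ (Oct (-1))).toLinearMap ∘ₗ LinearMap.rTensor _ (ipL R)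

@[simp] theorem contract_tmul (R S : Oct 1) (s : Oct (-1)) :
    contract R (S ⊗ₜ s) = ip R S • s := by simp [contract]

-- Unification finds a negation on `𝕆' ⊗ 𝕆` that is not syntactically the one of its ring
-- structure, so that the library's `neg_mul` and `mul_neg` do not rewrite.
@[simp] protected theorem neg_mul (a b : BiOct) : -a * b = -(a * b) := _root_.neg_mul a b
@[simp] protected theorem mul_neg (a b : BiOct) : a * -b = -(a * b) := _root_.mul_neg a b

theorem star_tmul (P : Oct 1) (p : Oct (-1)) : star (P ⊗ₜ[ℝ] p) = star P ⊗ₜ[ℝ] star p :=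
  TensorProduct.star_tmul P p

end BiOct

namespace e8
open GMat Oct Matrix

@[simp] theorem neg_fst (x : e8) (i : Fin 3) : (-x).1.1 i = -x.1.1 i := rfl
@[simp] theorem neg_snd (x : e8) (i : Fin 3) : (-x).1.2 i = -x.1.2 i := rfl
@[simp] theorem sub_fst (x y : e8) (i : Fin 3) : (x - y).1.1 i = x.1.1 i - y.1.1 i := rfl
@[simp] theorem zero_fst (i : Fin 3) : (0 : e8).1.1 i = 0 := rfl
@[simp] theorem zero_snd (i : Fin 3) : (0 : e8).1.2 i = 0 := rfl
@[simp] theorem off_fst (t i : Fin 3) (p : BiOct) : (off t p).1.1 i = 0 := rfl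

theorem off_snd (t i : Fin 3) (p : BiOct) : (off t p).1.2 i = if i = t then p else 0 :=
  Pi.single_apply t p i

theorem ext_tmul {x y : e8} (h1 : ∀ i S s, x.1.1 i (S ⊗ₜ s) = y.1.1 i (S ⊗ₜ s))
    (h2 : ∀ i, x.1.2 i = y.1.2 i) : x = y :=
  ext (fun i => LinearMap.congr_fun (TensorProduct.ext' (h1 i))) h2

/-- `off t` as a linear map. -/
def offL (t : Fin 3) : BiOct →ₗ[ℝ] e8 where
  toFun := off t
  map_add' := off_add t
  map_smul' := off_smul t

@[simp] theorem offL_apply (t : Fin 3) (p : BiOct) : offL t p = off t p := rfl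

/-- The commutator of off-diagonal matrices of the same type, as a bilinear map in their
parameters. With `q` imaginary and up to the factor `½`, it is `D_q`, `E_q`, `F_q` at `(1, q)`. -/
def offLie (t : Fin 3) : BiOct →ₗ[ℝ] BiOct →ₗ[ℝ] e8 :=
  (LieAlgebra.ad ℝ e8 : e8 →ₗ[ℝ] Module.End ℝ e8).compl₁₂ (offL t) (offL t)

theorem offLie_apply (t : Fin 3) (a b : BiOct) : offLie t a b = ⁅off t a, off t b⁆ := rfl

theorem offLie_fst (t i : Fin 3) (a b : BiOct) : (offLie t a b).1.1 i = nested t a b i := by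
  refine LinearMap.ext fun c => ?_
  rw [offLie_apply, lie_fst]
  rcases eq_or_eq_add_one_or_eq_add_two t i with rfl | rfl | rfl
  · rw [nested_self]; fin_cases i <;> simp [off_snd, prev_apply, next_apply]
  · rw [nested_add_one]; fin_cases t <;> simp [off_snd, prev_apply, own_apply]
  · rw [nested_add_two]; fin_cases t <;> simp [off_snd, next_apply, own_apply]

@[simp] theorem offLie_snd (t i : Fin 3) (a b : BiOct) : (offLie t a b).1.2 i = 0 := by
  rw [offLie_apply, lie_snd]
  fin_cases t <;> fin_cases i <;> simp [off_snd]

theorem offLie_fst_tmul (t i : Fin 3) (P R S : Oct 1) (p r s : Oct (-1)) :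
    (offLie t (P ⊗ₜ p) (R ⊗ₜ r)).1.1 i (S ⊗ₜ s) =
      ip P R • (S ⊗ₜ triality t p r i s) + ip p r • (triality t P R i S ⊗ₜ s) := by
  rw [offLie_fst, BiOct.nested_tmul]

theorem offLie_swap (t : Fin 3) (a b : BiOct) : offLie t b a = -offLie t a b :=
  (lie_skew _ _).symm

theorem lie_off_succ (t : Fin 3) (a b : BiOct) :
    (⁅off t a, off (t + 1) b⁆ : e8) = off (t + 2) (-star (a * b)) := by
  refine ext (fun i c => ?_) (fun i => ?_)
  · rw [lie_fst]
    fin_cases t <;> fin_cases i <;> simp [off_snd, next_apply, own_apply, prev_apply]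
  · rw [lie_snd]
    fin_cases t <;> fin_cases i <;> simp [off_snd]

theorem lie_off_of_snd_eq_zero {x : e8} (hx : ∀ i, x.1.2 i = 0) (t : Fin 3) (c : BiOct) :
    ⁅x, off t c⁆ = off t (x.1.1 t c) := by
  refine ext (fun i c => ?_) (fun i => ?_)
  · rw [lie_fst]
    simp [hx, next_apply, own_apply, prev_apply]
  · rw [lie_snd]
    simp only [hx, off_snd]
    split_ifs with h <;> simp [h]

theorem offLie_cyclic (t : Fin 3) (a b c : BiOct) :
    offLie t a (star (b * c)) + offLie (t + 1) b (star (c * a)) +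
      offLie (t + 2) c (star (a * b)) = 0 := by
  refine ext (fun i y => ?_) (fun i => by simp)
  have h1 := BiOct.own_cyc a b c y
  have h2 := BiOct.own_cyc b c a y
  have h3 := BiOct.own_cyc c a b y
  simp only [add_fst, LinearMap.add_apply, offLie_fst, zero_fst, LinearMap.zero_apply]
  fin_cases t <;> fin_cases i
  all_goals first
    | exact h1
    | exact (add_rotate ..).trans h2
    | exact (add_rotate ..).symm.trans h3

theorem D_eq (q : BiOct) : D q = (1 / 2 : ℝ) • offLie 0 1 q := rfl
theorem E_eq (q : BiOct) : E q = (1 / 2 : ℝ) • offLie 1 1 q := rfl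
theorem F_eq (q : BiOct) : F q = (1 / 2 : ℝ) • offLie 2 1 q := rfl

theorem D_add_E_add_F (q : BiOct) : D q + E q + F q = 0 := by
  refine ext (fun i y => ?_) (fun i => by simp [D_eq, E_eq, F_eq])
  fin_cases i <;>
    simp [D_eq, E_eq, F_eq, offLie_fst, nested, own_apply, next_apply, prev_apply] <;> module

theorem ofMatrix_snd (M : Matrix (Fin 3) (Fin 3) BiOct) (i : Fin 3) :
    (ofMatrix M).1.2 i = M i (i + 1) := by
  fin_cases i <;> simp [ofMatrix, X, Y, Z, D_eq, E_eq, off_snd]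

theorem ofMatrix_fst {M : Matrix (Fin 3) (Fin 3) BiOct} (hM : ∀ i, star (M i i) = -M i i)
    (htr : M.trace = 0) (i : Fin 3) (c : BiOct) :
    (ofMatrix M).1.1 i c = M i i * c - c * M (i + 1) (i + 1) := by
  have h1 : M 1 1 = -M 0 0 - M 2 2 := by
    rw [Matrix.trace, Fin.sum_univ_three] at htr
    simp only [diag_apply] at htr
    linear_combination (norm := abel) htr
  have h_own (j) := own_one_of_skew (A := BiOct) (hM j) c
  have h_next (j) := next_one_of_skew (A := BiOct) (hM j) c
  have h_prev (j) := prev_one_of_skew (A := BiOct) (hM j) c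
  rw [show (ofMatrix M).1.1 i c = (D (M 0 0)).1.1 i c - (E (M 2 2)).1.1 i c by
    simp [ofMatrix, X, Y, Z]]
  fin_cases i <;>
    simp [D_eq, E_eq, offLie_fst, nested, h_own, h_next, h_prev, h1, sub_mul, mul_sub] <;> module

end e8

namespace Oct
open GMat

/-- The span of `I, J, K, KL, JL, IL`, in which the labels `Q` live. -/
def labelSpan : Submodule ℝ (Oct 1) := LinearMap.ker (ipL 1) ⊓ LinearMap.ker (ipL l)

theorem labelSpan_eq_co {Q : Oct 1} (hQ : Q ∈ labelSpan) :
    ∃ q1 q2 q3 q5 q6 q7, Q = co 0 q1 q2 q3 0 q5 q6 q7 := by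
  obtain ⟨a0, a1, a2, a3, a4, a5, a6, a7, rfl⟩ := eq_co Q
  have h1 : ip 1 (co a0 a1 a2 a3 a4 a5 a6 a7 : Oct 1) = 0 := hQ.1
  have h2 : ip l (co a0 a1 a2 a3 a4 a5 a6 a7 : Oct 1) = 0 := hQ.2
  rw [one_eq_co, co_ip] at h1
  rw [l, co_ip] at h2
  obtain rfl : a0 = 0 := by linarith
  obtain rfl : a4 = 0 := by linarith
  exact ⟨_, _, _, _, _, _, rfl⟩

theorem co_mem_labelSpan (q1 q2 q3 q5 q6 q7 : ℝ) : co 0 q1 q2 q3 0 q5 q6 q7 ∈ labelSpan := by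
  constructor
  · change ip _ _ = 0; rw [one_eq_co, co_ip]; ring
  · change ip _ _ = 0; rw [l, co_ip]; ring

theorem l_mul_co (q1 q2 q3 q5 q6 q7 : ℝ) : (l * co 0 q1 q2 q3 0 q5 q6 q7 : Oct 1) =
    co 0 (-q5) (-q6) (-q7) 0 (-q1) (-q2) (-q3) := by
  rw [l, co_mul]; apply co_congr <;> ring

theorem l_mul_mem_labelSpan {Q : Oct 1} (hQ : Q ∈ labelSpan) : l * Q ∈ labelSpan := by
  obtain ⟨q1, q2, q3, q5, q6, q7, rfl⟩ := labelSpan_eq_co hQ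
  rw [l_mul_co]; exact co_mem_labelSpan ..

theorem l_mul_l_mul {Q : Oct 1} (hQ : Q ∈ labelSpan) : l * (l * Q) = Q := by
  obtain ⟨q1, q2, q3, q5, q6, q7, rfl⟩ := labelSpan_eq_co hQ
  simp only [l_mul_co, neg_neg]

theorem mul_l_eq_neg_l_mul {Q : Oct 1} (hQ : Q ∈ labelSpan) : Q * l = -(l * Q) := by
  obtain ⟨q1, q2, q3, q5, q6, q7, rfl⟩ := labelSpan_eq_co hQ
  rw [l_mul_co, l, co_mul, co_neg]
  apply co_congr <;> ring

theorem star_eq_neg_of_mem_labelSpan {Q : Oct 1} (hQ : Q ∈ labelSpan) : star Q = -Q := by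
  obtain ⟨q1, q2, q3, q5, q6, q7, rfl⟩ := labelSpan_eq_co hQ
  rw [co_star, co_neg, neg_zero]

/-- The projection of the split octonions to `labelSpan`, along the span of `1` and `L`. -/
def labelPart (S : Oct 1) : Oct 1 := S - ip 1 S • 1 + ip l S • l

/-- The operator by which the diagonal part of `Q𝓟` acts on the split octonionic factor of the
entry `(i, i + 1)`, where `d` is the diagonal of `𝓟`. If `d` is trace-free, this is the
commutator with `diag (d) Q`; the last term makes up for reading `Q𝓘` as `-½ G_Q`. -/
def diagOp (Q : Oct 1) (d : Fin 3 → ℝ) (i : Fin 3) (S : Oct 1) : Oct 1 :=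
  d i • (Q * S) - d (i + 1) • (S * Q) - (∑ j, d j) • labelPart (Q * labelPart S)

theorem diagOp_of_sum_eq_zero (Q : Oct 1) {d : Fin 3 → ℝ} (hd : ∑ j, d j = 0) (i : Fin 3)
    (S : Oct 1) : diagOp Q d i S = d i • (Q * S) - d (i + 1) • (S * Q) := by
  rw [diagOp, hd, zero_smul, sub_zero]

theorem diagOp_add (Q : Oct 1) (d e : Fin 3 → ℝ) (i : Fin 3) (S : Oct 1) :
    diagOp Q (d + e) i S = diagOp Q d i S + diagOp Q e i S := by
  simp only [diagOp, Pi.add_apply, Finset.sum_add_distrib]; module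

theorem diagOp_smul (Q : Oct 1) (r : ℝ) (d : Fin 3 → ℝ) (i : Fin 3) (S : Oct 1) :
    diagOp Q (r • d) i S = r • diagOp Q d i S := by
  simp only [diagOp, Pi.smul_apply, smul_eq_mul, ← Finset.mul_sum]; module

theorem diagOp_co (q1 q2 q3 q5 q6 q7 : ℝ) (d : Fin 3 → ℝ) (i : Fin 3)
    (s0 s1 s2 s3 s4 s5 s6 s7 : ℝ) :
    diagOp (co 0 q1 q2 q3 0 q5 q6 q7) d i (co s0 s1 s2 s3 s4 s5 s6 s7) =
      let a := d i - d (i + 1)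
      let b := d i + d (i + 1)
      let c := d (i + 2)
      co (-a * (q1 * s1 + q2 * s2 + q3 * s3 - q5 * s5 - q6 * s6 - q7 * s7))
        (a * s0 * q1 + b * s4 * q5 + c * (s2 * q3 - s3 * q2 + s6 * q7 - s7 * q6))
        (a * s0 * q2 + b * s4 * q6 + c * (s3 * q1 - s1 * q3 + s7 * q5 - s5 * q7))
        (a * s0 * q3 + b * s4 * q7 + c * (s1 * q2 - s2 * q1 + s5 * q6 - s6 * q5))
        (b * (q5 * s1 + q6 * s2 + q7 * s3 - q1 * s5 - q2 * s6 - q3 * s7))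
        (a * s0 * q5 + b * s4 * q1 + c * (s3 * q6 - s2 * q7 + s7 * q2 - s6 * q3))
        (a * s0 * q6 + b * s4 * q2 + c * (s1 * q7 - s3 * q5 + s5 * q3 - s7 * q1))
        (a * s0 * q7 + b * s4 * q3 + c * (s2 * q5 - s1 * q6 + s6 * q1 - s5 * q2)) := by
  simp only [diagOp, labelPart, sum_univ_three_cyclic d i, one_eq_co, l, co_mul, co_ip, co_add,
    co_sub, co_smul]
  apply co_congr <;> ring

theorem diagOp_one {Q : Oct 1} (hQ : Q ∈ labelSpan) (d : Fin 3 → ℝ) (i : Fin 3) :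
    diagOp Q d i 1 = (d i - d (i + 1)) • Q := by
  obtain ⟨q1, q2, q3, q5, q6, q7, rfl⟩ := labelSpan_eq_co hQ
  rw [one_eq_co, diagOp_co, co_smul]
  apply co_congr <;> ring

theorem diagOp_l {Q : Oct 1} (hQ : Q ∈ labelSpan) (d : Fin 3 → ℝ) (i : Fin 3) :
    diagOp Q d i l = -(d i + d (i + 1)) • (l * Q) := by
  obtain ⟨q1, q2, q3, q5, q6, q7, rfl⟩ := labelSpan_eq_co hQ
  rw [l_mul_co, l, diagOp_co, co_smul]
  apply co_congr <;> ring

theorem diagOp_commutator {Q : Oct 1} (hQ : Q ∈ labelSpan) {e : Fin 3 → ℝ} (he : ∑ j, e j = 0)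
    (d : Fin 3 → ℝ) (i : Fin 3) (S : Oct 1) :
    diagOp l e i (diagOp Q d i S) - diagOp Q d i (diagOp l e i S) =
      diagOp (l * Q) (fun j => 2 * (e j * d j)) i S := by
  obtain ⟨q1, q2, q3, q5, q6, q7, rfl⟩ := labelSpan_eq_co hQ
  obtain ⟨s0, s1, s2, s3, s4, s5, s6, s7, rfl⟩ := eq_co S
  have he' : e (i + 2) = -e i - e (i + 1) := by
    rw [sum_univ_three_cyclic e i] at he; linarith
  simp only [diagOp_of_sum_eq_zero l he, l_mul_co]
  simp only [diagOp_co, l, co_mul, co_smul, co_sub, he']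
  apply co_congr <;> ring

theorem own_add_prev_add_next_one {Q : Oct 1} (hQ : Q ∈ labelSpan) (w : Fin 3 → ℝ) (i : Fin 3)
    (S : Oct 1) :
    w i • own 1 Q S + w (i + 1) • prev 1 Q S + w (i + 2) • next 1 Q S =
      diagOp Q (fun j => 2 * (w j - w (j + 2))) i S := by
  have hQ' := star_eq_neg_of_mem_labelSpan hQ
  have hd : ∑ j, 2 * (w j - w (j + 2)) = 0 := by
    rw [sum_univ_three_cyclic _ i, add2, add4]; ring
  rw [own_one_of_skew hQ', prev_one_of_skew hQ', next_one_of_skew hQ',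
    diagOp_of_sum_eq_zero Q hd, add2]
  module

theorem own_add_prev_add_next_l {Q : Oct 1} (hQ : Q ∈ labelSpan) (w : Fin 3 → ℝ) (i : Fin 3)
    (S : Oct 1) :
    w i • own l Q S + w (i + 1) • prev l Q S + w (i + 2) • next l Q S =
      diagOp (l * Q) (fun j => 2 * (w j + w (j + 2))) i S := by
  obtain ⟨q1, q2, q3, q5, q6, q7, rfl⟩ := labelSpan_eq_co hQ
  obtain ⟨s0, s1, s2, s3, s4, s5, s6, s7, rfl⟩ := eq_co S
  rw [l_mul_co, diagOp_co]
  simp only [own_eq, prev_apply, next_apply, l, co_mul, co_star, co_ip, co_add, co_sub,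
    co_smul, add2, add4]
  apply co_congr <;> ring

end Oct

namespace Albert
open Oct

theorem star_apply (P : Albert) (i j : Fin 3) : star (P.1 i j) = P.1 j i := congrFun₂ P.2 j i

/-- The diagonal entries, which are real. -/
def diagEntry (P : Albert) (i : Fin 3) : ℝ := (P.1 i i).1.re

theorem apply_self (P : Albert) (i : Fin 3) : P.1 i i = diagEntry P i • 1 :=
  eq_re_smul_one_of_star_eq (star_apply P i i)

theorem tr_eq_sum (P : Albert) : tr P = ∑ i, diagEntry P i := by
  rw [tr, Matrix.trace, Fin.sum_univ_three, Fin.sum_univ_three]; rfl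

theorem ext_entries {P R : Albert} (h1 : ∀ i, diagEntry P i = diagEntry R i)
    (h2 : ∀ i, P.1 i (i + 1) = R.1 i (i + 1)) : P = R := by
  refine Subtype.ext (Matrix.ext fun i j => ?_)
  have : j = i ∨ j = i + 1 ∨ i = j + 1 := by revert i j; decide
  rcases this with rfl | rfl | rfl
  · rw [apply_self, apply_self, h1]
  · exact h2 i
  · rw [← star_apply, ← star_apply R, h2]

theorem act_apply (M : Matrix (Fin 3) (Fin 3) (Oct (-1))) (P : Albert) (i j : Fin 3) :
    (act M P).1 i j = ∑ k, (M i k * P.1 k j + P.1 i k * star (M j k)) := by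
  change (M * P.1 + P.1 * Mᴴ) i j = _
  rw [Matrix.add_apply, Matrix.mul_apply, Matrix.mul_apply, ← Finset.sum_add_distrib]; rfl

theorem diagEntry_act (M : Matrix (Fin 3) (Fin 3) (Oct (-1))) (P : Albert) (i : Fin 3) :
    diagEntry (act M P) i = 2 * ∑ k, ip (M i k) (P.1 i k) := by
  have h (k : Fin 3) :
      (M i k * P.1 k i + P.1 i k * star (M i k)).1.re = 2 * ip (M i k) (P.1 i k) := by
    rw [← star_apply P i k, two_mul]
    nth_rw 2 [ip_comm]
    rfl
  rw [diagEntry, act_apply, Fin.sum_univ_three, Fin.sum_univ_three, mul_add, mul_add, ← h, ← h,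
    ← h]
  rfl

theorem diagEntry_act_of_conjTranspose_eq_neg {M : Matrix (Fin 3) (Fin 3) (Oct (-1))}
    (hM : Mᴴ = -M) (P : Albert) (i : Fin 3) : diagEntry (act M P) i =
      2 * (ip (M i (i + 1)) (P.1 i (i + 1)) - ip (M (i + 2) i) (P.1 (i + 2) i)) := by
  have star_M (j k : Fin 3) : star (M j k) = -M k j := congrFun₂ hM k j
  have h_self : ip (M i i) (P.1 i i) = 0 := by
    have h : ip (star (M i i)) (star (P.1 i i)) = ip (M i i) (P.1 i i) := ip_star ..
    rw [star_M, star_apply, ip_neg_left] at h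
    linarith
  have h_prev : ip (M i (i + 2)) (P.1 i (i + 2)) = -ip (M (i + 2) i) (P.1 (i + 2) i) := by
    rw [← ip_star, star_M, star_apply, ip_neg_left]
  rw [diagEntry_act, sum_univ_three_cyclic _ i, h_self, h_prev]
  ring

theorem diagEntry_act_of_conjTranspose_eq {M : Matrix (Fin 3) (Fin 3) (Oct (-1))}
    (hM : Mᴴ = M) (P : Albert) (i : Fin 3) : diagEntry (act M P) i =
      2 * (diagEntry ⟨M, hM⟩ i * diagEntry P i) +
        2 * (ip (M i (i + 1)) (P.1 i (i + 1)) + ip (M (i + 2) i) (P.1 (i + 2) i)) := by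
  have star_M (j k : Fin 3) : star (M j k) = M k j := congrFun₂ hM k j
  have M_self : M i i = diagEntry ⟨M, hM⟩ i • 1 := apply_self ⟨M, hM⟩ i
  have h_prev : ip (M i (i + 2)) (P.1 i (i + 2)) = ip (M (i + 2) i) (P.1 (i + 2) i) := by
    rw [← ip_star, star_M, star_apply]
  rw [diagEntry_act, sum_univ_three_cyclic _ i, h_prev, M_self, apply_self, ip_smul_left,
    ip_smul_right, ip_one_one]
  ring

end Albert

namespace e8
open GMat Oct Albert Matrix

theorem GS_snd (Q : Oct 1) (i : Fin 3) : (GS Q).1.2 i = 0 := by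
  change (-2 : ℝ) • (1 / 2 : ℝ) • ((1 / 2 : ℝ) • (offLie 0 _ _).1.2 i +
    (1 / 2 : ℝ) • (offLie 1 _ _).1.2 i + (1 / 2 : ℝ) • (offLie 2 _ _).1.2 i) = 0
  simp

theorem GS_eq (Q : Oct 1) : GS Q = (-1 / 2 : ℝ) • ∑ t, offLie t ((Q * l) ⊗ₜ 1) (l ⊗ₜ 1) := by
  rw [Fin.sum_univ_three]
  change (-2 : ℝ) • (1 / 2 : ℝ) • ((1 / 2 : ℝ) • offLie 0 _ _ + (1 / 2 : ℝ) • offLie 1 _ _ +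
    (1 / 2 : ℝ) • offLie 2 _ _) = _
  module

theorem GS_fst_tmul {Q : Oct 1} (hQ : Q ∈ labelSpan) (i : Fin 3) (S : Oct 1) (s : Oct (-1)) :
    (GS Q).1.1 i (S ⊗ₜ s) = (-2 : ℝ) • (diagOp Q 1 i S ⊗ₜ[ℝ] s) := by
  have h_sum : ∑ t, triality t (Q * l) l i S = diagOp Q ((4 : ℝ) • 1) i S := by
    have h := own_add_prev_add_next_l (l_mul_mem_labelSpan hQ) 1 i S
    rw [l_mul_l_mul hQ] at h
    have h_triality := sum_smul_triality 1 (Q * l) l i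
    simp only [Pi.one_apply, one_smul] at h_triality
    rw [← LinearMap.sum_apply, h_triality, mul_l_eq_neg_l_mul hQ, own_swap, prev_swap, next_swap,
      ← neg_one_smul ℝ (l * Q), own_smul_right, prev_smul_right, next_smul_right]
    convert h using 1
    · simp
    · congr 1; funext j; norm_num
  rw [Fin.sum_univ_three] at h_sum
  rw [GS_eq, Fin.sum_univ_three]
  simp only [smul_fst, add_fst, LinearMap.smul_apply, LinearMap.add_apply, offLie_fst_tmul,
    triality_self, Pi.zero_apply, LinearMap.zero_apply, TensorProduct.tmul_zero, smul_zero,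
    zero_add, ip_one_one, one_smul, ← TensorProduct.add_tmul, h_sum, diagOp_smul,
    ← TensorProduct.smul_tmul']
  module

theorem labelled_snd (Q : Oct 1) (P : Albert) (i : Fin 3) :
    (labelled Q P).1.2 i = Q ⊗ₜ P.1 i (i + 1) := by
  have h : i ≠ i + 1 := by revert i; decide
  simp [labelled, ofMatrix_snd, mulLabel, GS_snd, Matrix.one_apply_ne h]

theorem labelled_fst_tmul {Q : Oct 1} (hQ : Q ∈ labelSpan) (P : Albert) (i : Fin 3) (S : Oct 1)
    (s : Oct (-1)) :
    (labelled Q P).1.1 i (S ⊗ₜ s) = diagOp Q (diagEntry P) i S ⊗ₜ s := by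
  set d : Fin 3 → ℝ := fun j => diagEntry P j - tr P / 3 with hd
  have hd_sum : ∑ j, d j = 0 := by
    simp only [hd, Finset.sum_sub_distrib, ← tr_eq_sum]; simp; ring
  have h_split : diagEntry P = d + (tr P / 3) • 1 := by funext j; simp [hd]
  have h_entry (j : Fin 3) : mulLabel Q (P.1 - (tr P / 3) • 1) j j = Q ⊗ₜ (d j • 1) := by
    simp only [mulLabel, Matrix.map_apply, Matrix.sub_apply, Matrix.smul_apply, Matrix.one_apply_eq,
      apply_self, sub_smul, hd]
  have h_skew (j : Fin 3) : star (mulLabel Q (P.1 - (tr P / 3) • 1) j j) =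
      -mulLabel Q (P.1 - (tr P / 3) • 1) j j := by
    rw [h_entry, BiOct.star_tmul, star_eq_neg_of_mem_labelSpan hQ, star_smul, star_trivial,
      star_one, TensorProduct.neg_tmul]
  have h_tr : (mulLabel Q (P.1 - (tr P / 3) • 1)).trace = 0 := by
    simp only [Matrix.trace, Matrix.diag_apply, h_entry, ← TensorProduct.tmul_sum,
      ← Finset.sum_smul, hd_sum, zero_smul, TensorProduct.tmul_zero]
  rw [labelled, add_fst, smul_fst, smul_fst, LinearMap.add_apply, LinearMap.smul_apply,
    LinearMap.smul_apply, GS_fst_tmul hQ, ofMatrix_fst h_skew h_tr, h_entry, h_entry, h_split,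
    diagOp_add, diagOp_smul, diagOp_of_sum_eq_zero Q hd_sum]
  simp only [BiOct.mul_tmul, smul_mul_assoc, mul_smul_comm, one_mul, mul_one,
    TensorProduct.tmul_smul, TensorProduct.add_tmul, TensorProduct.sub_tmul,
    ← TensorProduct.smul_tmul']
  module

theorem rotation_snd (M : Matrix (Fin 3) (Fin 3) (Oct (-1))) (i : Fin 3) :
    (rotation M).1.2 i = 1 ⊗ₜ M i (i + 1) := ofMatrix_snd ..

theorem boost_snd (M : Matrix (Fin 3) (Fin 3) (Oct (-1))) (i : Fin 3) :
    (boost M).1.2 i = l ⊗ₜ M i (i + 1) := ofMatrix_snd ..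

theorem trace_mulLabel (Q : Oct 1) (M : Matrix (Fin 3) (Fin 3) (Oct (-1))) :
    (mulLabel Q M).trace = Q ⊗ₜ M.trace := by
  simp only [Matrix.trace, TensorProduct.tmul_sum]; rfl

theorem rotation_fst_tmul {M : Matrix (Fin 3) (Fin 3) (Oct (-1))} (hM : Mᴴ = -M)
    (htr : M.trace = 0) (i : Fin 3) (S : Oct 1) (s : Oct (-1)) :
    (rotation M).1.1 i (S ⊗ₜ s) = S ⊗ₜ (M i i * s - s * M (i + 1) (i + 1)) := by
  have h_skew (j : Fin 3) : star (mulLabel 1 M j j) = -mulLabel 1 M j j := by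
    have h_star : star (M j j) = -M j j := congrFun₂ hM j j
    rw [mulLabel, Matrix.map_apply, BiOct.star_tmul, h_star, star_one, TensorProduct.tmul_neg]
  rw [rotation, ofMatrix_fst h_skew (by rw [trace_mulLabel, htr, TensorProduct.tmul_zero]),
    mulLabel, Matrix.map_apply, Matrix.map_apply, BiOct.mul_tmul, BiOct.mul_tmul, one_mul, mul_one,
    TensorProduct.tmul_sub]

theorem boost_fst_tmul {M : Matrix (Fin 3) (Fin 3) (Oct (-1))} (hM : Mᴴ = M)
    (htr : M.trace = 0) (i : Fin 3) (S : Oct 1) (s : Oct (-1)) :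
    (boost M).1.1 i (S ⊗ₜ s) = diagOp l (diagEntry ⟨M, hM⟩) i S ⊗ₜ s := by
  have h_skew (j : Fin 3) : star (mulLabel l M j j) = -mulLabel l M j j := by
    have h_star : star (M j j) = M j j := congrFun₂ hM j j
    rw [mulLabel, Matrix.map_apply, BiOct.star_tmul, h_star, star_l, TensorProduct.neg_tmul]
  have h_entry (j : Fin 3) : M j j = diagEntry ⟨M, hM⟩ j • 1 := apply_self ⟨M, hM⟩ j
  have h_sum : ∑ j, diagEntry ⟨M, hM⟩ j = 0 := by
    rw [← tr_eq_sum, tr, htr]; rfl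
  rw [boost, ofMatrix_fst h_skew (by rw [trace_mulLabel, htr, TensorProduct.tmul_zero]),
    diagOp_of_sum_eq_zero l h_sum, mulLabel, Matrix.map_apply, Matrix.map_apply, h_entry i,
    h_entry (i + 1), BiOct.mul_tmul, BiOct.mul_tmul, smul_one_mul, mul_smul_one,
    TensorProduct.sub_tmul, TensorProduct.smul_tmul, TensorProduct.smul_tmul]

theorem lie_rotation_labelled {Q : Oct 1} (hQ : Q ∈ labelSpan)
    {M : Matrix (Fin 3) (Fin 3) (Oct (-1))} (hM : Mᴴ = -M) (htr : M.trace = 0) (P : Albert) :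
    ⁅rotation M, labelled Q P⁆ = labelled Q (act M P) := by
  have star_M (j k : Fin 3) : star (M j k) = -M k j := congrFun₂ hM k j
  have h_ip : ip 1 Q = 0 := hQ.1
  refine ext_tmul (fun i S s => ?_) (fun i => ?_)
  · set w : Fin 3 → ℝ := fun j => ip (M j (j + 1)) (P.1 j (j + 1)) with hw
    have h_diag : diagEntry (act M P) = fun j => 2 * (w j - w (j + 2)) := by
      funext j; simp only [diagEntry_act_of_conjTranspose_eq_neg hM, hw, add3]
    simp only [lie_fst, rotation_snd, labelled_snd, rotation_fst_tmul hM htr,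
      labelled_fst_tmul hQ, BiOct.own_tmul, BiOct.next_tmul, BiOct.prev_tmul, h_ip, zero_smul,
      zero_add, sub_self, add3]
    rw [h_diag, ← own_add_prev_add_next_one hQ]
    simp only [TensorProduct.add_tmul, TensorProduct.smul_tmul', hw, add3]
  · simp only [lie_snd, rotation_snd, labelled_snd, rotation_fst_tmul hM htr, labelled_fst_tmul hQ,
      diagOp_one hQ, add1, add3, BiOct.mul_tmul, one_mul, mul_one, BiOct.star_tmul,
      star_eq_neg_of_mem_labelSpan hQ]
    simp only [act_apply, sum_univ_three_cyclic _ i, apply_self, star_mul, star_M,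
      Albert.star_apply, TensorProduct.neg_tmul, ← TensorProduct.smul_tmul',
      ← TensorProduct.tmul_smul,
      ← TensorProduct.tmul_neg, ← TensorProduct.tmul_sub, ← TensorProduct.tmul_add,
      smul_mul_assoc, mul_smul_comm, mul_one, one_mul, mul_neg, neg_mul]
    congr 1
    module

theorem lie_boost_labelled {Q : Oct 1} (hQ : Q ∈ labelSpan)
    {M : Matrix (Fin 3) (Fin 3) (Oct (-1))} (hM : Mᴴ = M) (htr : M.trace = 0) (P : Albert) :
    ⁅boost M, labelled Q P⁆ = labelled (l * Q) (act M P) := by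
  have star_M (j k : Fin 3) : star (M j k) = M k j := congrFun₂ hM k j
  have h_ip : ip l Q = 0 := hQ.2
  have hQ' := l_mul_mem_labelSpan hQ
  set e := diagEntry ⟨M, hM⟩ with he
  have M_diag (j : Fin 3) : M j j = e j • 1 := apply_self ⟨M, hM⟩ j
  have h_sum : ∑ j, e j = 0 := by rw [← tr_eq_sum, tr, htr]; rfl
  refine ext_tmul (fun i S s => ?_) (fun i => ?_)
  · set w : Fin 3 → ℝ := fun j => ip (M j (j + 1)) (P.1 j (j + 1)) with hw
    have h_diag : diagEntry (act M P) =
        (fun j => 2 * (e j * diagEntry P j)) + fun j => 2 * (w j + w (j + 2)) := by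
      funext j; simp only [diagEntry_act_of_conjTranspose_eq hM, hw, add3, Pi.add_apply, e]
    simp only [lie_fst, boost_snd, labelled_snd, boost_fst_tmul hM htr, labelled_fst_tmul hQ,
      labelled_fst_tmul hQ', BiOct.own_tmul, BiOct.next_tmul, BiOct.prev_tmul, h_ip, zero_smul,
      zero_add, add3]
    rw [h_diag, diagOp_add, ← diagOp_commutator hQ h_sum, ← own_add_prev_add_next_l hQ]
    simp only [TensorProduct.add_tmul, TensorProduct.sub_tmul, TensorProduct.smul_tmul', hw, add3]
    abel
  · have h_op : diagOp l e i Q = (e i + e (i + 1)) • (l * Q) := by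
      rw [diagOp_of_sum_eq_zero l h_sum, mul_l_eq_neg_l_mul hQ]; module
    simp only [lie_snd, boost_snd, labelled_snd, boost_fst_tmul hM htr, labelled_fst_tmul hQ,
      ← he, h_op, diagOp_l hQ, add1, add3, BiOct.mul_tmul, BiOct.star_tmul,
      star_eq_neg_of_mem_labelSpan hQ', mul_l_eq_neg_l_mul hQ, star_neg]
    simp only [act_apply, sum_univ_three_cyclic _ i, M_diag, apply_self, star_mul, star_M,
      Albert.star_apply, TensorProduct.neg_tmul, neg_neg, ← TensorProduct.smul_tmul',
      ← TensorProduct.tmul_smul, ← TensorProduct.tmul_neg, ← TensorProduct.tmul_sub,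
      ← TensorProduct.tmul_add, smul_mul_assoc, mul_smul_comm, mul_one, one_mul]
    congr 1
    module

end e8

namespace BiOct
open Oct

/-- The subalgebra `ℂ' ⊗ 𝕆` of `𝕆' ⊗ 𝕆`, where `ℂ'` is spanned by `1` and `L`. -/
def splitComplex : Submodule ℝ BiOct :=
  LinearMap.range (TensorProduct.mk ℝ (Oct 1) (Oct (-1)) 1) ⊔
    LinearMap.range (TensorProduct.mk ℝ (Oct 1) (Oct (-1)) l)

theorem mem_splitComplex {x : BiOct} :
    x ∈ splitComplex ↔ ∃ p q : Oct (-1), x = 1 ⊗ₜ p + l ⊗ₜ q := by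
  rw [splitComplex, Submodule.mem_sup]
  constructor
  · rintro ⟨_, ⟨p, rfl⟩, _, ⟨q, rfl⟩, rfl⟩; exact ⟨p, q, rfl⟩
  · rintro ⟨p, q, rfl⟩; exact ⟨_, ⟨p, rfl⟩, _, ⟨q, rfl⟩, rfl⟩

theorem one_tmul_mem_splitComplex (p : Oct (-1)) : 1 ⊗ₜ p ∈ splitComplex :=
  Submodule.mem_sup_left ⟨p, rfl⟩

theorem l_tmul_mem_splitComplex (p : Oct (-1)) : l ⊗ₜ p ∈ splitComplex :=
  Submodule.mem_sup_right ⟨p, rfl⟩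

theorem mul_mem_splitComplex {x y : BiOct} (hx : x ∈ splitComplex) (hy : y ∈ splitComplex) :
    x * y ∈ splitComplex := by
  obtain ⟨p, q, rfl⟩ := mem_splitComplex.1 hx
  obtain ⟨r, s, rfl⟩ := mem_splitComplex.1 hy
  refine mem_splitComplex.2 ⟨p * r + q * s, p * s + q * r, ?_⟩
  simp only [add_mul, mul_add, mul_tmul, one_mul, mul_one, l_mul_l, TensorProduct.tmul_add]
  abel

theorem star_mem_splitComplex {x : BiOct} (hx : x ∈ splitComplex) : star x ∈ splitComplex := by
  obtain ⟨p, q, rfl⟩ := mem_splitComplex.1 hx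
  rw [star_add, star_tmul, star_tmul, star_one, star_l, TensorProduct.neg_tmul]
  exact add_mem (one_tmul_mem_splitComplex _) (neg_mem (l_tmul_mem_splitComplex _))

theorem nested_mem_splitComplex {a b c : BiOct} (ha : a ∈ splitComplex) (hb : b ∈ splitComplex)
    (hc : c ∈ splitComplex) (t i : Fin 3) : GMat.nested t a b i c ∈ splitComplex := by
  have h_mul {x y : BiOct} := mul_mem_splitComplex (x := x) (y := y)
  have h_star {x : BiOct} := star_mem_splitComplex (x := x)
  unfold GMat.nested
  split_ifs
  · rw [own_apply]
    exact sub_mem (add_mem (sub_mem (h_mul hb (h_mul (h_star ha) hc))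
      (h_mul ha (h_mul (h_star hb) hc))) (h_mul hc (h_mul (h_star ha) hb)))
      (h_mul hc (h_mul (h_star hb) ha))
  · rw [next_apply]
    exact sub_mem (h_mul (h_star hb) (h_mul ha hc)) (h_mul (h_star ha) (h_mul hb hc))
  · rw [prev_apply]
    exact sub_mem (h_mul (h_mul hc ha) (h_star hb)) (h_mul (h_mul hc hb) (h_star ha))

end BiOct

theorem lie_mem_span_of_forall_lie_mem {R L : Type*} [CommRing R] [LieRing L] [LieAlgebra R L]
    {s : Set L} (hs : ∀ x ∈ s, ∀ y ∈ s, ⁅x, y⁆ ∈ Submodule.span R s) {x y : L}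
    (hx : x ∈ Submodule.span R s) (hy : y ∈ Submodule.span R s) : ⁅x, y⁆ ∈ Submodule.span R s := by
  have h := Submodule.apply_mem_map₂ (LieAlgebra.ad R L : L →ₗ[R] Module.End R L) hx hy
  rw [Submodule.map₂_span_span] at h
  exact Submodule.span_le.2 (Set.image2_subset_iff.2 hs) h

namespace e8
open GMat Oct

/-- The off-diagonal matrices over `ℂ' ⊗ 𝕆`. -/
def offGenerators : Set e8 := {x | ∃ t, ∃ a ∈ BiOct.splitComplex, x = off t a}

/-- The commutators of off-diagonal matrices of equal type over `ℂ' ⊗ 𝕆`. -/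
def diagonalGenerators : Set e8 :=
  {x | ∃ t, ∃ a ∈ BiOct.splitComplex, ∃ b ∈ BiOct.splitComplex, x = offLie t a b}

theorem lie_diagonal_off_mem {x y : e8} (hx : x ∈ diagonalGenerators) (hy : y ∈ offGenerators) :
    ⁅x, y⁆ ∈ offGenerators := by
  obtain ⟨t, a, ha, b, hb, rfl⟩ := hx
  obtain ⟨u, c, hc, rfl⟩ := hy
  rw [lie_off_of_snd_eq_zero (offLie_snd t · a b), offLie_fst]
  exact ⟨u, _, BiOct.nested_mem_splitComplex ha hb hc t u, rfl⟩

theorem lie_off_off_mem {x y : e8} (hx : x ∈ offGenerators) (hy : y ∈ offGenerators) :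
    ⁅x, y⁆ ∈ offGenerators ∪ diagonalGenerators := by
  obtain ⟨t, a, ha, rfl⟩ := hx
  obtain ⟨u, b, hb, rfl⟩ := hy
  have h_mul {c d : BiOct} (hc : c ∈ BiOct.splitComplex) (hd : d ∈ BiOct.splitComplex) :=
    neg_mem (BiOct.star_mem_splitComplex (BiOct.mul_mem_splitComplex hc hd))
  obtain rfl | rfl | rfl : u = t ∨ u = t + 1 ∨ t = u + 1 := by revert t u; decide
  · exact .inr ⟨_, a, ha, b, hb, rfl⟩
  · rw [lie_off_succ]
    exact .inl ⟨_, _, h_mul ha hb, rfl⟩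
  · rw [← lie_skew, lie_off_succ, ← offL_apply, ← map_neg]
    exact .inl ⟨_, _, neg_mem (h_mul hb ha), rfl⟩

theorem lie_mem_span_generators {x y : e8} (hx : x ∈ offGenerators ∪ diagonalGenerators)
    (hy : y ∈ offGenerators ∪ diagonalGenerators) :
    ⁅x, y⁆ ∈ Submodule.span ℝ (offGenerators ∪ diagonalGenerators) := by
  have h_off_off {x y : e8} (hx : x ∈ offGenerators) (hy : y ∈ offGenerators) :
      ⁅x, y⁆ ∈ Submodule.span ℝ (offGenerators ∪ diagonalGenerators) :=
    Submodule.subset_span (lie_off_off_mem hx hy)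
  rcases hx with hx | hx <;> rcases hy with hy | hy
  · exact h_off_off hx hy
  · rw [← lie_skew]
    exact neg_mem (Submodule.subset_span (.inl (lie_diagonal_off_mem hy hx)))
  · exact Submodule.subset_span (.inl (lie_diagonal_off_mem hx hy))
  · obtain ⟨u, c, hc, d, hd, rfl⟩ := hy
    rw [offLie_apply, leibniz_lie]
    exact add_mem
      (h_off_off (lie_diagonal_off_mem hx ⟨u, c, hc, rfl⟩) ⟨u, d, hd, rfl⟩)
      (h_off_off ⟨u, c, hc, rfl⟩ (lie_diagonal_off_mem hx ⟨u, d, hd, rfl⟩))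

/-- The Lie algebra `𝔰𝔲(3, ℂ' ⊗ 𝕆)`, spanned by the off-diagonal matrices over `ℂ' ⊗ 𝕆` and by
their commutators of equal type. -/
def su3 : LieSubalgebra ℝ e8 where
  toSubmodule := Submodule.span ℝ (offGenerators ∪ diagonalGenerators)
  lie_mem' := lie_mem_span_of_forall_lie_mem fun _ hx _ hy => lie_mem_span_generators hx hy

theorem off_mem_su3 (t : Fin 3) {a : BiOct} (ha : a ∈ BiOct.splitComplex) : off t a ∈ su3 :=
  Submodule.subset_span (.inl ⟨t, a, ha, rfl⟩)

theorem offLie_l_l (t : Fin 3) (p q : Oct (-1)) :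
    offLie t (l ⊗ₜ p) (l ⊗ₜ q) = -offLie t (1 ⊗ₜ p) (1 ⊗ₜ q) := by
  refine ext_tmul (fun i S s => ?_) (fun i => by simp)
  rw [neg_fst, LinearMap.neg_apply, offLie_fst_tmul, offLie_fst_tmul, triality_self,
    triality_self, ip_one_one, ip_l_l]
  simp

theorem offLie_one_l (t : Fin 3) (p q : Oct (-1)) :
    offLie t (1 ⊗ₜ p) (l ⊗ₜ q) = ip p q • offLie t 1 (l ⊗ₜ 1) := by
  refine ext_tmul (fun i S s => ?_) (fun i => by simp)
  rw [smul_fst, LinearMap.smul_apply, Algebra.TensorProduct.one_def, offLie_fst_tmul,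
    offLie_fst_tmul, ip_one_l, ip_one_one]
  simp

theorem su3_le {W : Submodule ℝ e8} (h_one : ∀ t p, off t (1 ⊗ₜ p) ∈ W)
    (h_l : ∀ t p, off t (l ⊗ₜ p) ∈ W) (h_one_one : ∀ t p q, offLie t (1 ⊗ₜ p) (1 ⊗ₜ q) ∈ W)
    (h_one_l : ∀ t, offLie t 1 (l ⊗ₜ 1) ∈ W) : su3.toSubmodule ≤ W := by
  refine Submodule.span_le.2 ?_
  rintro _ (⟨t, a, ha, rfl⟩ | ⟨t, a, ha, b, hb, rfl⟩)
  · obtain ⟨p, q, rfl⟩ := BiOct.mem_splitComplex.1 ha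
    rw [off_add]
    exact add_mem (h_one t p) (h_l t q)
  · obtain ⟨p, q, rfl⟩ := BiOct.mem_splitComplex.1 ha
    obtain ⟨r, s, rfl⟩ := BiOct.mem_splitComplex.1 hb
    rw [LinearMap.map_add₂, map_add, map_add, offLie_l_l, offLie_one_l t p s,
      offLie_swap t (1 ⊗ₜ r) (l ⊗ₜ q), offLie_one_l t r q]
    exact add_mem (add_mem (h_one_one ..) (W.smul_mem _ (h_one_l t)))
      (add_mem (neg_mem (W.smul_mem _ (h_one_l t))) (neg_mem (h_one_one ..)))

theorem DO_eq (p : Oct (-1) × Oct (-1)) :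
    DO p = (1 / 2 : ℝ) • offLie 0 (1 ⊗ₜ p.1) (1 ⊗ₜ p.2) := rfl

theorem offLie_one_one_fst_tmul (t i : Fin 3) (p q s : Oct (-1)) (R : Oct 1) :
    (offLie t (1 ⊗ₜ p) (1 ⊗ₜ q)).1.1 i (R ⊗ₜ s) = R ⊗ₜ triality t p q i s := by
  rw [offLie_fst_tmul, triality_self, ip_one_one]
  simp

theorem DO_add_DO_add_DO (n : Fin 7) :
    DO (pairA n) + DO (pairB n) + DO (pairC n) = S (1 ⊗ₜ unit n) := by
  refine ext_tmul (fun t R s => ?_) (fun i => by simp [DO_eq, S, E_eq, F_eq])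
  simp only [S, E_eq, F_eq, DO_eq, add_fst, sub_fst, smul_fst, LinearMap.add_apply,
    LinearMap.sub_apply, LinearMap.smul_apply, Algebra.TensorProduct.one_def,
    offLie_one_one_fst_tmul, ← TensorProduct.tmul_smul, ← TensorProduct.tmul_add,
    ← TensorProduct.tmul_sub]
  congr 1
  obtain ⟨s0, s1, s2, s3, s4, s5, s6, s7, rfl⟩ := eq_co s
  fin_cases n <;> fin_cases t <;>
    simp only [pairA, pairB, pairC, unit, triality, own_eq, next_apply, prev_apply, one_eq_co,
      i, j, k, kl, jl, il, l, co_mul, co_star, co_add, co_sub, co_smul, co_ip, Matrix.cons_val,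
      Fin.isValue, Fin.mk_one, Fin.zero_eta, Fin.reduceFinMk, Fin.reduceEq, Fin.reduceAdd,
      zero_ne_one, one_ne_zero, ↓reduceIte, mul_zero, zero_mul, mul_one, one_mul, add_zero,
      zero_add, sub_zero, zero_sub, neg_zero, sub_self, mul_neg, neg_mul, neg_neg] <;>
    apply co_congr <;> ring

theorem off_tmul_mem_of_basisUnit {t : Fin 3} {R : Oct 1} {W : Submodule ℝ e8}
    (h : ∀ n, off t (R ⊗ₜ basisUnit n) ∈ W) (p : Oct (-1)) : off t (R ⊗ₜ p) ∈ W := by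
  rw [← sum_ip_basisUnit_smul p, TensorProduct.tmul_sum, ← offL_apply, map_sum]
  refine sum_mem fun n _ => ?_
  rw [TensorProduct.tmul_smul, map_smul]
  exact W.smul_mem _ (h n)

theorem A_mem_e6Generators (n : Fin 7) : A n ∈ e6Generators := by simp [e6Generators]

theorem G_mem_e6Generators (n : Fin 7) : G n ∈ e6Generators := by simp [e6Generators]

theorem S_one_mem_e6Generators (n : Fin 7) : S (1 ⊗ₜ unit n) ∈ e6Generators := by
  simp [e6Generators]

theorem D_one_mem_e6Generators (n : Fin 7) : D (1 ⊗ₜ unit n) ∈ e6Generators := by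
  simp [e6Generators]

theorem D_l_mem_e6Generators : D (l ⊗ₜ 1) ∈ e6Generators := by simp [e6Generators]

theorem S_l_mem_e6Generators : S (l ⊗ₜ 1) ∈ e6Generators := by simp [e6Generators]

theorem off_one_mem_e6Generators (t : Fin 3) (n : Fin 8) :
    off t (1 ⊗ₜ basisUnit n) ∈ e6Generators := by
  fin_cases t
  · change X _ ∈ _; simp [e6Generators]
  · change Y _ ∈ _; simp [e6Generators]
  · change Z _ ∈ _; simp [e6Generators]

theorem off_l_mem_e6Generators (t : Fin 3) (n : Fin 8) :
    off t (l ⊗ₜ basisUnit n) ∈ e6Generators := by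
  fin_cases t
  · change X _ ∈ _; simp [e6Generators]
  · change Y _ ∈ _; simp [e6Generators]
  · change Z _ ∈ _; simp [e6Generators]

/-- The indices in `basisUnit` of the two units of `pairA n`, `pairB n` and `pairC n`. -/
def pairIndex : Fin 3 → Fin 7 → Fin 8 × Fin 8 :=
  ![![(2, 3), (3, 1), (1, 2), (5, 1), (6, 3), (4, 2), (6, 1)],
    ![(4, 5), (6, 4), (5, 6), (2, 6), (1, 4), (3, 5), (5, 2)],
    ![(7, 6), (7, 5), (7, 4), (3, 7), (2, 7), (1, 7), (4, 3)]]

theorem pair_eq_basisUnit_pairIndex (n : Fin 7) :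
    pairA n = (basisUnit (pairIndex 0 n).1, basisUnit (pairIndex 0 n).2) ∧
    pairB n = (basisUnit (pairIndex 1 n).1, basisUnit (pairIndex 1 n).2) ∧
    pairC n = (basisUnit (pairIndex 2 n).1, basisUnit (pairIndex 2 n).2) := by
  fin_cases n <;> exact ⟨rfl, rfl, rfl⟩

theorem exists_pairIndex (m n : Fin 8) : m = 0 ∨ n = 0 ∨ m = n ∨
    ∃ t k, pairIndex t k = (m, n) ∨ pairIndex t k = (n, m) := by
  revert m n; decide

theorem DO_mem_span_e6Generators (n : Fin 7) : DO (pairA n) ∈ Submodule.span ℝ e6Generators ∧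
    DO (pairB n) ∈ Submodule.span ℝ e6Generators ∧
      DO (pairC n) ∈ Submodule.span ℝ e6Generators := by
  have hA := Submodule.subset_span (R := ℝ) (A_mem_e6Generators n)
  have hG := Submodule.subset_span (R := ℝ) (G_mem_e6Generators n)
  have hS := Submodule.subset_span (R := ℝ) (S_one_mem_e6Generators n)
  rw [← DO_add_DO_add_DO] at hS
  rw [A] at hA
  rw [G] at hG
  have hC : DO (pairC n) ∈ Submodule.span ℝ e6Generators := by
    convert Submodule.smul_mem _ (1 / 3 : ℝ) (add_mem hS hG) using 1; module
  have hB : DO (pairB n) ∈ Submodule.span ℝ e6Generators := by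
    convert Submodule.smul_mem _ (1 / 2 : ℝ) (add_mem (sub_mem hS hC) hA) using 1; module
  refine ⟨?_, hB, hC⟩
  convert sub_mem hB hA using 1; module

theorem offLie_basisUnit_pairIndex_mem_span (t : Fin 3) (n : Fin 7) :
    offLie 0 (1 ⊗ₜ basisUnit (pairIndex t n).1) (1 ⊗ₜ basisUnit (pairIndex t n).2) ∈
      Submodule.span ℝ e6Generators := by
  obtain ⟨hA, hB, hC⟩ := DO_mem_span_e6Generators n
  obtain ⟨eA, eB, eC⟩ := pair_eq_basisUnit_pairIndex n
  have h_half : (1 / 2 : ℝ) ≠ 0 := by norm_num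
  rw [eA, DO_eq, Submodule.smul_mem_iff _ h_half] at hA
  rw [eB, DO_eq, Submodule.smul_mem_iff _ h_half] at hB
  rw [eC, DO_eq, Submodule.smul_mem_iff _ h_half] at hC
  fin_cases t
  exacts [hA, hB, hC]

theorem offLie_one_mem_span_of_D_S {q : BiOct} (hD : D q ∈ Submodule.span ℝ e6Generators)
    (hS : S q ∈ Submodule.span ℝ e6Generators) (t : Fin 3) :
    offLie t 1 q ∈ Submodule.span ℝ e6Generators := by
  have h := D_add_E_add_F q
  have hE : E q ∈ Submodule.span ℝ e6Generators := by
    convert Submodule.smul_mem _ (1 / 2 : ℝ) (sub_mem hS hD) using 1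
    rw [S]
    linear_combination (norm := module) (1 / 2 : ℝ) • h
  have hF : F q ∈ Submodule.span ℝ e6Generators := by
    rw [eq_neg_of_add_eq_zero_right h]
    exact neg_mem (add_mem hD hE)
  have h_half : (1 / 2 : ℝ) ≠ 0 := by norm_num
  rw [D_eq, Submodule.smul_mem_iff _ h_half] at hD
  rw [E_eq, Submodule.smul_mem_iff _ h_half] at hE
  rw [F_eq, Submodule.smul_mem_iff _ h_half] at hF
  fin_cases t
  exacts [hD, hE, hF]

theorem offLie_self (t : Fin 3) (a : BiOct) : offLie t a a = 0 := lie_self _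

theorem offLie_one_basisUnit_mem_span (t : Fin 3) (n : Fin 8) :
    offLie t 1 (1 ⊗ₜ basisUnit n) ∈ Submodule.span ℝ e6Generators := by
  refine Fin.cases ?_ (fun n => ?_) n
  · change offLie t 1 1 ∈ _
    rw [offLie_self]
    exact zero_mem _
  · exact offLie_one_mem_span_of_D_S (Submodule.subset_span (D_one_mem_e6Generators n))
      (Submodule.subset_span (S_one_mem_e6Generators n)) t

theorem offLie_one_tmul_mem_span (t : Fin 3) (p : Oct (-1)) :
    offLie t 1 (1 ⊗ₜ p) ∈ Submodule.span ℝ e6Generators := by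
  rw [← sum_ip_basisUnit_smul p, TensorProduct.tmul_sum, map_sum]
  refine sum_mem fun n _ => ?_
  rw [TensorProduct.tmul_smul, map_smul]
  exact Submodule.smul_mem _ _ (offLie_one_basisUnit_mem_span t n)

theorem offLie_zero_basisUnit_mem_span (m n : Fin 8) :
    offLie 0 (1 ⊗ₜ basisUnit m) (1 ⊗ₜ basisUnit n) ∈ Submodule.span ℝ e6Generators := by
  rcases exists_pairIndex m n with rfl | rfl | rfl | ⟨t, k, h | h⟩
  · exact offLie_one_basisUnit_mem_span 0 n
  · rw [offLie_swap]
    exact neg_mem (offLie_one_basisUnit_mem_span 0 m)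
  · rw [offLie_self]
    exact zero_mem _
  · have h_mem := offLie_basisUnit_pairIndex_mem_span t k
    rwa [h] at h_mem
  · have h_mem := offLie_basisUnit_pairIndex_mem_span t k
    rw [h] at h_mem
    rw [offLie_swap]
    exact neg_mem h_mem

theorem offLie_zero_tmul_mem_span (p q : Oct (-1)) :
    offLie 0 (1 ⊗ₜ p) (1 ⊗ₜ q) ∈ Submodule.span ℝ e6Generators := by
  rw [← sum_ip_basisUnit_smul p, ← sum_ip_basisUnit_smul q]
  simp only [TensorProduct.tmul_sum, TensorProduct.tmul_smul, map_sum, LinearMap.sum_apply,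
    map_smul, LinearMap.smul_apply]
  exact sum_mem fun n _ => Submodule.smul_mem _ _ <| sum_mem fun m _ => Submodule.smul_mem _ _ <|
    offLie_zero_basisUnit_mem_span m n

theorem offLie_tmul_mem_span (t : Fin 3) (p q : Oct (-1)) :
    offLie t (1 ⊗ₜ p) (1 ⊗ₜ q) ∈ Submodule.span ℝ e6Generators := by
  have h_zero := offLie_zero_tmul_mem_span
  have h_one := offLie_one_tmul_mem_span
  fin_cases t
  · exact h_zero p q
  · have h := offLie_cyclic 0 (1 ⊗ₜ star q) (1 ⊗ₜ p) 1
    simp only [mul_one, one_mul, BiOct.mul_tmul, BiOct.star_tmul, star_one, star_star] at h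
    rw [add_right_comm] at h
    exact (eq_neg_of_add_eq_zero_right h).symm ▸ neg_mem (add_mem (h_zero _ _) (h_one _ _))
  · have h := offLie_cyclic 0 (1 ⊗ₜ star q) 1 (1 ⊗ₜ p)
    simp only [mul_one, one_mul, BiOct.mul_tmul, BiOct.star_tmul, star_one, star_star] at h
    exact (eq_neg_of_add_eq_zero_right h).symm ▸ neg_mem (add_mem (h_zero _ _) (h_one _ _))

theorem su3_le_span : su3.toSubmodule ≤ Submodule.span ℝ e6Generators :=
  su3_le
    (fun t => off_tmul_mem_of_basisUnit fun n =>
      Submodule.subset_span (off_one_mem_e6Generators t n))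
    (fun t => off_tmul_mem_of_basisUnit fun n =>
      Submodule.subset_span (off_l_mem_e6Generators t n))
    offLie_tmul_mem_span
    (offLie_one_mem_span_of_D_S (Submodule.subset_span D_l_mem_e6Generators)
      (Submodule.subset_span S_l_mem_e6Generators))

theorem e6Generators_subset {K : LieSubalgebra ℝ e8} (h_one : ∀ t p, off t (1 ⊗ₜ p) ∈ K)
    (h_l : ∀ t p, off t (l ⊗ₜ p) ∈ K) : e6Generators ⊆ K := by
  have h_lie (t : Fin 3) (a b : BiOct) (ha : off t a ∈ K) (hb : off t b ∈ K) :
      (1 / 2 : ℝ) • ⁅off t a, off t b⁆ ∈ K := K.smul_mem _ (K.lie_mem ha hb)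
  have hDO (p : Oct (-1) × Oct (-1)) : DO p ∈ K := h_lie _ _ _ (h_one _ _) (h_one _ _)
  have hD {q : BiOct} (hq : ∀ t, off t q ∈ K) : D q ∈ K := h_lie _ _ _ (h_one _ 1) (hq _)
  have hS {q : BiOct} (hq : ∀ t, off t q ∈ K) : S q ∈ K :=
    sub_mem (h_lie _ _ _ (h_one _ 1) (hq _)) (h_lie _ _ _ (h_one _ 1) (hq _))
  rintro x ((((((((((⟨n, rfl⟩ | ⟨n, rfl⟩) | ⟨n, rfl⟩) | ⟨n, rfl⟩) | ⟨n, rfl⟩) | ⟨n, rfl⟩) |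
    ⟨n, rfl⟩) | ⟨n, rfl⟩) | ⟨n, rfl⟩) | ⟨n, rfl⟩) | rfl | rfl)
  · exact neg_mem (sub_mem (hDO _) (hDO _))
  · exact neg_mem (sub_mem (add_mem (hDO _) (hDO _)) (K.smul_mem _ (hDO _)))
  · exact hS fun t => h_one _ _
  · exact hD fun t => h_one _ _
  · exact h_one _ _
  · exact h_one _ _
  · exact h_one _ _
  · exact h_l _ _
  · exact h_l _ _
  · exact h_l _ _
  · exact hD fun t => h_l _ _
  · exact hS fun t => h_l _ _

theorem e6_le {K : LieSubalgebra ℝ e8} (h_one : ∀ t p, off t (1 ⊗ₜ p) ∈ K)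
    (h_l : ∀ t p, off t (l ⊗ₜ p) ∈ K) : e6 ≤ K :=
  LieSubalgebra.lieSpan_le.2 (e6Generators_subset h_one h_l)

theorem e6_le_su3 : e6 ≤ su3 :=
  e6_le (fun t p => off_mem_su3 t (BiOct.one_tmul_mem_splitComplex p))
    (fun t p => off_mem_su3 t (BiOct.l_tmul_mem_splitComplex p))

theorem e6_eq_span : e6.toSubmodule = Submodule.span ℝ e6Generators :=
  le_antisymm (le_trans e6_le_su3 su3_le_span) LieSubalgebra.submodule_span_le_lieSpan

theorem e6_eq_su3 : e6 = su3 := by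
  refine le_antisymm e6_le_su3 ?_
  change su3.toSubmodule ≤ e6.toSubmodule
  exact su3_le_span.trans_eq e6_eq_span.symm

end e8

theorem linearIndependent_of_dual_family {K V ι : Type*} [Field K] [AddCommGroup V] [Module K V]
    {b : ι → V} (φ : ι → V →ₗ[K] K) (h_self : ∀ i, φ i (b i) ≠ 0)
    (h_ne : ∀ i j, i ≠ j → φ i (b j) = 0) : LinearIndependent K b := by
  classical
  rw [linearIndependent_iff']
  intro s g hg i hi
  have h := congrArg (φ i) hg
  rw [map_sum, map_zero, Finset.sum_eq_single_of_mem i hi fun j _ hj => by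
    rw [map_smul, h_ne i j hj.symm, smul_zero]] at h
  simpa [h_self] using h

namespace e8
open GMat Oct

/-- The generators of `𝔢₆`, as a family. -/
def e6Family : (Fin 4 × Fin 7) ⊕ (Fin 6 × Fin 8) ⊕ Fin 2 → e8 :=
  Sum.elim (fun x => ![A x.2, G x.2, S (1 ⊗ₜ unit x.2), D (1 ⊗ₜ unit x.2)] x.1)
    (Sum.elim (fun x => ![X (1 ⊗ₜ basisUnit x.2), Y (1 ⊗ₜ basisUnit x.2), Z (1 ⊗ₜ basisUnit x.2),
      X (l ⊗ₜ basisUnit x.2), Y (l ⊗ₜ basisUnit x.2), Z (l ⊗ₜ basisUnit x.2)] x.1)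
      ![D (l ⊗ₜ 1), S (l ⊗ₜ 1)])

theorem e6Generators_subset_range_e6Family : e6Generators ⊆ Set.range e6Family := by
  rintro x ((((((((((⟨n, rfl⟩ | ⟨n, rfl⟩) | ⟨n, rfl⟩) | ⟨n, rfl⟩) | ⟨n, rfl⟩) | ⟨n, rfl⟩) |
    ⟨n, rfl⟩) | ⟨n, rfl⟩) | ⟨n, rfl⟩) | ⟨n, rfl⟩) | rfl | rfl)
  · exact ⟨.inl (0, n), rfl⟩
  · exact ⟨.inl (1, n), rfl⟩
  · exact ⟨.inl (2, n), rfl⟩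
  · exact ⟨.inl (3, n), rfl⟩
  · exact ⟨.inr (.inl (0, n)), rfl⟩
  · exact ⟨.inr (.inl (1, n)), rfl⟩
  · exact ⟨.inr (.inl (2, n)), rfl⟩
  · exact ⟨.inr (.inl (3, n)), rfl⟩
  · exact ⟨.inr (.inl (4, n)), rfl⟩
  · exact ⟨.inr (.inl (5, n)), rfl⟩
  · exact ⟨.inr (.inr 0), rfl⟩
  · exact ⟨.inr (.inr 1), rfl⟩

theorem e6_le_span_range_e6Family : e6.toSubmodule ≤ Submodule.span ℝ (Set.range e6Family) :=
  e6_eq_span.trans_le (Submodule.span_mono e6Generators_subset_range_e6Family)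

instance : Module.Finite ℝ e6 :=
  have := Module.Finite.span_of_finite ℝ (Set.finite_range e6Family)
  Submodule.finiteDimensional_of_le e6_le_span_range_e6Family

theorem finrank_e6_le : Module.finrank ℝ e6 ≤ 78 := by
  have := Module.Finite.span_of_finite ℝ (Set.finite_range e6Family)
  refine (Submodule.finrank_mono e6_le_span_range_e6Family).trans ?_
  exact (finrank_range_le_card e6Family).trans_eq (by simp)

/-- Evaluation of the `i`-th operator of the diagonal part at `c`. -/
def fstL (i : Fin 3) (c : BiOct) : e8 →ₗ[ℝ] BiOct where
  toFun x := x.1.1 i c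
  map_add' _ _ := rfl
  map_smul' _ _ := rfl

/-- The `i`-th parameter of the off-diagonal part. -/
def sndL (i : Fin 3) : e8 →ₗ[ℝ] BiOct where
  toFun x := x.1.2 i
  map_add' _ _ := rfl
  map_smul' _ _ := rfl

@[simp] theorem fstL_apply (i : Fin 3) (c : BiOct) (x : e8) : fstL i c x = x.1.1 i c := rfl
@[simp] theorem sndL_apply (i : Fin 3) (x : e8) : sndL i x = x.1.2 i := rfl

/-- The index set of `e6Basis`: `48` off-diagonal elements, `28` rotations and `2` boosts. -/
abbrev E6Index : Type := (Fin 3 × Fin 2 × Fin 8) ⊕ {x : Fin 8 × Fin 8 // x.1 < x.2} ⊕ Fin 2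

/-- A linearly independent family in `𝔢₆`: off-diagonal elements, the rotations `[X_p, X_q]`
spanning `𝔰𝔬(8)`, and the boosts `D_L` and `S_L`. Unlike the generators it is adapted to a family
of coordinate functionals. -/
def e6Basis : E6Index → e8 :=
  Sum.elim (fun x => off x.1 ((![1, l] x.2.1 : Oct 1) ⊗ₜ basisUnit x.2.2))
    (Sum.elim (fun x => offLie 0 (1 ⊗ₜ basisUnit x.1.1) (1 ⊗ₜ basisUnit x.1.2))
      ![D (l ⊗ₜ 1), S (l ⊗ₜ 1)])

/-- Linear functionals dual to `e6Basis` up to nonzero scalars. -/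
def e6Dual : E6Index → e8 →ₗ[ℝ] ℝ :=
  Sum.elim (fun x => ipL (basisUnit x.2.2) ∘ₗ BiOct.contract (![1, l] x.2.1) ∘ₗ sndL x.1)
    (Sum.elim (fun x => ipL (basisUnit x.1.2) ∘ₗ BiOct.contract 1 ∘ₗ
        fstL 0 (1 ⊗ₜ basisUnit x.1.1))
      ![ipL 1 ∘ₗ BiOct.contract l ∘ₗ fstL 0 1,
        ipL 1 ∘ₗ BiOct.contract l ∘ₗ (fstL 0 1 + (2 : ℝ) • fstL 1 1)])

@[simp] theorem D_snd (q : BiOct) (i : Fin 3) : (D q).1.2 i = 0 := by simp [D_eq]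

@[simp] theorem S_snd (q : BiOct) (i : Fin 3) : (S q).1.2 i = 0 := by simp [S, E_eq, F_eq]

theorem offLie_one_l_fst_tmul (t i : Fin 3) (s : Oct (-1)) :
    (offLie t 1 (l ⊗ₜ 1)).1.1 i (1 ⊗ₜ s) = triality t 1 l i 1 ⊗ₜ[ℝ] s := by
  rw [Algebra.TensorProduct.one_def, offLie_fst_tmul, ip_one_l, ip_one_one]
  simp

theorem D_l_fst_tmul (i : Fin 3) (s : Oct (-1)) :
    (D (l ⊗ₜ 1)).1.1 i (1 ⊗ₜ s) = (![2, -1, -1] i : ℝ) • (l ⊗ₜ[ℝ] s) := by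
  rw [D_eq, smul_fst, LinearMap.smul_apply, offLie_one_l_fst_tmul, TensorProduct.smul_tmul',
    TensorProduct.smul_tmul']
  congr 1
  fin_cases i <;> simp [triality, own_apply, next_apply, prev_apply, star_l] <;> module

theorem S_l_fst_tmul (i : Fin 3) (s : Oct (-1)) :
    (S (l ⊗ₜ 1)).1.1 i (1 ⊗ₜ s) = (![0, 3, -3] i : ℝ) • (l ⊗ₜ[ℝ] s) := by
  rw [S, E_eq, F_eq, sub_fst, LinearMap.sub_apply, smul_fst, smul_fst, LinearMap.smul_apply,
    LinearMap.smul_apply, offLie_one_l_fst_tmul, offLie_one_l_fst_tmul,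
    TensorProduct.smul_tmul', TensorProduct.smul_tmul', ← TensorProduct.sub_tmul,
    TensorProduct.smul_tmul']
  congr 1
  fin_cases i <;> simp [triality, own_apply, next_apply, prev_apply, star_l] <;> module

theorem ip_own_basisUnit (p q r s : Fin 8) :
    ip (basisUnit s) (own (basisUnit p) (basisUnit q) (basisUnit r) : Oct (-1)) =
      4 * ((if p = r then 1 else 0) * (if s = q then 1 else 0) -
        (if q = r then 1 else 0) * (if s = p then 1 else 0)) := by
  rw [own_eq, ip_sub_right, ip_smul_right, ip_smul_right]
  simp only [ip_basisUnit]
  ring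

theorem e6Dual_self_ne_zero (x : E6Index) : e6Dual x (e6Basis x) ≠ 0 := by
  rcases x with ⟨t, z, n⟩ | ⟨⟨p, q⟩, hpq⟩ | m
  · fin_cases z <;> simp [e6Dual, e6Basis, off_snd, ip_neg_right, ip_basisUnit, ip_one_one, ip_l_l]
  · have hpq : p < q := hpq
    simp [e6Dual, e6Basis, offLie_one_one_fst_tmul, triality, ip_own_basisUnit, ip_one_one,
      hpq.ne']
  · fin_cases m <;> simp [e6Dual, e6Basis, Algebra.TensorProduct.one_def, D_l_fst_tmul,
      S_l_fst_tmul, ip_neg_right, ip_smul_right, ip_one_one, ip_l_l]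

theorem e6Dual_off_of_ne {x : Fin 3 × Fin 2 × Fin 8} {y : E6Index} (h : .inl x ≠ y) :
    e6Dual (.inl x) (e6Basis y) = 0 := by
  obtain ⟨t, z, n⟩ := x
  rcases y with ⟨t', z', n'⟩ | ⟨⟨p, q⟩, hpq⟩ | m
  · by_cases ht : t = t'
    · subst ht
      by_cases hn : n = n'
      · subst hn
        fin_cases z <;> fin_cases z' <;>
          simp [e6Dual, e6Basis, off_snd, ip_zero_right, ip_one_l, ip_l_one] at h ⊢
      · fin_cases z <;> fin_cases z' <;>
          simp [e6Dual, e6Basis, off_snd, ip_basisUnit, hn]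
    · simp [e6Dual, e6Basis, off_snd, ip_zero_right, ht]
  · simp [e6Dual, e6Basis, ip_zero_right]
  · fin_cases m <;> simp [e6Dual, e6Basis, ip_zero_right]

theorem e6Dual_rotation_of_ne {x : {x : Fin 8 × Fin 8 // x.1 < x.2}} {y : E6Index}
    (h : .inr (.inl x) ≠ y) : e6Dual (.inr (.inl x)) (e6Basis y) = 0 := by
  obtain ⟨⟨p, q⟩, hpq⟩ := x
  rcases y with ⟨t', z', n'⟩ | ⟨⟨p', q'⟩, hpq'⟩ | m
  · simp [e6Dual, e6Basis, ip_zero_right]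
  · have hpq : p < q := hpq
    have hpq' : p' < q' := hpq'
    simp only [e6Dual, e6Basis, Sum.elim_inr, Sum.elim_inl, LinearMap.comp_apply, fstL_apply,
      offLie_one_one_fst_tmul, BiOct.contract_tmul, ipL_apply, triality, if_true, ip_one_one,
      one_smul, ip_own_basisUnit]
    split_ifs <;> simp_all
    omega
  · fin_cases m <;> simp [e6Dual, e6Basis, D_l_fst_tmul, S_l_fst_tmul, ip_one_l, ip_zero_right]

theorem e6Dual_boost_of_ne {m : Fin 2} {y : E6Index} (h : .inr (.inr m) ≠ y) :
    e6Dual (.inr (.inr m)) (e6Basis y) = 0 := by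
  rcases y with ⟨t, z, n⟩ | ⟨⟨p, q⟩, hpq⟩ | m'
  · fin_cases m <;> simp [e6Dual, e6Basis, ip_zero_right]
  · fin_cases m <;> simp [e6Dual, e6Basis, Algebra.TensorProduct.one_def,
      offLie_one_one_fst_tmul, ip_l_one, ip_zero_right]
  · fin_cases m <;> fin_cases m' <;>
      simp [e6Dual, e6Basis, Algebra.TensorProduct.one_def, D_l_fst_tmul, S_l_fst_tmul,
        ip_zero_right] at h ⊢

theorem linearIndependent_e6Basis : LinearIndependent ℝ e6Basis := by
  refine linearIndependent_of_dual_family e6Dual e6Dual_self_ne_zero ?_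
  rintro (x | x | m) y h
  exacts [e6Dual_off_of_ne h, e6Dual_rotation_of_ne h, e6Dual_boost_of_ne h]

theorem e6Basis_mem_e6 (x : E6Index) : e6Basis x ∈ e6 := by
  rw [e6_eq_su3]
  have h_one (t p) := off_mem_su3 t (BiOct.one_tmul_mem_splitComplex p)
  have h_l (t p) := off_mem_su3 t (BiOct.l_tmul_mem_splitComplex p)
  rcases x with ⟨t, z, n⟩ | ⟨p, q⟩ | m
  · fin_cases z
    exacts [h_one _ _, h_l _ _]
  · exact su3.lie_mem (h_one _ _) (h_one _ _)
  · have h_boost (t) := su3.smul_mem (1 / 2 : ℝ) (su3.lie_mem (h_one t 1) (h_l t 1))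
    fin_cases m
    exacts [h_boost 0, sub_mem (h_boost 1) (h_boost 2)]

theorem finrank_e6 : Module.finrank ℝ e6 = 78 := by
  refine le_antisymm finrank_e6_le ?_
  have h : LinearIndependent ℝ (fun x => (⟨e6Basis x, e6Basis_mem_e6 x⟩ : e6)) :=
    LinearIndependent.of_comp e6.toSubmodule.subtype linearIndependent_e6Basis
  exact h.fintype_card_le_finrank

end e8

theorem tmul_eq_zero_iff {K V W : Type*} [Field K] [AddCommGroup V] [Module K V] [AddCommGroup W]
    [Module K W] {v : V} {w : W} : v ⊗ₜ[K] w = 0 ↔ v = 0 ∨ w = 0 := by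
  refine ⟨fun h => ?_, ?_⟩
  · have h_dual (f : Module.Dual K V) (g : Module.Dual K W) : f v = 0 ∨ g w = 0 := by
      simpa using congrArg (TensorProduct.lid K K ∘ TensorProduct.map f g) h
    by_contra! hvw
    obtain ⟨f, hf⟩ := not_forall.1 (mt (Module.forall_dual_apply_eq_zero_iff K v).1 hvw.1)
    obtain ⟨g, hg⟩ := not_forall.1 (mt (Module.forall_dual_apply_eq_zero_iff K w).1 hvw.2)
    exact (h_dual f g).elim hf hg
  · rintro (rfl | rfl)
    exacts [TensorProduct.zero_tmul _ _, TensorProduct.tmul_zero _ _]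

namespace Oct

theorem co_inj {γ : ℝ} {a0 a1 a2 a3 a4 a5 a6 a7 b0 b1 b2 b3 b4 b5 b6 b7 : ℝ} :
    (co a0 a1 a2 a3 a4 a5 a6 a7 : Oct γ) = co b0 b1 b2 b3 b4 b5 b6 b7 ↔ a0 = b0 ∧ a1 = b1 ∧
      a2 = b2 ∧ a3 = b3 ∧ a4 = b4 ∧ a5 = b5 ∧ a6 = b6 ∧ a7 = b7 := by
  refine ⟨fun h => ?_, fun ⟨h0, h1, h2, h3, h4, h5, h6, h7⟩ => co_congr h0 h1 h2 h3 h4 h5 h6 h7⟩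
  obtain ⟨h_fst, h_snd⟩ := Prod.ext_iff.1 h
  exact ⟨congrArg (·.re) h_fst, congrArg (·.imI) h_fst, congrArg (·.imJ) h_fst,
    congrArg (·.imK) h_fst, congrArg (·.re) h_snd, congrArg (·.imI) h_snd,
    congrArg (·.imJ) h_snd, congrArg (·.imK) h_snd⟩

theorem mem_labels {Q : Oct 1} : Q ∈ e8.labels ↔
    Q = co 0 (1/2) 0 0 0 (1/2) 0 0 ∨ Q = co 0 (1/2) 0 0 0 (-1/2) 0 0 ∨
    Q = co 0 0 (1/2) 0 0 0 (1/2) 0 ∨ Q = co 0 0 (1/2) 0 0 0 (-1/2) 0 ∨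
    Q = co 0 0 0 (1/2) 0 0 0 (1/2) ∨ Q = co 0 0 0 (1/2) 0 0 0 (-1/2) := by
  have h_two_smul (R : Oct 1) : (2 : ℝ) • Q = R ↔ Q = (1 / 2 : ℝ) • R := by
    rw [one_div, eq_inv_smul_iff₀ two_ne_zero]
  simp only [e8.labels, Set.mem_ofPred_eq, Set.mem_insert_iff, Set.mem_singleton_iff, h_two_smul,
    i, j, k, il, jl, kl, co_add, co_sub, co_smul]
  norm_num [neg_div]

theorem mem_labelSpan_of_mem_labels {Q : Oct 1} (hQ : Q ∈ e8.labels) : Q ∈ labelSpan := by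
  rcases mem_labels.1 hQ with rfl | rfl | rfl | rfl | rfl | rfl <;>
    exact co_mem_labelSpan _ _ _ _ _ _

theorem l_mul_eq_or_eq_neg {Q : Oct 1} (hQ : Q ∈ e8.labels) : l * Q = Q ∨ l * Q = -Q := by
  rcases mem_labels.1 hQ with rfl | rfl | rfl | rfl | rfl | rfl <;>
    simp only [l_mul_co, co_neg, co_inj] <;> norm_num

theorem ne_zero_of_mem_labels {Q : Oct 1} (hQ : Q ∈ e8.labels) : Q ≠ 0 := by
  rw [zero_eq_co]
  rcases mem_labels.1 hQ with rfl | rfl | rfl | rfl | rfl | rfl <;>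
    simp only [Ne, co_inj] <;> norm_num

theorem l_mul_eq_neg_iff {Q : Oct 1} (hQ : Q ∈ e8.labels) : l * Q = -Q ↔ l * Q ≠ Q := by
  refine ⟨fun h h' => ne_zero_of_mem_labels hQ ?_, (l_mul_eq_or_eq_neg hQ).resolve_left⟩
  have h2 : (2 : ℝ) • Q = 0 := by
    rw [two_smul]
    exact add_eq_zero_iff_eq_neg.2 (h'.symm.trans h)
  exact (smul_eq_zero_iff_right two_ne_zero).1 h2

theorem setOf_l_mul_eq : {Q ∈ e8.labels | l * Q = Q} =
    {co 0 (1/2) 0 0 0 (-1/2) 0 0, co 0 0 (1/2) 0 0 0 (-1/2) 0, co 0 0 0 (1/2) 0 0 0 (-1/2)} := by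
  ext Q
  simp only [Set.mem_ofPred_eq, mem_labels, Set.mem_insert_iff, Set.mem_singleton_iff]
  constructor
  · rintro ⟨rfl | rfl | rfl | rfl | rfl | rfl, h⟩ <;> simp only [l_mul_co, co_inj] at h ⊢ <;>
      norm_num at h <;> norm_num
  · rintro (rfl | rfl | rfl) <;> simp only [l_mul_co, co_inj] <;> norm_num

theorem setOf_l_mul_eq_neg : {Q ∈ e8.labels | l * Q = -Q} =
    {co 0 (1/2) 0 0 0 (1/2) 0 0, co 0 0 (1/2) 0 0 0 (1/2) 0, co 0 0 0 (1/2) 0 0 0 (1/2)} := by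
  ext Q
  simp only [Set.mem_ofPred_eq, mem_labels, Set.mem_insert_iff, Set.mem_singleton_iff]
  constructor
  · rintro ⟨rfl | rfl | rfl | rfl | rfl | rfl, h⟩ <;>
      simp only [l_mul_co, co_neg, co_inj] at h ⊢ <;> norm_num at h <;> norm_num
  · rintro (rfl | rfl | rfl) <;> simp only [l_mul_co, co_neg, co_inj] <;> norm_num

theorem ncard_l_mul_eq : {Q ∈ e8.labels | l * Q = Q}.ncard = 3 := by
  rw [setOf_l_mul_eq, Set.ncard_eq_three]
  refine ⟨_, _, _, ?_, ?_, ?_, rfl⟩ <;> rw [Ne, co_inj] <;> norm_num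

theorem ncard_l_mul_eq_neg : {Q ∈ e8.labels | l * Q = -Q}.ncard = 3 := by
  rw [setOf_l_mul_eq_neg, Set.ncard_eq_three]
  refine ⟨_, _, _, ?_, ?_, ?_, rfl⟩ <;> rw [Ne, co_inj] <;> norm_num

theorem finrank_eq (γ : ℝ) : Module.finrank ℝ (Oct γ) = 8 := by
  change Module.finrank ℝ (ℍ[ℝ] × ℍ[ℝ]) = 8
  rw [Module.finrank_prod, Quaternion.finrank_eq_four]

instance (γ : ℝ) : Module.Finite ℝ (Oct γ) := inferInstanceAs (Module.Finite ℝ (ℍ[ℝ] × ℍ[ℝ]))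

end Oct

namespace Albert
open Oct

/-- The Hermitian matrix with diagonal `d` and entries `p i` in the positions `(i, i + 1)`. -/
def ofEntries (d : Fin 3 → ℝ) (p : Fin 3 → Oct (-1)) : Albert :=
  ⟨Matrix.of fun i j => if j = i then d i • 1 else if j = i + 1 then p i else star (p j), by
    refine Matrix.ext fun i j => ?_
    change star (ite (i = j) _ (ite _ _ _)) = ite (j = i) _ (ite _ _ _)
    rcases eq_or_eq_add_one_or_eq_add_two i j with rfl | rfl | rfl
    · simp
    · have h1 : i ≠ i + 1 := by revert i; decide
      have h2 : i ≠ i + 1 + 1 := by revert i; decide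
      simp [h1, h2]
    · have h1 : i ≠ i + 2 := by revert i; decide
      have h2 : i + 2 ≠ i + 1 := by revert i; decide
      have h3 : i + 2 + 1 = i := by revert i; decide
      simp [h1, h1.symm, h2, h3]⟩

@[simp] theorem diagEntry_ofEntries (d : Fin 3 → ℝ) (p : Fin 3 → Oct (-1)) :
    diagEntry (ofEntries d p) = d := by
  funext i; simp [diagEntry, ofEntries]

@[simp] theorem ofEntries_apply_add_one (d : Fin 3 → ℝ) (p : Fin 3 → Oct (-1)) (i : Fin 3) :
    (ofEntries d p).1 i (i + 1) = p i := by
  simp [ofEntries]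

/-- The coordinates of the Albert algebra: the diagonal and the entries in the positions
`(i, i + 1)`. -/
@[simps] def entriesEquiv : Albert ≃ₗ[ℝ] (Fin 3 → ℝ) × (Fin 3 → Oct (-1)) where
  toFun P := (diagEntry P, fun i => P.1 i (i + 1))
  map_add' _ _ := rfl
  map_smul' _ _ := rfl
  invFun x := ofEntries x.1 x.2
  left_inv P := ext_entries (by simp) (by simp)
  right_inv x := by ext <;> simp

theorem finrank_eq : Module.finrank ℝ Albert = 27 := by
  rw [entriesEquiv.finrank_eq, Module.finrank_prod, Module.finrank_pi, Module.finrank_pi_fintype]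
  simp [Oct.finrank_eq]

instance : Module.Finite ℝ Albert := Module.Finite.equiv entriesEquiv.symm

theorem eq_sum_ofEntries (P : Albert) :
    P = ((2 * diagEntry P 0 - diagEntry P 1 - diagEntry P 2) / 3) • ofEntries ![1, -1, 0] 0 +
      ((diagEntry P 0 + diagEntry P 1 - 2 * diagEntry P 2) / 3) • ofEntries ![0, 1, -1] 0 +
      (-(diagEntry P 0 + diagEntry P 1 + diagEntry P 2) / 6) • ofEntries ![-2, -2, -2] 0 +
      ∑ t, ofEntries 0 (Pi.single t (P.1 t (t + 1))) := by
  apply entriesEquiv.injective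
  simp only [map_add, map_smul, Fin.sum_univ_three, entriesEquiv_apply]
  ext i
  · fin_cases i <;> simp <;> ring
  · fin_cases i <;> simp

end Albert

namespace e8
open GMat Oct Albert

/-- `𝓟 ↦ Q𝓟` as a linear map. -/
def labelledL {Q : Oct 1} (hQ : Q ∈ labelSpan) : Albert →ₗ[ℝ] e8 where
  toFun := labelled Q
  map_add' P R := by
    refine ext_tmul (fun i S s => ?_) (fun i => ?_)
    · rw [add_fst, LinearMap.add_apply, labelled_fst_tmul hQ, labelled_fst_tmul hQ,
        labelled_fst_tmul hQ, ← TensorProduct.add_tmul, ← diagOp_add]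
      rfl
    · rw [add_snd, labelled_snd, labelled_snd, labelled_snd, ← TensorProduct.tmul_add]; rfl
  map_smul' r P := by
    refine ext_tmul (fun i S s => ?_) (fun i => ?_)
    · rw [smul_fst, LinearMap.smul_apply, labelled_fst_tmul hQ, labelled_fst_tmul hQ,
        TensorProduct.smul_tmul', ← diagOp_smul]
      rfl
    · rw [smul_snd, labelled_snd, labelled_snd, ← TensorProduct.tmul_smul]; rfl

@[simp] theorem labelledL_apply {Q : Oct 1} (hQ : Q ∈ labelSpan) (P : Albert) :
    labelledL hQ P = labelled Q P := rfl

theorem labelled_neg_label {Q : Oct 1} (hQ : Q ∈ labelSpan) (P : Albert) :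
    labelled (-Q) P = -labelled Q P := by
  refine ext_tmul (fun i S s => ?_) (fun i => ?_)
  · have h_diagOp : diagOp (-Q) (diagEntry P) i S = -diagOp Q (diagEntry P) i S := by
      simp only [diagOp, labelPart, neg_mul, mul_neg, ip_neg_right]; module
    rw [neg_fst, LinearMap.neg_apply, labelled_fst_tmul hQ, labelled_fst_tmul (neg_mem hQ),
      h_diagOp, TensorProduct.neg_tmul]
  · rw [neg_snd, labelled_snd, labelled_snd, TensorProduct.neg_tmul]

theorem labelled_injective {Q : Oct 1} (hQ : Q ∈ labelSpan) (h0 : Q ≠ 0) :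
    Function.Injective (labelled Q) := by
  change Function.Injective (labelledL hQ)
  refine (injective_iff_map_eq_zero _).2 fun P hP => ext_entries (fun i => ?_) (fun i => ?_)
  · have h_diagOp (S : Oct 1) : diagOp Q (diagEntry P) i S = 0 := by
      have h := congrArg (fun x : e8 => x.1.1 i (S ⊗ₜ 1)) hP
      rw [labelledL_apply, labelled_fst_tmul hQ, zero_fst, LinearMap.zero_apply,
        tmul_eq_zero_iff] at h
      exact h.resolve_right fun h1 => by simpa [h1, ip_zero_left] using ip_one_one (γ := -1)
    have hlQ : l * Q ≠ 0 := fun h => h0 (by rw [← l_mul_l_mul hQ, h, mul_zero])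
    have h_one := h_diagOp 1
    have h_l := h_diagOp l
    rw [diagOp_one hQ, smul_eq_zero_iff_left h0] at h_one
    rw [diagOp_l hQ, smul_eq_zero_iff_left hlQ] at h_l
    change diagEntry P i = 0
    linarith
  · have h := congrArg (fun x : e8 => x.1.2 i) hP
    rwa [labelledL_apply, labelled_snd, zero_snd, tmul_eq_zero_iff, or_iff_right h0] at h

theorem sum_smul_offLie_one_label {Q : Oct 1} (hQ : Q ∈ labelSpan) (w : Fin 3 → ℝ) :
    ∑ t, w t • offLie t 1 (Q ⊗ₜ 1) =
      labelled Q (ofEntries (fun i => 2 * (w i - w (i + 2))) 0) := by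
  refine ext_tmul (fun i S s => ?_) (fun i => ?_)
  · rw [labelled_fst_tmul hQ, diagEntry_ofEntries, ← own_add_prev_add_next_one hQ w,
      ← LinearMap.smul_apply, ← LinearMap.smul_apply, ← LinearMap.smul_apply,
      ← LinearMap.add_apply, ← LinearMap.add_apply, ← sum_smul_triality, Fin.sum_univ_three,
      Fin.sum_univ_three]
    simp only [Algebra.TensorProduct.one_def, add_fst, smul_fst, LinearMap.add_apply,
      LinearMap.smul_apply, offLie_fst_tmul, triality_self, Pi.zero_apply, LinearMap.zero_apply,
      TensorProduct.tmul_zero, smul_zero, zero_add, ip_one_one, one_smul, TensorProduct.add_tmul,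
      ← TensorProduct.smul_tmul']
  · simp [Fin.sum_univ_three, labelled_snd]

theorem D_eq_labelled {Q : Oct 1} (hQ : Q ∈ labelSpan) :
    D (Q ⊗ₜ 1) = labelled Q (ofEntries ![1, -1, 0] 0) := by
  convert sum_smul_offLie_one_label hQ ![1 / 2, 0, 0] using 1
  · simp [Fin.sum_univ_three, D_eq]
  · congr 2; funext i; fin_cases i <;> simp

theorem E_eq_labelled {Q : Oct 1} (hQ : Q ∈ labelSpan) :
    E (Q ⊗ₜ 1) = labelled Q (ofEntries ![0, 1, -1] 0) := by
  convert sum_smul_offLie_one_label hQ ![0, 1 / 2, 0] using 1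
  · simp [Fin.sum_univ_three, E_eq]
  · congr 2; funext i; fin_cases i <;> simp

theorem GS_eq_labelled {Q : Oct 1} (hQ : Q ∈ labelSpan) :
    GS Q = labelled Q (ofEntries ![-2, -2, -2] 0) := by
  refine ext_tmul (fun i S s => ?_) (fun i => by simp [labelled_snd, GS_snd])
  rw [GS_fst_tmul hQ, labelled_fst_tmul hQ, TensorProduct.smul_tmul', ← diagOp_smul,
    diagEntry_ofEntries]
  congr 2; funext j; fin_cases j <;> simp

theorem off_tmul_eq_labelled {Q : Oct 1} (hQ : Q ∈ labelSpan) (t : Fin 3) (p : Oct (-1)) :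
    off t (Q ⊗ₜ p) = labelled Q (ofEntries 0 (Pi.single t p)) := by
  refine ext_tmul (fun i S s => ?_) (fun i => ?_)
  · rw [labelled_fst_tmul hQ, diagEntry_ofEntries, diagOp_of_sum_eq_zero Q (by simp)]
    simp
  · rw [labelled_snd, off_snd, ofEntries_apply_add_one, Pi.single_apply]
    split_ifs <;> simp

theorem labelled_mem_H {Q : Oct 1} (hQ : Q ∈ labelSpan) (P : Albert) : labelled Q P ∈ H Q := by
  have h_off (t : Fin 3) (p : Oct (-1)) : off t (Q ⊗ₜ p) ∈ H Q := by
    refine off_tmul_mem_of_basisUnit (fun n => Submodule.subset_span (Or.inl ?_)) p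
    fin_cases t
    exacts [.inl (.inl ⟨n, rfl⟩), .inl (.inr ⟨n, rfl⟩), .inr ⟨n, rfl⟩]
  have h_D : D (Q ⊗ₜ 1) ∈ H Q := Submodule.subset_span (by simp)
  have h_S : S (Q ⊗ₜ 1) ∈ H Q := Submodule.subset_span (by simp)
  have h_GS : GS Q ∈ H Q := Submodule.subset_span (by simp)
  have h_E : E (Q ⊗ₜ 1) ∈ H Q := by
    have h : E (Q ⊗ₜ 1) = (1 / 2 : ℝ) • (S (Q ⊗ₜ 1) - D (Q ⊗ₜ 1)) := by
      rw [S]; linear_combination (norm := module) (1 / 2 : ℝ) • D_add_E_add_F (Q ⊗ₜ 1)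
    rw [h]; exact Submodule.smul_mem _ _ (sub_mem h_S h_D)
  rw [← labelledL_apply hQ, eq_sum_ofEntries P]
  simp only [map_add, map_smul, map_sum, labelledL_apply, ← D_eq_labelled hQ, ← E_eq_labelled hQ,
    ← GS_eq_labelled hQ, ← off_tmul_eq_labelled hQ]
  exact add_mem (add_mem (add_mem (Submodule.smul_mem _ _ h_D) (Submodule.smul_mem _ _ h_E))
    (Submodule.smul_mem _ _ h_GS)) (sum_mem fun t _ => h_off t _)

theorem range_labelledL {Q : Oct 1} (hQ : Q ∈ labelSpan) :
    LinearMap.range (labelledL hQ) = H Q := by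
  refine le_antisymm ?_ (Submodule.span_le.2 ?_)
  · rintro _ ⟨P, rfl⟩
    exact labelled_mem_H hQ P
  · have h_off (t : Fin 3) (p : Oct (-1)) : off t (Q ⊗ₜ p) ∈ LinearMap.range (labelledL hQ) :=
      ⟨_, (off_tmul_eq_labelled hQ t p).symm⟩
    have h_D : D (Q ⊗ₜ 1) ∈ LinearMap.range (labelledL hQ) := ⟨_, (D_eq_labelled hQ).symm⟩
    have h_E : E (Q ⊗ₜ 1) ∈ LinearMap.range (labelledL hQ) := ⟨_, (E_eq_labelled hQ).symm⟩
    have h_F : F (Q ⊗ₜ 1) ∈ LinearMap.range (labelledL hQ) := by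
      rw [eq_neg_of_add_eq_zero_right (D_add_E_add_F (Q ⊗ₜ 1))]
      exact neg_mem (add_mem h_D h_E)
    rintro x (((⟨n, rfl⟩ | ⟨n, rfl⟩) | ⟨n, rfl⟩) | rfl | rfl | rfl)
    exacts [h_off _ _, h_off _ _, h_off _ _, h_D, sub_mem h_E h_F, ⟨_, (GS_eq_labelled hQ).symm⟩]

theorem finrank_H {Q : Oct 1} (hQ : Q ∈ labelSpan) (h0 : Q ≠ 0) :
    Module.finrank ℝ (H Q) = 27 := by
  rw [← range_labelledL hQ, LinearMap.finrank_range_of_inj (labelled_injective hQ h0),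
    Albert.finrank_eq]

end e8

namespace Oct

theorem ip_mul_left {γ : ℝ} (a b c : Oct γ) : ip (a * b) c = ip b (star a * c) := by
  rw [ip_comm, ← star_star (a * b), star_mul, ip_cyc, ip_star]

theorem ip_mul_right {γ : ℝ} (a b c : Oct γ) : ip (a * b) c = ip a (c * star b) := by
  rw [← ip_star, star_mul, ip_mul_left, star_star, ← ip_star, star_star, star_mul, star_star]

theorem ip_self_nonneg (p : Oct (-1)) : 0 ≤ ip p p := by
  obtain ⟨a0, a1, a2, a3, a4, a5, a6, a7, rfl⟩ := eq_co p
  rw [co_ip]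
  ring_nf
  positivity

end Oct

namespace Albert
open Oct

/-- The trace form `(P, R) ↦ Re tr (P R)` of the Albert algebra; since `R` is Hermitian, it is the
sum of the inner products of the entries. -/
def traceForm : LinearMap.BilinForm ℝ Albert :=
  ∑ i, ∑ j, ipL.compl₁₂ (Matrix.entryLinearMap ℝ (Oct (-1)) i j ∘ₗ Albert.subtype)
    (Matrix.entryLinearMap ℝ (Oct (-1)) i j ∘ₗ Albert.subtype)

theorem traceForm_apply (P R : Albert) :
    traceForm P R = ∑ i, ∑ j, ip (P.1 i j) (R.1 i j) := by
  simp [traceForm, LinearMap.sum_apply]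

theorem traceForm_act (M : Matrix (Fin 3) (Fin 3) (Oct (-1))) (P R : Albert) :
    traceForm (act M P) R = traceForm P (act Mᴴ R) := by
  have h_left : ∑ i, ∑ j, ∑ k, ip (M i k * P.1 k j) (R.1 i j) =
      ∑ i, ∑ j, ∑ k, ip (P.1 i j) (star (M k i) * R.1 k j) := by
    simp only [ip_mul_left]
    rw [Finset.sum_comm, Finset.sum_congr rfl fun j _ => Finset.sum_comm, Finset.sum_comm]
  have h_right (i : Fin 3) : ∑ j, ∑ k, ip (P.1 i k * star (M j k)) (R.1 i j) =
      ∑ j, ∑ k, ip (P.1 i j) (R.1 i k * M k j) := by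
    simp only [ip_mul_right, star_star]
    exact Finset.sum_comm
  simp only [traceForm_apply, act_apply, ← ipL_apply, map_sum, LinearMap.sum_apply, map_add,
    LinearMap.add_apply, Finset.sum_add_distrib]
  simp only [ipL_apply, h_left, h_right, Matrix.conjTranspose_apply, star_star]

theorem traceForm_nondegenerate : traceForm.Nondegenerate := by
  have h_self (P : Albert) (h : traceForm P P = 0) : P = 0 := by
    rw [traceForm_apply] at h
    refine Subtype.ext (Matrix.ext fun i j => ip_self_eq_zero.1 ?_)
    have h_row := (Finset.sum_eq_zero_iff_of_nonneg fun i _ =>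
      Finset.sum_nonneg fun j _ => ip_self_nonneg (P.1 i j)).1 h i (Finset.mem_univ i)
    exact (Finset.sum_eq_zero_iff_of_nonneg fun j _ => ip_self_nonneg (P.1 i j)).1 h_row j
      (Finset.mem_univ j)
  exact ⟨fun P h => h_self P (h P), fun P h => h_self P (h P)⟩

end Albert

section Intertwining
variable {R L L' M A : Type*} [CommRing R] [LieRing L] [LieAlgebra R L] [LieRing L']
  [LieAlgebra R L'] [AddCommGroup M] [Module R M] [LieRingModule L M] [LieModule R L M]
  [AddCommGroup A] [Module R A] [LieRingModule L' A] [LieModule R L' A]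

variable (L L') in
/-- The pairs `(x, y)` such that the linear map `φ` carries the action of `y` to the action
of `x`. -/
def intertwining (φ : A →ₗ[R] M) : LieSubalgebra R (L × L') where
  carrier := {p | ∀ a, ⁅p.1, φ a⁆ = φ ⁅p.2, a⁆}
  zero_mem' a := by simp
  add_mem' hp hq a := by simp [hp a, hq a]
  smul_mem' r p hp a := by simp [hp a]
  lie_mem' := by
    rintro p q (hp : ∀ a, _) (hq : ∀ a, _) a
    simp [hp, hq]

end Intertwining

section GraphEquiv
variable {R L L' : Type*} [CommRing R] [LieRing L] [LieAlgebra R L] [LieRing L'] [LieAlgebra R L']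

/-- The isomorphism from a Lie subalgebra to its image under a homomorphism that is injective
on it. -/
def mapEquivOfInjective {f : L →ₗ⁅R⁆ L'} {Γ : LieSubalgebra R L} {K : LieSubalgebra R L'}
    (hf : Function.Injective (f.comp Γ.incl)) (hK : Γ.map f = K) : Γ ≃ₗ⁅R⁆ K :=
  (LieEquiv.ofInjective _ hf).trans (LieEquiv.ofEq _ K (by rw [← hK]; ext; simp))

variable {Γ : LieSubalgebra R (L × L')} {K : LieSubalgebra R L} {K' : LieSubalgebra R L'}

theorem fst_injective_of_forall_mem (h : ∀ y, (0, y) ∈ Γ → y = 0) :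
    Function.Injective ((LieHom.fst R L L').comp Γ.incl) :=
  (injective_iff_map_eq_zero _).2 fun ⟨⟨_, y⟩, hp⟩ (hx : _ = 0) => by
    subst hx
    exact Subtype.ext (Prod.ext rfl (h y hp))

theorem snd_injective_of_forall_mem (h : ∀ x, (x, 0) ∈ Γ → x = 0) :
    Function.Injective ((LieHom.snd R L L').comp Γ.incl) :=
  (injective_iff_map_eq_zero _).2 fun ⟨⟨x, _⟩, hp⟩ (hy : _ = 0) => by
    subst hy
    exact Subtype.ext (Prod.ext (h x hp) rfl)

/-- The isomorphism from `K` to `K'` with graph `Γ`. -/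
def graphEquiv (hK : Γ.map (LieHom.fst R L L') = K) (hK' : Γ.map (LieHom.snd R L L') = K')
    (h_fst : ∀ y, (0, y) ∈ Γ → y = 0) (h_snd : ∀ x, (x, 0) ∈ Γ → x = 0) : K ≃ₗ⁅R⁆ K' :=
  (mapEquivOfInjective (fst_injective_of_forall_mem h_fst) hK).symm.trans
    (mapEquivOfInjective (snd_injective_of_forall_mem h_snd) hK')

theorem mk_graphEquiv_mem (hK : Γ.map (LieHom.fst R L L') = K)
    (hK' : Γ.map (LieHom.snd R L L') = K') (h_fst : ∀ y, (0, y) ∈ Γ → y = 0)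
    (h_snd : ∀ x, (x, 0) ∈ Γ → x = 0) (x : K) :
    ((x : L), (graphEquiv hK hK' h_fst h_snd x : L')) ∈ Γ := by
  let e := mapEquivOfInjective (fst_injective_of_forall_mem h_fst) hK
  have h_graph : ((x : L), (graphEquiv hK hK' h_fst h_snd x : L')) = (e.symm x : L × L') :=
    Prod.ext (congrArg Subtype.val (e.apply_symm_apply x)).symm rfl
  rw [h_graph]
  exact (e.symm x).2

theorem graphEquiv_eq_of_mem (hK : Γ.map (LieHom.fst R L L') = K)
    (hK' : Γ.map (LieHom.snd R L L') = K') (h_fst : ∀ y, (0, y) ∈ Γ → y = 0)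
    (h_snd : ∀ x, (x, 0) ∈ Γ → x = 0) {x : K} {y : L'} (hxy : ((x : L), y) ∈ Γ) :
    (graphEquiv hK hK' h_fst h_snd x : L') = y := by
  have h := sub_mem (mk_graphEquiv_mem hK hK' h_fst h_snd x) hxy
  rw [Prod.mk_sub_mk, sub_self] at h
  exact sub_eq_zero.1 (h_fst _ h)

end GraphEquiv

section LieModuleEquiv
variable {R L M A : Type*} [CommRing R] [LieRing L] [AddCommGroup M] [Module R M]
  [LieRingModule L M] [AddCommGroup A] [Module R A] [LieRingModule L A]

/-- The isomorphism from `A` to the range of an injective homomorphism of Lie modules. -/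
def lieModuleEquivOfRangeEq {f : A →ₗ⁅R,L⁆ M} (hf : Function.Injective f)
    {N : LieSubmodule R L M} (hN : LinearMap.range (f : A →ₗ[R] M) = N.toSubmodule) :
    A ≃ₗ⁅R,L⁆ N where
  __ := (LinearEquiv.ofInjective (f : A →ₗ[R] M) hf).trans (LinearEquiv.ofEq _ _ hN)
  map_lie' := Subtype.ext (f.map_lie _ _)

theorem nonempty_lieModuleEquiv_iff {B N : Type*} [AddCommGroup B] [Module R B]
    [LieRingModule L B] [AddCommGroup N] [Module R N] [LieRingModule L N]
    (hAB : IsEmpty (A ≃ₗ⁅R,L⁆ B)) {p q : Prop}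
    (hM : p ∧ Nonempty (A ≃ₗ⁅R,L⁆ M) ∨ ¬p ∧ Nonempty (B ≃ₗ⁅R,L⁆ M))
    (hN : q ∧ Nonempty (A ≃ₗ⁅R,L⁆ N) ∨ ¬q ∧ Nonempty (B ≃ₗ⁅R,L⁆ N)) :
    Nonempty (M ≃ₗ⁅R,L⁆ N) ↔ (p ↔ q) := by
  rcases hM with ⟨hp, ⟨e⟩⟩ | ⟨hp, ⟨e⟩⟩ <;> rcases hN with ⟨hq, ⟨e'⟩⟩ | ⟨hq, ⟨e'⟩⟩
  · exact iff_of_true ⟨e.symm.trans e'⟩ (iff_of_true hp hq)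
  · exact iff_of_false (fun ⟨f⟩ => hAB.false ((e.trans f).trans e'.symm)) (hq <| ·.1 hp)
  · exact iff_of_false (fun ⟨f⟩ => hAB.false ((e'.trans f.symm).trans e.symm)) (hp <| ·.2 hq)
  · exact iff_of_true ⟨e.symm.trans e'⟩ (iff_of_false hp hq)

end LieModuleEquiv

namespace Albert

theorem act_neg (M : Matrix (Fin 3) (Fin 3) (Oct (-1))) : act (-M) = -act M := by
  refine LinearMap.ext fun P => Subtype.ext (Matrix.ext fun i j => ?_)
  change (act (-M) P).1 i j = -(act M P).1 i j
  rw [act_apply, act_apply, ← Finset.sum_neg_distrib]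
  refine Finset.sum_congr rfl fun k _ => ?_
  rw [Matrix.neg_apply, Matrix.neg_apply, star_neg, neg_mul, mul_neg, neg_add]

/-- The identification of the Albert algebra with its dual by the trace form. -/
def toDual : Albert ≃ₗ[ℝ] Module.Dual ℝ Albert :=
  LinearMap.BilinForm.toDual traceForm traceForm_nondegenerate

theorem lie_act_toDual (M : Matrix (Fin 3) (Fin 3) (Oct (-1))) (P : Albert) :
    ⁅act M, toDual P⁆ = -toDual (act Mᴴ P) := by
  refine LinearMap.ext fun R => ?_
  rw [Module.Dual.lie_apply, Module.End.lie_apply, LinearMap.neg_apply]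
  change -traceForm P (act M R) = -traceForm (act Mᴴ P) R
  rw [traceForm_act, Matrix.conjTranspose_conjTranspose]

end Albert

namespace Oct

theorem labelPart_mem_labelSpan (S : Oct 1) : labelPart S ∈ labelSpan := by
  constructor
  · change ip 1 (labelPart S) = 0
    rw [labelPart, ← ipL_apply, map_add, map_sub, map_smul, map_smul]
    simp [ip_one_one, ip_one_l]
  · change ip l (labelPart S) = 0
    rw [labelPart, ← ipL_apply, map_add, map_sub, map_smul, map_smul]
    simp [ip_l_l, ip_l_one]

end Oct

namespace e8
open GMat Oct Albert

theorem eq_zero_of_forall_lie_off {x : e8} (h : ∀ t c, ⁅x, off t c⁆ = 0) : x = 0 := by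
  have h_off (i : Fin 3) : x.1.2 i = 0 := by
    have h1 : i ≠ i + 1 := by revert i; decide
    have h2 : i + 2 ≠ i + 1 := by revert i; decide
    have h_snd := congrArg (fun y : e8 => y.1.2 (i + 2)) (h (i + 1) 1)
    simpa [lie_snd, off_snd, h1, h2, add3, add4] using h_snd
  refine ext (fun i c => ?_) h_off
  have h_diag := congrArg (fun y : e8 => y.1.2 i) (h i c)
  simpa [lie_off_of_snd_eq_zero h_off, off_snd] using h_diag

theorem eq_zero_of_forall_lie_off_label {x : e8}
    (h : ∀ t, ∀ Q ∈ labelSpan, ∀ p, ⁅x, off t (Q ⊗ₜ p)⁆ = 0) : x = 0 := by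
  have h_mul {Q R : Oct 1} (hQ : Q ∈ labelSpan) (hR : R ∈ labelSpan) (t : Fin 3) (p : Oct (-1)) :
      ⁅x, off t ((-star (Q * R)) ⊗ₜ p)⁆ = 0 := by
    have h_lie := lie_off_succ (t + 1) (Q ⊗ₜ 1) (R ⊗ₜ star p)
    rw [BiOct.mul_tmul, BiOct.star_tmul, one_mul, star_star, ← TensorProduct.neg_tmul, add2]
      at h_lie
    rw [← h_lie, leibniz_lie, h _ _ hQ, h _ _ hR, lie_zero, zero_lie, zero_add]
  have h_one (t : Fin 3) (p : Oct (-1)) : ⁅x, off t (1 ⊗ₜ p)⁆ = 0 := by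
    convert h_mul (co_mem_labelSpan 1 0 0 0 0 0) (co_mem_labelSpan 1 0 0 0 0 0) t p
    rw [co_mul, co_star, co_neg, one_eq_co]
    apply co_congr <;> ring
  have h_l (t : Fin 3) (p : Oct (-1)) : ⁅x, off t (l ⊗ₜ p)⁆ = 0 := by
    convert h_mul (co_mem_labelSpan 1 0 0 0 0 0) (co_mem_labelSpan 0 0 0 (-1) 0 0) t p
    rw [co_mul, co_star, co_neg, l]
    apply co_congr <;> ring
  refine eq_zero_of_forall_lie_off fun t c => ?_
  induction c using TensorProduct.induction_on with
  | zero => rw [← offL_apply, map_zero, lie_zero]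
  | add c d hc hd => rw [off_add, lie_add, hc, hd, add_zero]
  | tmul S p =>
    have h_S : S = ip 1 S • 1 - ip l S • l + labelPart S := by rw [labelPart]; abel
    rw [h_S]
    simp only [TensorProduct.add_tmul, TensorProduct.sub_tmul, ← TensorProduct.smul_tmul',
      ← offL_apply, map_add, map_sub, map_smul, lie_add, lie_sub, lie_smul]
    simp only [offL_apply, h_one, h_l, h t _ (labelPart_mem_labelSpan S), smul_zero, sub_zero,
      add_zero]

theorem ofMatrix_mulLabel_mem_e6 {R : Oct 1} (hR : ∀ p, R ⊗ₜ p ∈ BiOct.splitComplex)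
    (M : Matrix (Fin 3) (Fin 3) (Oct (-1))) : ofMatrix (mulLabel R M) ∈ e6 := by
  rw [e6_eq_su3]
  have h_off (t : Fin 3) (p : Oct (-1)) : off t (R ⊗ₜ p) ∈ su3 := off_mem_su3 t (hR p)
  have h_half_lie (t : Fin 3) (p : Oct (-1)) :
      (1 / 2 : ℝ) • ⁅off t (1 ⊗ₜ 1), off t (R ⊗ₜ p)⁆ ∈ su3 :=
    su3.smul_mem _ (su3.lie_mem (off_mem_su3 t (BiOct.one_tmul_mem_splitComplex 1)) (h_off t p))
  exact sub_mem (add_mem (add_mem (add_mem (h_off _ _) (h_off _ _)) (h_off _ _))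
    (h_half_lie _ _)) (h_half_lie _ _)

theorem rotation_mem_e6 (M : Matrix (Fin 3) (Fin 3) (Oct (-1))) : rotation M ∈ e6 :=
  ofMatrix_mulLabel_mem_e6 BiOct.one_tmul_mem_splitComplex M

theorem boost_mem_e6 (M : Matrix (Fin 3) (Fin 3) (Oct (-1))) : boost M ∈ e6 :=
  ofMatrix_mulLabel_mem_e6 BiOct.l_tmul_mem_splitComplex M

theorem exists_rotation_eq_off (t : Fin 3) (p : Oct (-1)) :
    ∃ M : Matrix (Fin 3) (Fin 3) (Oct (-1)), Mᴴ = -M ∧ M.trace = 0 ∧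
      rotation M = off t (1 ⊗ₜ p) := by
  have h_ne : t ≠ t + 1 := by revert t; decide
  have hM : (Matrix.single t (t + 1) p - Matrix.single (t + 1) t (star p))ᴴ =
      -(Matrix.single t (t + 1) p - Matrix.single (t + 1) t (star p)) := by
    rw [Matrix.conjTranspose_sub, Matrix.conjTranspose_single, Matrix.conjTranspose_single,
      star_star, neg_sub]
  have htr : (Matrix.single t (t + 1) p - Matrix.single (t + 1) t (star p)).trace = 0 := by
    rw [Matrix.trace_sub, Matrix.trace_single_eq_of_ne _ _ _ h_ne,
      Matrix.trace_single_eq_of_ne _ _ _ h_ne.symm, sub_zero]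
  refine ⟨_, hM, htr, ext_tmul (fun n S s => ?_) (fun n => ?_)⟩
  · rw [rotation_fst_tmul hM htr]
    fin_cases t <;> fin_cases n <;> simp
  · rw [rotation_snd, off_snd]
    fin_cases t <;> fin_cases n <;> simp

theorem exists_boost_eq_off (t : Fin 3) (p : Oct (-1)) :
    ∃ M : Matrix (Fin 3) (Fin 3) (Oct (-1)), Mᴴ = M ∧ M.trace = 0 ∧
      boost M = off t (l ⊗ₜ p) := by
  have h_ne : t ≠ t + 1 := by revert t; decide
  have hM : (Matrix.single t (t + 1) p + Matrix.single (t + 1) t (star p))ᴴ =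
      (Matrix.single t (t + 1) p + Matrix.single (t + 1) t (star p)) := by
    rw [Matrix.conjTranspose_add, Matrix.conjTranspose_single, Matrix.conjTranspose_single,
      star_star, add_comm]
  have htr : (Matrix.single t (t + 1) p + Matrix.single (t + 1) t (star p)).trace = 0 := by
    rw [Matrix.trace_add, Matrix.trace_single_eq_of_ne _ _ _ h_ne,
      Matrix.trace_single_eq_of_ne _ _ _ h_ne.symm, add_zero]
  have h_diag : diagEntry ⟨_, hM⟩ = 0 := by
    funext n
    fin_cases t <;> fin_cases n <;> simp [diagEntry]
  refine ⟨_, hM, htr, ext_tmul (fun n S s => ?_) (fun n => ?_)⟩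
  · rw [boost_fst_tmul hM htr, h_diag, diagOp_of_sum_eq_zero l (by simp)]
    simp
  · rw [boost_snd, off_snd]
    fin_cases t <;> fin_cases n <;> simp

/-- The graph of the action of `𝔢₆` on the Albert algebra: the Lie algebra generated by the pairs
of a rotation or a boost and the operator that it stands for. -/
def actionGraph : LieSubalgebra ℝ (e8 × Module.End ℝ Albert) :=
  LieSubalgebra.lieSpan ℝ _ {p | ∃ M : Matrix (Fin 3) (Fin 3) (Oct (-1)), M.trace = 0 ∧
    (Mᴴ = -M ∧ p = (rotation M, act M) ∨ Mᴴ = M ∧ p = (boost M, act M))}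

theorem rotation_mem_actionGraph {M : Matrix (Fin 3) (Fin 3) (Oct (-1))} (hM : Mᴴ = -M)
    (htr : M.trace = 0) : (rotation M, act M) ∈ actionGraph :=
  LieSubalgebra.subset_lieSpan ⟨M, htr, .inl ⟨hM, rfl⟩⟩

theorem boost_mem_actionGraph {M : Matrix (Fin 3) (Fin 3) (Oct (-1))} (hM : Mᴴ = M)
    (htr : M.trace = 0) : (boost M, act M) ∈ actionGraph :=
  LieSubalgebra.subset_lieSpan ⟨M, htr, .inr ⟨hM, rfl⟩⟩

theorem actionGraph_le {K : LieSubalgebra ℝ (e8 × Module.End ℝ Albert)}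
    (h_rotation : ∀ M, Mᴴ = -M → M.trace = 0 → (rotation M, act M) ∈ K)
    (h_boost : ∀ M, Mᴴ = M → M.trace = 0 → (boost M, act M) ∈ K) : actionGraph ≤ K := by
  refine LieSubalgebra.lieSpan_le.2 ?_
  rintro _ ⟨M, htr, ⟨hM, rfl⟩ | ⟨hM, rfl⟩⟩
  exacts [h_rotation M hM htr, h_boost M hM htr]

theorem map_fst_actionGraph : actionGraph.map (LieHom.fst ℝ e8 (Module.End ℝ Albert)) = e6 := by
  refine le_antisymm (LieSubalgebra.map_le_iff_le_comap.2 (actionGraph_le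
    (fun M _ _ => rotation_mem_e6 M) (fun M _ _ => boost_mem_e6 M))) (e6_le ?_ ?_)
  · intro t p
    obtain ⟨M, hM, htr, h⟩ := exists_rotation_eq_off t p
    exact ⟨_, rotation_mem_actionGraph hM htr, h⟩
  · intro t p
    obtain ⟨M, hM, htr, h⟩ := exists_boost_eq_off t p
    exact ⟨_, boost_mem_actionGraph hM htr, h⟩

theorem map_snd_actionGraph :
    actionGraph.map (LieHom.snd ℝ e8 (Module.End ℝ Albert)) = sl3O := by
  refine le_antisymm (LieSubalgebra.map_le_iff_le_comap.2 (actionGraph_le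
    (fun M hM htr => LieSubalgebra.subset_lieSpan ⟨M, htr, .inl hM, rfl⟩)
    (fun M hM htr => LieSubalgebra.subset_lieSpan ⟨M, htr, .inr hM, rfl⟩)))
    (LieSubalgebra.lieSpan_le.2 ?_)
  rintro _ ⟨M, htr, hM | hM, rfl⟩
  exacts [⟨_, rotation_mem_actionGraph hM htr, rfl⟩, ⟨_, boost_mem_actionGraph hM htr, rfl⟩]

theorem actionGraph_le_intertwining {Q : Oct 1} (hQ : Q ∈ labelSpan) (h : l * Q = Q) :
    actionGraph ≤ intertwining e8 (Module.End ℝ Albert) (labelledL hQ) :=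
  actionGraph_le (fun _ hM htr P => lie_rotation_labelled hQ hM htr P)
    (fun _ hM htr P => (lie_boost_labelled hQ hM htr P).trans (by rw [h]; rfl))

/-- The dual of the Albert algebra, embedded as `H_Q` by the trace form. -/
def dualLabelledL {Q : Oct 1} (hQ : Q ∈ labelSpan) : Module.Dual ℝ Albert →ₗ[ℝ] e8 :=
  labelledL hQ ∘ₗ toDual.symm.toLinearMap

theorem dualLabelledL_toDual {Q : Oct 1} (hQ : Q ∈ labelSpan) (P : Albert) :
    dualLabelledL hQ (toDual P) = labelled Q P := by
  simp [dualLabelledL]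

theorem dualLabelledL_injective {Q : Oct 1} (hQ : Q ∈ labelSpan) (h0 : Q ≠ 0) :
    Function.Injective (dualLabelledL hQ) :=
  (labelled_injective hQ h0).comp toDual.symm.injective

theorem range_dualLabelledL {Q : Oct 1} (hQ : Q ∈ labelSpan) :
    LinearMap.range (dualLabelledL hQ) = H Q := by
  rw [dualLabelledL, LinearMap.range_comp_of_range_eq_top _ (LinearEquiv.range _),
    range_labelledL]

theorem actionGraph_le_intertwining_dual {Q : Oct 1} (hQ : Q ∈ labelSpan) (h : l * Q = -Q) :
    actionGraph ≤ intertwining e8 (Module.End ℝ Albert) (dualLabelledL hQ) := by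
  refine actionGraph_le (fun M hM htr f => ?_) (fun M hM htr f => ?_)
  · obtain ⟨P, rfl⟩ := toDual.surjective f
    rw [dualLabelledL_toDual, lie_rotation_labelled hQ hM htr, lie_act_toDual, hM, act_neg,
      LinearMap.neg_apply, map_neg, map_neg, map_neg, neg_neg, dualLabelledL_toDual]
  · obtain ⟨P, rfl⟩ := toDual.surjective f
    rw [dualLabelledL_toDual, lie_boost_labelled hQ hM htr, lie_act_toDual, hM, h,
      labelled_neg_label hQ, map_neg, dualLabelledL_toDual]

theorem eq_zero_of_zero_mk_mem_actionGraph {T : Module.End ℝ Albert}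
    (hT : (0, T) ∈ actionGraph) : T = 0 := by
  let Q : Oct 1 := co 0 (1 / 2) 0 0 0 (-1 / 2) 0 0
  have hQ : Q ∈ labels := mem_labels.2 (.inr (.inl rfl))
  have hlQ : l * Q = Q := by rw [l_mul_co]; apply co_congr <;> norm_num
  have hQ' := mem_labelSpan_of_mem_labels hQ
  refine LinearMap.ext fun P => labelled_injective hQ' (ne_zero_of_mem_labels hQ) ?_
  have h_lie : ⁅(0 : e8), labelled Q P⁆ = labelled Q (T P) :=
    actionGraph_le_intertwining hQ' hlQ hT P
  rw [← h_lie, zero_lie, LinearMap.zero_apply, ← labelledL_apply hQ', map_zero]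

theorem eq_zero_of_mk_zero_mem_actionGraph {x : e8} (hx : (x, 0) ∈ actionGraph) : x = 0 := by
  have h_eq {Q : Oct 1} (hQ : Q ∈ labelSpan) (h : l * Q = Q) (P : Albert) :
      ⁅x, labelled Q P⁆ = 0 := by
    have h_lie : ⁅x, labelled Q P⁆ = labelledL hQ 0 := actionGraph_le_intertwining hQ h hx P
    rw [h_lie, map_zero]
  have h_eq_neg {Q : Oct 1} (hQ : Q ∈ labelSpan) (h : l * Q = -Q) (P : Albert) :
      ⁅x, labelled Q P⁆ = 0 := by
    have h_lie : ⁅x, dualLabelledL hQ (toDual P)⁆ = dualLabelledL hQ 0 :=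
      (actionGraph_le_intertwining_dual hQ h hx (toDual P)).trans
        (congrArg _ (zero_lie (L := Module.End ℝ Albert) (toDual P)))
    rw [← dualLabelledL_toDual hQ, h_lie, map_zero]
  refine eq_zero_of_forall_lie_off_label fun t Q hQ p => ?_
  have hlQ := l_mul_mem_labelSpan hQ
  have h_add := h_eq (add_mem hQ hlQ) (by rw [mul_add, l_mul_l_mul hQ, add_comm])
    (ofEntries 0 (Pi.single t p))
  have h_sub := h_eq_neg (sub_mem hQ hlQ) (by rw [mul_sub, l_mul_l_mul hQ, neg_sub])
    (ofEntries 0 (Pi.single t p))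
  rw [← off_tmul_eq_labelled (add_mem hQ hlQ), TensorProduct.add_tmul, off_add, lie_add] at h_add
  rw [← off_tmul_eq_labelled (sub_mem hQ hlQ), TensorProduct.sub_tmul, ← offL_apply, map_sub,
    offL_apply, offL_apply, lie_sub] at h_sub
  linear_combination (norm := module) (1 / 2 : ℝ) • h_add + (1 / 2 : ℝ) • h_sub

/-- The isomorphism from `𝔢₆` to `𝔰𝔩(3, 𝕆)` by which rotations and boosts act on the Albert
algebra. -/
def equivSl3O : e6 ≃ₗ⁅ℝ⁆ sl3O :=
  graphEquiv map_fst_actionGraph map_snd_actionGraph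
    (fun _ => eq_zero_of_zero_mk_mem_actionGraph) (fun _ => eq_zero_of_mk_zero_mem_actionGraph)

theorem mk_equivSl3O_mem (x : e6) : ((x : e8), (equivSl3O x : Module.End ℝ Albert)) ∈ actionGraph :=
  mk_graphEquiv_mem ..

theorem equivSl3O_rotation {M : Matrix (Fin 3) (Fin 3) (Oct (-1))} (hM : Mᴴ = -M)
    (htr : M.trace = 0) :
    (equivSl3O ⟨rotation M, rotation_mem_e6 M⟩ : Module.End ℝ Albert) = act M :=
  graphEquiv_eq_of_mem _ _ _ _ (rotation_mem_actionGraph hM htr)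

theorem equivSl3O_boost {M : Matrix (Fin 3) (Fin 3) (Oct (-1))} (hM : Mᴴ = M)
    (htr : M.trace = 0) :
    (equivSl3O ⟨boost M, boost_mem_e6 M⟩ : Module.End ℝ Albert) = act M :=
  graphEquiv_eq_of_mem _ _ _ _ (boost_mem_actionGraph hM htr)

end e8

namespace Albert

theorem conjTranspose_diagonal_smul_one (a : Fin 3 → ℝ) :
    (Matrix.diagonal fun n => a n • (1 : Oct (-1)))ᴴ = Matrix.diagonal fun n => a n • 1 := by
  rw [Matrix.diagonal_conjTranspose]
  congr 1
  funext n
  simp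

theorem act_diagonal_apply (a : Fin 3 → ℝ) (P : Albert) (m n : Fin 3) :
    (act (Matrix.diagonal fun n => a n • 1) P).1 m n = (a m + a n) • P.1 m n := by
  rw [act_apply]
  simp only [Matrix.diagonal_apply, Finset.sum_add_distrib, ite_mul, apply_ite star, mul_ite,
    star_zero, zero_mul, mul_zero, Finset.sum_ite_eq, Finset.mem_univ, if_true, star_smul,
    star_one, star_trivial, smul_mul_assoc, mul_smul_comm, one_mul, mul_one, add_smul]

theorem act_diagonal_ofEntries_single (a : Fin 3 → ℝ) (i : Fin 3) :
    act (Matrix.diagonal fun n => a n • 1) (ofEntries (Pi.single i 1) 0) =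
      (2 * a i) • ofEntries (Pi.single i 1) 0 := by
  refine Subtype.ext (Matrix.ext fun m n => ?_)
  change _ = (2 * a i) • (ofEntries (Pi.single i 1) 0).1 m n
  rw [act_diagonal_apply]
  fin_cases i <;> fin_cases m <;> fin_cases n <;> simp [ofEntries, two_mul]

theorem eq_zero_of_act_diagonal_eq_smul {a : Fin 3 → ℝ} {μ : ℝ} {P : Albert}
    (hμ : ∀ m n, a m + a n ≠ μ) (h : act (Matrix.diagonal fun n => a n • 1) P = μ • P) :
    P = 0 := by
  refine Subtype.ext (Matrix.ext fun m n => ?_)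
  have h_entry : (a m + a n) • P.1 m n = μ • P.1 m n := by
    rw [← act_diagonal_apply, h]
    rfl
  rw [← sub_eq_zero, ← sub_smul] at h_entry
  exact (smul_eq_zero.1 h_entry).resolve_left (sub_ne_zero.2 (hμ m n))

end Albert

namespace e8
open GMat Oct Albert

instance : LieRingModule e6 Albert :=
  LieRingModule.compLieHom Albert (sl3O.incl.comp equivSl3O.toLieHom)

instance : LieModule ℝ e6 Albert :=
  LieModule.compLieHom Albert (sl3O.incl.comp equivSl3O.toLieHom)

theorem lie_eq_act (x : e6) (P : Albert) : ⁅x, P⁆ = (equivSl3O x : Module.End ℝ Albert) P :=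
  rfl

theorem lie_labelled {Q : Oct 1} (hQ : Q ∈ labelSpan) (h : l * Q = Q) (x : e6) (P : Albert) :
    ⁅x, labelled Q P⁆ = labelled Q ⁅x, P⁆ :=
  actionGraph_le_intertwining hQ h (mk_equivSl3O_mem x) P

theorem lie_dualLabelledL {Q : Oct 1} (hQ : Q ∈ labelSpan) (h : l * Q = -Q) (x : e6)
    (f : Module.Dual ℝ Albert) : ⁅x, dualLabelledL hQ f⁆ = dualLabelledL hQ ⁅x, f⁆ :=
  actionGraph_le_intertwining_dual hQ h (mk_equivSl3O_mem x) f

/-- For `LQ = Q`, the map `P ↦ QP` as a homomorphism of representations of `𝔢₆`. -/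
def labelledHom {Q : Oct 1} (hQ : Q ∈ labelSpan) (h : l * Q = Q) : Albert →ₗ⁅ℝ,e6⁆ e8 where
  __ := labelledL hQ
  map_lie' := (lie_labelled hQ h _ _).symm

/-- For `LQ = -Q`, the embedding of the dual of the Albert algebra as `H_Q`, as a homomorphism of
representations of `𝔢₆`. -/
def dualLabelledHom {Q : Oct 1} (hQ : Q ∈ labelSpan) (h : l * Q = -Q) :
    Module.Dual ℝ Albert →ₗ⁅ℝ,e6⁆ e8 where
  __ := dualLabelledL hQ
  map_lie' := (lie_dualLabelledL hQ h _ _).symm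

/-- The representation of `𝔢₆` generated by `H_Q`, equal to `H_Q` when `Q` is a label. -/
def labelModule (Q : Oct 1) : LieSubmodule ℝ e6 e8 :=
  LieSubmodule.lieSpan ℝ e6 (H Q : Set e8)

theorem labelModule_toSubmodule {Q : Oct 1} (hQ : Q ∈ labels) :
    (labelModule Q).toSubmodule = H Q := by
  have hQ' := mem_labelSpan_of_mem_labels hQ
  refine LieSubmodule.coe_lieSpan_submodule_eq_iff.2 ?_
  rcases l_mul_eq_or_eq_neg hQ with h | h
  · exact ⟨(labelledHom hQ' h).range, range_labelledL hQ'⟩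
  · exact ⟨(dualLabelledHom hQ' h).range, range_dualLabelledL hQ'⟩

/-- For `LQ = Q`, the representation `H_Q` is the Albert algebra. -/
def albertEquivLabelModule {Q : Oct 1} (hQ : Q ∈ labels) (h : l * Q = Q) :
    Albert ≃ₗ⁅ℝ,e6⁆ labelModule Q :=
  have hQ' := mem_labelSpan_of_mem_labels hQ
  lieModuleEquivOfRangeEq (f := labelledHom hQ' h)
    (labelled_injective hQ' (ne_zero_of_mem_labels hQ))
    ((range_labelledL hQ').trans (labelModule_toSubmodule hQ).symm)

/-- For `LQ = -Q`, the representation `H_Q` is the dual of the Albert algebra. -/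
def dualEquivLabelModule {Q : Oct 1} (hQ : Q ∈ labels) (h : l * Q = -Q) :
    Module.Dual ℝ Albert ≃ₗ⁅ℝ,e6⁆ labelModule Q :=
  have hQ' := mem_labelSpan_of_mem_labels hQ
  lieModuleEquivOfRangeEq (f := dualLabelledHom hQ' h)
    (dualLabelledL_injective hQ' (ne_zero_of_mem_labels hQ))
    ((range_dualLabelledL hQ').trans (labelModule_toSubmodule hQ).symm)

theorem isEmpty_albert_equiv_dual :
    IsEmpty (Albert ≃ₗ⁅ℝ,e6⁆ Module.Dual ℝ Albert) := by
  refine ⟨fun e => ?_⟩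
  let a : Fin 3 → ℝ := ![1, 1, -2]
  have h_last : a 2 = -2 := rfl
  let M : Matrix (Fin 3) (Fin 3) (Oct (-1)) := Matrix.diagonal fun n => a n • 1
  have hM : Mᴴ = M := conjTranspose_diagonal_smul_one a
  have htr : M.trace = 0 := by
    rw [Matrix.trace_diagonal, ← Finset.sum_smul,
      show ∑ n, a n = 0 by simp only [Fin.sum_univ_three, h_last]; norm_num [a], zero_smul]
  let x : e6 := ⟨boost M, boost_mem_e6 M⟩
  have hx : (equivSl3O x : Module.End ℝ Albert) = act M := equivSl3O_boost hM htr
  let P : Albert := ofEntries (Pi.single 2 1) 0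
  have hP : ⁅x, P⁆ = (-4 : ℝ) • P := by
    rw [lie_eq_act, hx, act_diagonal_ofEntries_single, h_last]
    norm_num [P]
  obtain ⟨R, hR⟩ := toDual.surjective (e P)
  have hR_eigen : act M R = (4 : ℝ) • R := by
    have h_dual : ⁅x, toDual R⁆ = (-4 : ℝ) • toDual R := by
      rw [hR, ← map_smul e, ← hP]
      exact (e.toLieModuleHom.map_lie x P).symm
    change ⁅(equivSl3O x : Module.End ℝ Albert), toDual R⁆ = _ at h_dual
    rw [hx, lie_act_toDual, hM] at h_dual
    refine toDual.injective (neg_injective (h_dual.trans ?_))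
    rw [map_smul]
    module
  have hR0 : R = 0 := eq_zero_of_act_diagonal_eq_smul
    (by intro m n; fin_cases m <;> fin_cases n <;> norm_num [a]) hR_eigen
  have hP0 : P = 0 := e.injective (by rw [← hR, hR0, map_zero, map_zero])
  have h_entry : diagEntry P 2 = 0 := by
    rw [hP0]
    rfl
  simp [P] at h_entry

theorem albert_or_dual_equiv_labelModule {Q : Oct 1} (hQ : Q ∈ labels) :
    l * Q = Q ∧ Nonempty (Albert ≃ₗ⁅ℝ,e6⁆ labelModule Q) ∨
      ¬l * Q = Q ∧ Nonempty (Module.Dual ℝ Albert ≃ₗ⁅ℝ,e6⁆ labelModule Q) :=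
  (l_mul_eq_or_eq_neg hQ).imp (fun h => ⟨h, ⟨albertEquivLabelModule hQ h⟩⟩)
    fun h => ⟨(l_mul_eq_neg_iff hQ).1 h, ⟨dualEquivLabelModule hQ h⟩⟩

theorem nonempty_equiv_iff {Q R : Oct 1} (hQ : Q ∈ labels) (hR : R ∈ labels) :
    Nonempty (labelModule Q ≃ₗ⁅ℝ,e6⁆ labelModule R) ↔ (l * Q = Q ↔ l * R = R) :=
  nonempty_lieModuleEquiv_iff isEmpty_albert_equiv_dual (albert_or_dual_equiv_labelModule hQ)
    (albert_or_dual_equiv_labelModule hR)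

end e8

end

theorem mainTheorem1 :
    -- the 78 generators close under the commutator
    (e8.e6.toSubmodule = Submodule.span ℝ e8.e6Generators ∧ Module.finrank ℝ e8.e6 = 78) ∧
    -- three labels have `LQ = Q`, the other three have `LQ = -Q`
    {Q ∈ e8.labels | Oct.l * Q = Q}.ncard = 3 ∧ {Q ∈ e8.labels | Oct.l * Q = -Q}.ncard = 3 ∧
    (∀ Q ∈ e8.labels, Oct.l * Q = Q ∨ Oct.l * Q = -Q) ∧
    -- identification of `𝔢₆` in `𝔢₈` with `𝔢₆` acting on the Albert algebra
    ∃ (Φ : e8.e6 ≃ₗ⁅ℝ⁆ Albert.sl3O) (N : Oct 1 → LieSubmodule ℝ e8.e6 e8),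
      (∀ M : Matrix (Fin 3) (Fin 3) (Oct (-1)), Mᴴ = -M → M.trace = 0 →
        ∃ hM : e8.rotation M ∈ e8.e6,
          (Φ ⟨e8.rotation M, hM⟩ : Module.End ℝ Albert) = Albert.act M) ∧
      (∀ M : Matrix (Fin 3) (Fin 3) (Oct (-1)), Mᴴ = M → M.trace = 0 →
        ∃ hM : e8.boost M ∈ e8.e6,
          (Φ ⟨e8.boost M, hM⟩ : Module.End ℝ Albert) = Albert.act M) ∧
      (∀ Q ∈ e8.labels,
        -- `H_Q` is a 27-dimensional representation of `𝔢₆` under the commutator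
        (N Q).toSubmodule = e8.H Q ∧ Module.finrank ℝ (e8.H Q) = 27 ∧
        -- its elements are the `Q𝓟` with `𝓟` in the Albert algebra
        IsLinearMap ℝ (e8.labelled Q) ∧ Function.Injective (e8.labelled Q) ∧
        Set.range (e8.labelled Q) = (e8.H Q : Set e8) ∧
        -- rotations and boosts act on `𝓟`, boosts up to the sign in `LQ = ±Q`
        (∀ M : Matrix (Fin 3) (Fin 3) (Oct (-1)), Mᴴ = -M → M.trace = 0 → ∀ P : Albert,
          ⁅e8.rotation M, e8.labelled Q P⁆ = e8.labelled Q (Albert.act M P)) ∧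
        (∀ M : Matrix (Fin 3) (Fin 3) (Oct (-1)), Mᴴ = M → M.trace = 0 → ∀ P : Albert,
          ⁅e8.boost M, e8.labelled Q P⁆ = e8.labelled (Oct.l * Q) (Albert.act M P)) ∧
        -- if `LQ = Q`, then `H_Q` is the representation of `𝔢₆` on the Albert algebra
        (Oct.l * Q = Q → ∀ (x : e8.e6) (P : Albert),
          ⁅(x : e8), e8.labelled Q P⁆ = e8.labelled Q ((Φ x : Module.End ℝ Albert) P)) ∧
        -- if `LQ = -Q`, then `H_Q` is the dual of that representation
        (Oct.l * Q = -Q → ∃ δ : Module.Dual ℝ Albert →ₗ[ℝ] e8,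
          Function.Injective δ ∧ LinearMap.range δ = e8.H Q ∧
          ∀ (x : e8.e6) (f : Module.Dual ℝ Albert),
            ⁅(x : e8), δ f⁆ = δ (-(f ∘ₗ (Φ x : Module.End ℝ Albert))))) ∧
      -- the two representations are inequivalent
      (∀ Q ∈ e8.labels, ∀ R ∈ e8.labels,
        Nonempty (N Q ≃ₗ⁅ℝ,e8.e6⁆ N R) ↔ (Oct.l * Q = Q ↔ Oct.l * R = R)) := by
  refine ⟨⟨e8.e6_eq_span, e8.finrank_e6⟩, Oct.ncard_l_mul_eq, Oct.ncard_l_mul_eq_neg,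
    fun Q hQ => Oct.l_mul_eq_or_eq_neg hQ, e8.equivSl3O, e8.labelModule,
    fun M hM htr => ⟨e8.rotation_mem_e6 M, e8.equivSl3O_rotation hM htr⟩,
    fun M hM htr => ⟨e8.boost_mem_e6 M, e8.equivSl3O_boost hM htr⟩, fun Q hQ => ?_,
    fun Q hQ R hR => e8.nonempty_equiv_iff hQ hR⟩
  have hQ' := Oct.mem_labelSpan_of_mem_labels hQ
  have h0 := Oct.ne_zero_of_mem_labels hQ
  exact ⟨e8.labelModule_toSubmodule hQ, e8.finrank_H hQ' h0, (e8.labelledL hQ').isLinear,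
    e8.labelled_injective hQ' h0, congrArg SetLike.coe (e8.range_labelledL hQ'),
    fun M hM htr => e8.lie_rotation_labelled hQ' hM htr,
    fun M hM htr => e8.lie_boost_labelled hQ' hM htr, fun h => e8.lie_labelled hQ' h,
    fun h => ⟨e8.dualLabelledL hQ', e8.dualLabelledL_injective hQ' h0,
      e8.range_dualLabelledL hQ', e8.lie_dualLabelledL hQ' h⟩⟩
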